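/- A \emph{canonical box} is a nonempty set $[x_1,+\infty)\times[y_1,y_2)\times[z_1,z_2)\subseteq\mathbb R^3$ with $x_1,y_1,z_1\in\mathbb R$ and $y_2,z_2\in\mathbb R\cup\{+\infty\}$. Given $n\ge 2$ canonical boxes (a finite family; ties between coordinates are allowed), consider the following structure of three layers of trees. \emph{Top layer:} a balanced segment tree over the $z$-ranges. Its leaves are the elementary intervals cut out by the distinct real endpoints of the $z$-ranges, each node $v$ has the interval $I(v)$ that is the union of the elementary intervals below it, and a box is assigned to $v$ if its $z$-range covers $I(v)$ but not the interval of the parent of $v$. \emph{Middle layer:} for every node of the segment tree, an interval tree over the $y$-ranges of the boxes assigned to it. A node built for a nonempty list of $m$ boxes holds the (lower) median $\mu$ of the $2m$ endpoints of their $y$-ranges; the boxes whose $y$-range contains $\mu$ are assigned to this node, and those whose $y$-range lies to the left (right) of $\mu$ go to its left (right) subtree. \emph{Bottom layer:} for every interval tree node, two balanced leaf-oriented binary range trees over the $y$-coordinates, one over the lower points $(x_1,y_1)$ and one over the upper points $(x_1,y_2)$ of the boxes assigned to that node. For a node $v$ of a range tree, the \emph{bottom list} $P(v)$ is the list of the boxes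 whose points are at the leaf descendants of $v$, sorted by $x_1$. Each internal node stores, instead of $P(v)$, the packed bit vector that tells for each entry of $P(v)$ whether it belongs to the left or the right child. The model is the word RAM with $w$-bit words and unit-cost arithmetic, shift, bitwise, memory, jump and output instructions. Coordinates are atomic, take one word each, and can only be copied and compared. Then for every constant $\varepsilon>0$ there are a constant $C>0$ and two programs (for counting and for reporting), depending only on $\varepsilon$, such that for all $n\ge2$, all word sizes $w$ with $2^w\ge C\,n\lg n$ and all families of $n$ canonical boxes there is a memory content that stores the three-layer structure above, possibly with auxiliary words, that uses at most $C\,n\lg n$ words in total, whose coordinate cells contain only coordinates of the boxes, and for which the following holds for every query point $q\in\mathbb R^3$, where $k$ is the number of boxes that contain $q$: \begin{itemize} \item the counting program outputs $k$ after at most $C\lg^3 n$ steps; \item the reporting program outputs the (indices of the) boxes that contain $q$, each exactly once, after at most $C(\lg^3 n+k\lg^{\varepsilon}n)$ steps; \item the reported boxes are output as the concatenation of at most $C\lg^3 n$ pairwise disjoint sets, each of which is a nonempty prefix of some bottom list of the structure. \end{itemize} Both programs leave the memory as they found it. Here $\lg$ is the logarithm to base $2$. -/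

import Mathlib

namespace Stabbing

noncomputable section

open scoped Classical

/-! ## Canonical boxes -/

/-- A point of three-dimensional space. -/
structure Point where
  x : ℝ
  y : ℝ
  z : ℝ

/-- A (nonempty) canonical box `[x1, +∞) × [y1, y2) × [z1, z2)` where `x1, y1, z1` are real and
`y2, z2` are real or `+∞`. -/
structure CanonicalBox where
  x1 : ℝ
  y1 : ℝ
  y2 : WithTop ℝ
  z1 : ℝ
  z2 : WithTop ℝ
  y1_lt_y2 : (y1 : WithTop ℝ) < y2
  z1_lt_z2 : (z1 : WithTop ℝ) < z2

/-- The `z`-range `[z1, z2)` of a box. -/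
def CanonicalBox.zRange (B : CanonicalBox) : Set ℝ :=
  {t | B.z1 ≤ t ∧ (t : WithTop ℝ) < B.z2}

/-- The `y`-range `[y1, y2)` of a box. -/
def CanonicalBox.yRange (B : CanonicalBox) : Set ℝ :=
  {t | B.y1 ≤ t ∧ (t : WithTop ℝ) < B.y2}

/-- The box as a set of points. -/
def CanonicalBox.region (B : CanonicalBox) : Set Point :=
  {p | B.x1 ≤ p.x ∧ p.y ∈ B.yRange ∧ p.z ∈ B.zRange}

/-- The five numbers that describe a box. -/
def CanonicalBox.coordinates (B : CanonicalBox) : List (WithTop ℝ) :=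
  [(B.x1 : WithTop ℝ), (B.y1 : WithTop ℝ), B.y2, (B.z1 : WithTop ℝ), B.z2]

/-- The boxes, given by their indices, that contain the point `q`. -/
def stabbed {n : ℕ} (b : Fin n → CanonicalBox) (q : Point) : Finset (Fin n) :=
  Finset.univ.filter fun i => q ∈ (b i).region

/-! ## Bottom layer: binary range trees

A range tree is leaf-oriented: every leaf holds a point, and the point stands for the box (index)
it comes from. -/

/-- Binary range trees whose leaves hold box indices; `nil` is the tree over the empty set. -/
inductive RangeTree (n : ℕ) where
  | nil : RangeTree n
  | leaf (i : Fin n) : RangeTree n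
  | node (left right : RangeTree n) : RangeTree n

/-- The leaves of a range tree from left to right. -/
def RangeTree.leaves {n : ℕ} : RangeTree n → List (Fin n)
  | .nil => []
  | .leaf i => [i]
  | .node l r => l.leaves ++ r.leaves

/-- The balanced range tree whose leaves, from left to right, hold the given list. -/
def RangeTree.ofList {n : ℕ} : List (Fin n) → RangeTree n
  | [] => .nil
  | [i] => .leaf i
  | i :: j :: L =>
    .node (RangeTree.ofList ((i :: j :: L).take ((i :: j :: L).length / 2)))
      (RangeTree.ofList ((i :: j :: L).drop ((i :: j :: L).length / 2)))
  termination_by L => L.length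
  decreasing_by
    · simp only [List.length_take, List.length_cons]; omega
    · simp only [List.length_drop, List.length_cons]; omega

/-- All nodes of a range tree (leaves included), each given as the subtree rooted at it. -/
def RangeTree.subtrees {n : ℕ} : RangeTree n → List (RangeTree n)
  | .nil => []
  | .leaf i => [.leaf i]
  | .node l r => .node l r :: (l.subtrees ++ r.subtrees)

/-- The list `P(v)` of the points (boxes) at the leaf descendants of the node `v`, sorted by
`x`-coordinate. -/
def RangeTree.bottomList {n : ℕ} (b : Fin n → CanonicalBox) (v : RangeTree n) : List (Fin n) :=
  v.leaves.insertionSort fun i j => (b i).x1 ≤ (b j).x1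

/-- The range tree over the lower points `(x1, y1)` of the given boxes: leaves are sorted by
`y`-coordinate. -/
def lowerTree {n : ℕ} (b : Fin n → CanonicalBox) (L : List (Fin n)) : RangeTree n :=
  RangeTree.ofList (L.insertionSort fun i j => (b i).y1 ≤ (b j).y1)

/-- The range tree over the upper points `(x1, y2)` of the given boxes: leaves are sorted by
`y`-coordinate. -/
def upperTree {n : ℕ} (b : Fin n → CanonicalBox) (L : List (Fin n)) : RangeTree n :=
  RangeTree.ofList (L.insertionSort fun i j => (b i).y2 ≤ (b j).y2)

/-! ## Middle layer: interval trees over the `y`-ranges -/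

/-- Interval trees. A node holds a median of the endpoints of the intervals in its subtree, and,
for the boxes whose `y`-range contains the median, the two range trees over the lower and the
upper points. -/
inductive IntervalTree (n : ℕ) where
  | nil : IntervalTree n
  | node (median : WithTop ℝ) (lower upper : RangeTree n) (left right : IntervalTree n) :
      IntervalTree n

/-- The endpoints (with multiplicity) of the `y`-ranges of the given boxes. -/
def yEndpoints {n : ℕ} (b : Fin n → CanonicalBox) (L : List (Fin n)) : List (WithTop ℝ) :=
  L.flatMap fun i => [((b i).y1 : WithTop ℝ), (b i).y2]

/-- The (lower) median of the `2m` endpoints of the `y`-ranges of `m` boxes, that is the `m`-th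
smallest of them. -/
def yMedian {n : ℕ} (b : Fin n → CanonicalBox) (L : List (Fin n)) : WithTop ℝ :=
  ((yEndpoints b L).insertionSort (· ≤ ·)).getD (L.length - 1) 0

/-- The boxes of `L` whose `y`-range contains the median. -/
def yMiddle {n : ℕ} (b : Fin n → CanonicalBox) (L : List (Fin n)) : List (Fin n) :=
  L.filter fun i => ((b i).y1 : WithTop ℝ) ≤ yMedian b L ∧ yMedian b L < (b i).y2

/-- The boxes of `L` whose `y`-range lies to the left of the median. -/
def yLeft {n : ℕ} (b : Fin n → CanonicalBox) (L : List (Fin n)) : List (Fin n) :=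
  L.filter fun i => (b i).y2 ≤ yMedian b L

/-- The boxes of `L` whose `y`-range lies to the right of the median. -/
def yRight {n : ℕ} (b : Fin n → CanonicalBox) (L : List (Fin n)) : List (Fin n) :=
  L.filter fun i => yMedian b L < ((b i).y1 : WithTop ℝ)

theorem length_yEndpoints {n : ℕ} (b : Fin n → CanonicalBox) (L : List (Fin n)) :
    (yEndpoints b L).length = 2 * L.length := by
  induction L with
  | nil => rfl
  | cons i L ih =>
    simp only [yEndpoints, List.flatMap_cons, List.length_append, List.length_cons,
      List.length_nil] at ih ⊢
    omega

theorem yMedian_eq_getElem {n : ℕ} (b : Fin n → CanonicalBox) (L : List (Fin n)) (hL : L ≠ []) :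
    ∃ h : L.length - 1 < ((yEndpoints b L).insertionSort (· ≤ ·)).length,
      yMedian b L = ((yEndpoints b L).insertionSort (· ≤ ·))[L.length - 1] := by
  have hpos : 0 < L.length := List.length_pos_iff.mpr hL
  have h : L.length - 1 < ((yEndpoints b L).insertionSort (· ≤ ·)).length := by
    rw [List.length_insertionSort, length_yEndpoints]; omega
  exact ⟨h, by rw [yMedian, List.getD_eq_getElem _ _ h]⟩

theorem length_yLeft_lt {n : ℕ} (b : Fin n → CanonicalBox) (L : List (Fin n)) (hL : L ≠ []) :
    (yLeft b L).length < L.length := by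
  have hpos : 0 < L.length := List.length_pos_iff.mpr hL
  by_contra hcon
  have heq : (yLeft b L).length = L.length :=
    le_antisymm (List.length_filter_le _ _) (not_lt.mp hcon)
  have hall : ∀ i ∈ L, (b i).y2 ≤ yMedian b L := by
    have := List.length_filter_eq_length_iff.mp heq
    intro i hi
    simpa using this i hi
  obtain ⟨hlt, hm⟩ := yMedian_eq_getElem b L hL
  set s := (yEndpoints b L).insertionSort (· ≤ ·) with hs
  have hsorted : s.Pairwise (· ≤ ·) := List.pairwise_insertionSort _ _
  have hcount : s.countP (fun t => decide (t < yMedian b L)) =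
      (yEndpoints b L).countP (fun t => decide (t < yMedian b L)) :=
    (List.perm_insertionSort _ _).countP_eq _
  have hge : ∀ M : List (Fin n), (∀ i ∈ M, (b i).y2 ≤ yMedian b L) →
      M.length ≤ (yEndpoints b M).countP (fun t => decide (t < yMedian b L)) := by
    intro M
    induction M with
    | nil => intro _; simp
    | cons i M ih =>
      intro hM
      have h1 : ((b i).y1 : WithTop ℝ) < yMedian b L :=
        lt_of_lt_of_le (b i).y1_lt_y2 (hM i (by simp))
      have h2 := ih (fun j hj => hM j (by simp [hj]))
      simp only [yEndpoints] at h2 ⊢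
      rw [List.flatMap_cons, List.countP_append, List.countP_cons]
      simp only [h1, decide_true, if_true, List.length_cons]
      omega
  have h1 := hge L hall
  have hle : s.countP (fun t => decide (t < yMedian b L)) ≤ L.length - 1 := by
    conv_lhs => rw [← List.take_append_drop (L.length - 1) s]
    rw [List.countP_append]
    have hz : (s.drop (L.length - 1)).countP (fun t => decide (t < yMedian b L)) = 0 := by
      rw [List.countP_eq_zero]
      intro t ht
      rw [List.mem_iff_getElem] at ht
      obtain ⟨k, hk, rfl⟩ := ht
      rw [List.getElem_drop]
      simp only [decide_eq_true_eq, not_lt, hm]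
      rcases Nat.eq_zero_or_pos k with rfl | hkpos
      · exact le_of_eq rfl
      · exact List.pairwise_iff_getElem.mp hsorted _ _ _ _ (by omega)
    have ht : (s.take (L.length - 1)).countP (fun t => decide (t < yMedian b L)) ≤ L.length - 1 :=
      le_trans List.countP_le_length (by rw [List.length_take]; omega)
    omega
  omega

theorem length_yRight_lt {n : ℕ} (b : Fin n → CanonicalBox) (L : List (Fin n)) (hL : L ≠ []) :
    (yRight b L).length < L.length := by
  by_contra hcon
  have heq : (yRight b L).length = L.length :=
    le_antisymm (List.length_filter_le _ _) (not_lt.mp hcon)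
  have hall : ∀ i ∈ L, yMedian b L < ((b i).y1 : WithTop ℝ) := by
    have := List.length_filter_eq_length_iff.mp heq
    intro i hi
    simpa using this i hi
  obtain ⟨hlt, hm⟩ := yMedian_eq_getElem b L hL
  have hmem : yMedian b L ∈ yEndpoints b L := by
    rw [← List.mem_insertionSort (· ≤ ·), hm]
    exact List.getElem_mem _
  simp only [yEndpoints, List.mem_flatMap, List.mem_cons, List.not_mem_nil, or_false] at hmem
  obtain ⟨i, hi, h | h⟩ := hmem
  · exact absurd (hall i hi) (by rw [h]; exact lt_irrefl _)
  · have h3 := hall i hi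
    rw [h] at h3
    exact absurd (lt_trans h3 (b i).y1_lt_y2) (lt_irrefl _)

/-- The interval tree over the `y`-ranges of the boxes in `L`, together with the range trees of
its nodes. -/
def IntervalTree.build {n : ℕ} (b : Fin n → CanonicalBox) (L : List (Fin n)) : IntervalTree n :=
  if hL : L = [] then .nil
  else
    .node (yMedian b L) (lowerTree b (yMiddle b L)) (upperTree b (yMiddle b L))
      (IntervalTree.build b (yLeft b L)) (IntervalTree.build b (yRight b L))
  termination_by L.length
  decreasing_by
    · exact length_yLeft_lt b L hL
    · exact length_yRight_lt b L hL

/-- All range trees attached to the nodes of an interval tree. -/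
def IntervalTree.rangeTrees {n : ℕ} : IntervalTree n → List (RangeTree n)
  | .nil => []
  | .node _ lo up l r => lo :: up :: (l.rangeTrees ++ r.rangeTrees)

/-! ## Top layer: a segment tree over the `z`-ranges -/

/-- Segment trees. The leaves stand for the elementary intervals; an internal node holds the
real number that separates the interval of its left child from that of its right child. Every
node also holds the interval tree over the boxes assigned to it. -/
inductive SegmentTree (n : ℕ) where
  | leaf (mid : IntervalTree n) : SegmentTree n
  | node (key : ℝ) (mid : IntervalTree n) (left right : SegmentTree n) : SegmentTree n

/-- The distinct real endpoints of the `z`-ranges in increasing order. The elementary intervals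
they induce are `(-∞, p₁), [p₁, p₂), …, [pₘ, +∞)`. -/
def zKeys {n : ℕ} (b : Fin n → CanonicalBox) : List ℝ :=
  ((Finset.univ.image fun i => (b i).z1) ∪
    (Finset.univ.filter fun i => (b i).z2 ≠ ⊤).image fun i => (b i).z2.untopD 0).sort (· ≤ ·)

/-- The boxes assigned to a segment tree node with interval `I` whose parent has the interval `J`:
their `z`-ranges cover `I` but not `J`. -/
def assigned {n : ℕ} (b : Fin n → CanonicalBox) (J I : Set ℝ) : List (Fin n) :=
  (List.finRange n).filter fun i => I ⊆ (b i).zRange ∧ ¬ J ⊆ (b i).zRange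

/-- The balanced segment tree node with interval `I`, whose parent has the interval `J`, and whose
leaf descendants are the parts into which the increasing list `keys` cuts `I`. -/
def SegmentTree.build {n : ℕ} (b : Fin n → CanonicalBox) (keys : List ℝ) (J I : Set ℝ) :
    SegmentTree n :=
  if hk : keys = [] then .leaf (IntervalTree.build b (assigned b J I))
  else
    have hlt : keys.length / 2 < keys.length :=
      Nat.div_lt_self (List.length_pos_iff.mpr hk) (by norm_num)
    .node keys[keys.length / 2] (IntervalTree.build b (assigned b J I))
      (SegmentTree.build b (keys.take (keys.length / 2)) I (I ∩ Set.Iio keys[keys.length / 2]))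
      (SegmentTree.build b (keys.drop (keys.length / 2 + 1)) I (I ∩ Set.Ici keys[keys.length / 2]))
  termination_by keys.length
  decreasing_by
    · simp only [List.length_take]; omega
    · simp only [List.length_drop]; omega

/-- The three-layer structure over the boxes `b`. The root of the top layer stands for the whole
line, which no `z`-range covers, so nothing is assigned to it. -/
def structureOf {n : ℕ} (b : Fin n → CanonicalBox) : SegmentTree n :=
  SegmentTree.build b (zKeys b) Set.univ Set.univ

/-- All interval trees attached to the nodes of a segment tree. -/
def SegmentTree.intervalTrees {n : ℕ} : SegmentTree n → List (IntervalTree n)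
  | .leaf m => [m]
  | .node _ m l r => m :: (l.intervalTrees ++ r.intervalTrees)

/-- The bottom lists of the three-layer structure over `b`: the lists `P(v)` of all nodes `v` of
all range trees of the bottom layer. -/
def bottomLists {n : ℕ} (b : Fin n → CanonicalBox) : List (List (Fin n)) :=
  (((structureOf b).intervalTrees.flatMap IntervalTree.rangeTrees).flatMap
    RangeTree.subtrees).map (RangeTree.bottomList b)

/-! ## The word RAM

Words have `w` bits. Coordinates (real numbers or `+∞`) are atomic: they live in cells of their
own, one per word of space, and can only be copied and compared. -/

/-- The arithmetic and bitwise operations on words. -/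
inductive BinOp where
  | add | sub | mul | div | mod | and | or | xor | shl | shr

/-- The value of an operation, modulo `2 ^ w`. -/
def BinOp.eval {w : ℕ} : BinOp → BitVec w → BitVec w → BitVec w
  | .add, x, y => x + y
  | .sub, x, y => x - y
  | .mul, x, y => x * y
  | .div, x, y => x / y
  | .mod, x, y => x % y
  | .and, x, y => x &&& y
  | .or, x, y => x ||| y
  | .xor, x, y => x ^^^ y
  | .shl, x, y => x <<< y.toNat
  | .shr, x, y => x >>> y.toNat

/-- Instructions; `d`, `a`, `s` are fixed register names and `t` is a fixed program position. -/
inductive Instr where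
  /-- word register `d` becomes the constant `v` -/
  | const (d v : ℕ)
  /-- word register `d` becomes the result of an operation on word registers `a₁`, `a₂` -/
  | op (o : BinOp) (d a₁ a₂ : ℕ)
  /-- word register `d` becomes the word at the address held in word register `a` -/
  | load (d a : ℕ)
  /-- the word at the address held in word register `a` becomes the value of word register `s` -/
  | store (a s : ℕ)
  /-- coordinate register `d` becomes the coordinate at the address held in word register `a` -/
  | loadCoord (d a : ℕ)
  /-- jump to `t` -/
  | jump (t : ℕ)
  /-- jump to `t` if word register `a₁` is less than word register `a₂` -/
  | jumpLt (a₁ a₂ t : ℕ)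
  /-- jump to `t` if coordinate register `a₁` is less than coordinate register `a₂` -/
  | jumpCoordLt (a₁ a₂ t : ℕ)
  /-- append the value of word register `a` to the output -/
  | output (a : ℕ)
  /-- stop -/
  | halt

/-- A program is a finite list of instructions; it uses a constant number of registers. -/
abbrev Program := List Instr

/-- A configuration of the machine. -/
structure Config (w : ℕ) where
  pc : ℕ
  reg : ℕ → BitVec w
  coordReg : ℕ → WithTop ℝ
  mem : List (BitVec w)
  out : List (BitVec w)

/-- Execute one instruction; `none` if the machine has stopped or if it accesses a cell outside
the memory. -/
def step {w : ℕ} (P : Program) (coords : List (WithTop ℝ)) (c : Config w) : Option (Config w) :=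
  match P[c.pc]? with
  | none => none
  | some .halt => none
  | some (.const d v) =>
    some { c with pc := c.pc + 1, reg := Function.update c.reg d (BitVec.ofNat w v) }
  | some (.op o d a₁ a₂) =>
    some { c with pc := c.pc + 1, reg := Function.update c.reg d (o.eval (c.reg a₁) (c.reg a₂)) }
  | some (.load d a) =>
    match c.mem[(c.reg a).toNat]? with
    | none => none
    | some v => some { c with pc := c.pc + 1, reg := Function.update c.reg d v }
  | some (.store a s) =>
    if (c.reg a).toNat < c.mem.length then
      some { c with pc := c.pc + 1, mem := c.mem.set (c.reg a).toNat (c.reg s) }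
    else none
  | some (.loadCoord d a) =>
    match coords[(c.reg a).toNat]? with
    | none => none
    | some v => some { c with pc := c.pc + 1, coordReg := Function.update c.coordReg d v }
  | some (.jump t) => some { c with pc := t }
  | some (.jumpLt a₁ a₂ t) =>
    some { c with pc := if (c.reg a₁).toNat < (c.reg a₂).toNat then t else c.pc + 1 }
  | some (.jumpCoordLt a₁ a₂ t) =>
    some { c with pc := if c.coordReg a₁ < c.coordReg a₂ then t else c.pc + 1 }
  | some (.output a) => some { c with pc := c.pc + 1, out := c.out ++ [c.reg a] }

/-- The configuration after exactly `t` steps, if the machine makes that many. -/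
def runFor {w : ℕ} (P : Program) (coords : List (WithTop ℝ)) : ℕ → Config w → Option (Config w)
  | 0, c => some c
  | t + 1, c => (step P coords c).bind (runFor P coords t)

/-- The start of a query: the coordinates of the query point are in the coordinate registers
`0`, `1`, `2`; everything else is cleared. -/
def startConfig {w : ℕ} (mem : List (BitVec w)) (q : Point) : Config w where
  pc := 0
  reg := fun _ => 0
  coordReg := fun i =>
    if i = 0 then (q.x : WithTop ℝ) else if i = 1 then (q.y : WithTop ℝ)
    else if i = 2 then (q.z : WithTop ℝ) else 0
  mem := mem
  out := []

/-- On the memory `mem`, `coords` and the query point `q`, the program `P` reaches a `halt`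
instruction after exactly `t` steps, having written the output `out` and leaving the memory as it
was. -/
def AnswersIn {w : ℕ} (P : Program) (mem : List (BitVec w)) (coords : List (WithTop ℝ))
    (q : Point) (t : ℕ) (out : List (BitVec w)) : Prop :=
  ∃ c : Config w, runFor P coords t (startConfig mem q) = some c ∧
    P[c.pc]? = some .halt ∧ c.mem = mem ∧ c.out = out

/-! ## The three-layer structure in memory

Every tree node is a record of consecutive words that starts with a tag. Pointers are addresses;
a coordinate is referred to by its address among the coordinate cells. The memory may hold
further (auxiliary) words. -/

/-- The bit vector `B(v)` of the range tree node `v` with right child `r` is stored in packed form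
from address `p` on: its `j`-th bit tells whether the `j`-th point of `P(v)` is a leaf descendant
of `r`. -/
def BitVectorAt {n w : ℕ} (b : Fin n → CanonicalBox) (mem : List (BitVec w)) (v r : RangeTree n)
    (p : ℕ) : Prop :=
  ∀ (j : ℕ) (i : Fin n), (v.bottomList b)[j]? = some i →
    ∃ x, mem[p + j / w]? = some x ∧ (x.getLsbD (j % w) = true ↔ i ∈ r.leaves)

/-- The range tree is stored with its root at address `a`; the lists `P(v)` are not stored, the
bit vectors `B(v)` of the internal nodes are. -/
def RangeTree.StoredAt {n w : ℕ} (b : Fin n → CanonicalBox) (mem : List (BitVec w)) :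
    RangeTree n → ℕ → Prop
  | .nil, a => mem[a]? = some 0#w
  | .leaf i, a => mem[a]? = some 1#w ∧ mem[a + 1]? = some (BitVec.ofNat w i)
  | .node l r, a => mem[a]? = some 2#w ∧
      (∃ p, mem[a + 1]? = some p ∧ RangeTree.StoredAt b mem l p.toNat) ∧
      (∃ p, mem[a + 2]? = some p ∧ RangeTree.StoredAt b mem r p.toNat) ∧
      (∃ p, mem[a + 3]? = some p ∧ BitVectorAt b mem (.node l r) r p.toNat)

/-- The interval tree, with all its range trees, is stored with its root at address `a`. -/
def IntervalTree.StoredAt {n w : ℕ} (b : Fin n → CanonicalBox) (mem : List (BitVec w))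
    (coords : List (WithTop ℝ)) : IntervalTree n → ℕ → Prop
  | .nil, a => mem[a]? = some 0#w
  | .node m lo up l r, a => mem[a]? = some 1#w ∧
      (∃ p, mem[a + 1]? = some p ∧ coords[p.toNat]? = some m) ∧
      (∃ p, mem[a + 2]? = some p ∧ lo.StoredAt b mem p.toNat) ∧
      (∃ p, mem[a + 3]? = some p ∧ up.StoredAt b mem p.toNat) ∧
      (∃ p, mem[a + 4]? = some p ∧ IntervalTree.StoredAt b mem coords l p.toNat) ∧
      (∃ p, mem[a + 5]? = some p ∧ IntervalTree.StoredAt b mem coords r p.toNat)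

/-- The segment tree, with all its interval trees, is stored with its root at address `a`. -/
def SegmentTree.StoredAt {n w : ℕ} (b : Fin n → CanonicalBox) (mem : List (BitVec w))
    (coords : List (WithTop ℝ)) : SegmentTree n → ℕ → Prop
  | .leaf m, a => mem[a]? = some 0#w ∧
      (∃ p, mem[a + 1]? = some p ∧ m.StoredAt b mem coords p.toNat)
  | .node k m l r, a => mem[a]? = some 1#w ∧
      (∃ p, mem[a + 1]? = some p ∧ m.StoredAt b mem coords p.toNat) ∧
      (∃ p, mem[a + 2]? = some p ∧ coords[p.toNat]? = some (k : WithTop ℝ)) ∧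
      (∃ p, mem[a + 3]? = some p ∧ SegmentTree.StoredAt b mem coords l p.toNat) ∧
      (∃ p, mem[a + 4]? = some p ∧ SegmentTree.StoredAt b mem coords r p.toNat)

/-- The binary logarithm. -/
def lg (n : ℕ) : ℝ := Real.logb 2 n

end

end Stabbing

namespace Stabbing

/-! ## Blocks inside a list -/

/-! The test "box contains `q`" is split over the layers. A box whose `z`-range contains `q.z` is
assigned to exactly one node on the search path of `q.z` in the segment tree. Among the boxes of
such a node, those whose `y`-range contains `q.y` all sit on one search path of the interval tree.
At each node of that path they are the boxes whose lower point is at most `q.y`, or those whose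
upper point is above `q.y`: the leaves of logarithmically many maximal subtrees of one range tree.
In the bottom list of such a subtree the boxes with `x1 ≤ q.x` form a prefix. So the stabbed boxes
are a disjoint union of `O(lg³ n)` prefixes (`flatMap_piece_visits_perm`,
`length_visits_structureOf_le`). Counting adds their lengths; reporting lists their entries.

One binary search per interval tree node gives the prefix length at the roots of its range trees.
Below a root no search is needed: sorting is stable, so the bottom list of a child is a subsequence
of that of its parent (`filter_insertionSort`), and the prefix length of the child is a rank in the
bit vector of the parent (`RangeTree.rank_count`). With `s = ⌊lg n⌋`, a rank takes constant time
from a directory over chunks of `s` bits and one table with the bit counts of all `s`-bit words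
(`ev_rank`).

To report an entry of a bottom list it must be followed down to its leaf. One level per step would
cost `lg n` per box, so nodes of suitable heights `h` have jump tables that lead `d h` levels down
at once. The field of an entry takes `3d` bits: `d` bits name the descendant, and `2d` bits give the
position there relative to a base value that is stored once per block of `2 ^ (2d)` entries and
descendant (`exists_jumps`). Per box this costs `O(d / s)` words for fields and `O(2 ^ (-d))` words
for bases. The lengths must therefore have sum `O(s)` over all heights and bounded sum of `2 ^
(-d)`, and must still reach the bottom in `O(s ^ ε)` jumps. Powers of some `B` near `s ^ (1 / (K +
1))`, with `K` about `1 / ε` and chosen by divisibility of the height, do all this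
(`exists_jumpSchedule`).

For the space, a box assigned to a segment tree node has an endpoint inside the interval of the
parent, so each level holds `O(n)` boxes and the structure `O(n lg n)`
(`SegmentTree.boxes_build_le`). A range tree over `m` boxes with all its tables takes `O(m)` words
(`RangeTree.Bal.words_le_mul`).

The programs are written in a small structured language over natural numbers whose semantics counts
machine steps and which is compiled to the word RAM (`Exec.run`). The search is verified once, for
an arbitrary action at the visited nodes (`VisitSpec`, `segmentWalk_spec`), and is then used both
with counting and with reporting. -/

/-- The list `xs` occurs in `M` from position `a` on. -/
def Holds {α : Type*} (M : List α) (a : ℕ) (xs : List α) : Prop :=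
  ∀ i x, xs[i]? = some x → M[a + i]? = some x

theorem Holds.left {α : Type*} {M : List α} {a : ℕ} {xs ys : List α} (h : Holds M a (xs ++ ys)) :
    Holds M a xs := by
  intro i x hx
  refine h i x ?_
  rw [List.getElem?_append_left (List.getElem?_eq_some_iff.mp hx).1]
  exact hx

theorem Holds.right {α : Type*} {M : List α} {a : ℕ} {xs ys : List α} (h : Holds M a (xs ++ ys)) :
    Holds M (a + xs.length) ys := by
  intro i x hx
  rw [Nat.add_assoc]
  refine h (xs.length + i) x ?_
  rw [List.getElem?_append_right (by omega)]
  simpa using hx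

theorem Holds.head {α : Type*} {M : List α} {a : ℕ} {x : α} {xs : List α}
    (h : Holds M a (x :: xs)) : M[a]? = some x := by
  simpa using h 0 x (by simp)

theorem Holds.tail {α : Type*} {M : List α} {a : ℕ} {x : α} {xs : List α}
    (h : Holds M a (x :: xs)) : Holds M (a + 1) xs :=
  Holds.right (xs := [x]) h

/-! ## A structured language on natural numbers -/

/-- Expressions over word variables. -/
inductive Expr where
  | var (r : ℕ)
  | lit (v : ℕ)
  | op (o : BinOp) (e₁ e₂ : Expr)
  /-- the word at the address `e₁ + e₂` -/
  | ld (e₁ e₂ : Expr)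

/-- Structured programs. -/
inductive Stmt where
  | skip
  | assign (d : ℕ) (e : Expr)
  | getC (d : ℕ) (e : Expr)
  | outp (e : Expr)
  | seq (s₁ s₂ : Stmt)
  | ite (e₁ e₂ : Expr) (s₁ s₂ : Stmt)
  | cite (a₁ a₂ : ℕ) (s₁ s₂ : Stmt)
  | whil (e₁ e₂ : Expr) (s : Stmt)

/-- The state of a structured program; the memory is read-only. -/
structure St where
  reg : ℕ → ℕ
  creg : ℕ → WithTop ℝ
  out : List ℕ

/-- The operations on natural numbers. -/
def BinOp.nat : BinOp → ℕ → ℕ → ℕ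
  | .add, x, y => x + y
  | .sub, x, y => x - y
  | .mul, x, y => x * y
  | .div, x, y => x / y
  | .mod, x, y => x % y
  | .and, x, y => x &&& y
  | .or, x, y => x ||| y
  | .xor, x, y => x ^^^ y
  | .shl, x, y => x * 2 ^ y
  | .shr, x, y => x / 2 ^ y

/-- The operation on words agrees with the operation on natural numbers. -/
def BinOp.Fits (w : ℕ) : BinOp → ℕ → ℕ → Prop
  | .add, x, y => x + y < 2 ^ w
  | .sub, x, y => y ≤ x
  | .mul, x, y => x * y < 2 ^ w
  | .shl, x, y => x * 2 ^ y < 2 ^ w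
  | _, _, _ => True

/-- Only sums, products and left shifts can overflow, and only differences can be truncated. The
other operations never leave the range, and division and remainder by zero follow the same
conventions on words and on naturals, so they need no side condition. -/
theorem BinOp.toNat_eval {w : ℕ} (o : BinOp) (x y : BitVec w)
    (h : o.Fits w x.toNat y.toNat) : (o.eval x y).toNat = o.nat x.toNat y.toNat := by
  cases o <;> simp only [BinOp.Fits] at h <;> simp only [BinOp.eval, BinOp.nat]
  · rw [BitVec.toNat_add, Nat.mod_eq_of_lt h]
  · exact BitVec.toNat_sub_of_le h
  · rw [BitVec.toNat_mul, Nat.mod_eq_of_lt h]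
  · exact BitVec.toNat_udiv
  · exact BitVec.toNat_umod
  · exact BitVec.toNat_and ..
  · exact BitVec.toNat_or ..
  · exact BitVec.toNat_xor ..
  · rw [BitVec.toNat_shiftLeft, Nat.shiftLeft_eq, Nat.mod_eq_of_lt h]
  · rw [BitVec.toNat_ushiftRight, Nat.shiftRight_eq_div_pow]

/-- The value of an expression. -/
inductive Ev (w : ℕ) (M : List ℕ) (σ : St) : Expr → ℕ → Prop where
  | var (r : ℕ) : Ev w M σ (.var r) (σ.reg r)
  | lit (v : ℕ) (h : v < 2 ^ w) : Ev w M σ (.lit v) v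
  | op {o : BinOp} {e₁ e₂ : Expr} {v₁ v₂ : ℕ} (h₁ : Ev w M σ e₁ v₁) (h₂ : Ev w M σ e₂ v₂)
      (h : o.Fits w v₁ v₂) : Ev w M σ (.op o e₁ e₂) (o.nat v₁ v₂)
  | ld {e₁ e₂ : Expr} {v₁ v₂ x : ℕ} (h₁ : Ev w M σ e₁ v₁) (h₂ : Ev w M σ e₂ v₂)
      (h : M[v₁ + v₂]? = some x) : Ev w M σ (.ld e₁ e₂) x

/-- The number of instructions of an expression. -/
@[simp] def Expr.cost : Expr → ℕ
  | .var _ => 1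
  | .lit _ => 1
  | .op _ e₁ e₂ => e₁.cost + e₂.cost + 1
  | .ld e₁ e₂ => e₁.cost + e₂.cost + 2

/-- Set a word variable. -/
def St.set (σ : St) (d v : ℕ) : St := { σ with reg := Function.update σ.reg d v }

/-- Set a coordinate variable. -/
def St.setC (σ : St) (d : ℕ) (v : WithTop ℝ) : St :=
  { σ with creg := Function.update σ.creg d v }

/-- Append a word to the output. -/
def St.emit (σ : St) (v : ℕ) : St := { σ with out := σ.out ++ [v] }

@[simp] theorem St.reg_set (σ : St) (d v r : ℕ) :
    (σ.set d v).reg r = if r = d then v else σ.reg r := by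
  simp [St.set, Function.update_apply]
@[simp] theorem St.creg_set (σ : St) (d v : ℕ) : (σ.set d v).creg = σ.creg := rfl
@[simp] theorem St.out_set (σ : St) (d v : ℕ) : (σ.set d v).out = σ.out := rfl
@[simp] theorem St.reg_setC (σ : St) (d : ℕ) (v : WithTop ℝ) : (σ.setC d v).reg = σ.reg := rfl
open scoped Classical in
@[simp] theorem St.creg_setC (σ : St) (d : ℕ) (v : WithTop ℝ) (r : ℕ) :
    (σ.setC d v).creg r = if r = d then v else σ.creg r := by
  simp [St.setC, Function.update_apply]
@[simp] theorem St.out_setC (σ : St) (d : ℕ) (v : WithTop ℝ) : (σ.setC d v).out = σ.out := rfl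
@[simp] theorem St.reg_emit (σ : St) (v : ℕ) : (σ.emit v).reg = σ.reg := rfl
@[simp] theorem St.creg_emit (σ : St) (v : ℕ) : (σ.emit v).creg = σ.creg := rfl
@[simp] theorem St.out_emit (σ : St) (v : ℕ) : (σ.emit v).out = σ.out ++ [v] := rfl

/-- `Exec w M coords s σ t σ'`: the program `s` leads from `σ` to `σ'` in `t` machine steps. -/
inductive Exec (w : ℕ) (M : List ℕ) (coords : List (WithTop ℝ)) :
    Stmt → St → ℕ → St → Prop where
  | skip (σ : St) : Exec w M coords .skip σ 0 σ
  | assign {σ : St} (d : ℕ) {e : Expr} {v : ℕ} (h : Ev w M σ e v) :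
      Exec w M coords (.assign d e) σ (e.cost + 1) (σ.set d v)
  | getC {σ : St} (d : ℕ) {e : Expr} {v : ℕ} {x : WithTop ℝ} (h : Ev w M σ e v)
      (hx : coords[v]? = some x) : Exec w M coords (.getC d e) σ (e.cost + 1) (σ.setC d x)
  | outp {σ : St} {e : Expr} {v : ℕ} (h : Ev w M σ e v) :
      Exec w M coords (.outp e) σ (e.cost + 1) (σ.emit v)
  | seq {s₁ s₂ : Stmt} {σ₁ σ₂ σ₃ : St} {t₁ t₂ : ℕ} (h₁ : Exec w M coords s₁ σ₁ t₁ σ₂)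
      (h₂ : Exec w M coords s₂ σ₂ t₂ σ₃) : Exec w M coords (.seq s₁ s₂) σ₁ (t₁ + t₂) σ₃
  | ite_true {e₁ e₂ : Expr} {s₁ s₂ : Stmt} {σ σ' : St} {v₁ v₂ t : ℕ} (h₁ : Ev w M σ e₁ v₁)
      (h₂ : Ev w M σ e₂ v₂) (h : v₁ < v₂) (hs : Exec w M coords s₁ σ t σ') :
      Exec w M coords (.ite e₁ e₂ s₁ s₂) σ (e₁.cost + e₂.cost + 1 + t) σ'
  | ite_false {e₁ e₂ : Expr} {s₁ s₂ : Stmt} {σ σ' : St} {v₁ v₂ t : ℕ} (h₁ : Ev w M σ e₁ v₁)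
      (h₂ : Ev w M σ e₂ v₂) (h : ¬ v₁ < v₂) (hs : Exec w M coords s₂ σ t σ') :
      Exec w M coords (.ite e₁ e₂ s₁ s₂) σ (e₁.cost + e₂.cost + 2 + t) σ'
  | cite_true {a₁ a₂ : ℕ} {s₁ s₂ : Stmt} {σ σ' : St} {t : ℕ}
      (h : σ.creg a₁ < σ.creg a₂) (hs : Exec w M coords s₁ σ t σ') :
      Exec w M coords (.cite a₁ a₂ s₁ s₂) σ (1 + t) σ'
  | cite_false {a₁ a₂ : ℕ} {s₁ s₂ : Stmt} {σ σ' : St} {t : ℕ}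
      (h : ¬ σ.creg a₁ < σ.creg a₂) (hs : Exec w M coords s₂ σ t σ') :
      Exec w M coords (.cite a₁ a₂ s₁ s₂) σ (2 + t) σ'
  | whil_true {e₁ e₂ : Expr} {s : Stmt} {σ σ' σ'' : St} {v₁ v₂ t t' : ℕ} (h₁ : Ev w M σ e₁ v₁)
      (h₂ : Ev w M σ e₂ v₂) (h : v₁ < v₂) (hs : Exec w M coords s σ t σ')
      (hw : Exec w M coords (.whil e₁ e₂ s) σ' t' σ'') :
      Exec w M coords (.whil e₁ e₂ s) σ (e₁.cost + e₂.cost + 2 + t + t') σ''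
  | whil_false {e₁ e₂ : Expr} {s : Stmt} {σ : St} {v₁ v₂ : ℕ} (h₁ : Ev w M σ e₁ v₁)
      (h₂ : Ev w M σ e₂ v₂) (h : ¬ v₁ < v₂) :
      Exec w M coords (.whil e₁ e₂ s) σ (e₁.cost + e₂.cost + 2) σ

/-! ## Compilation -/

/-- Variables are the registers below `100`. -/
def Expr.WF : Expr → Bool
  | .var r => r < 100
  | .lit _ => true
  | .op _ e₁ e₂ => e₁.WF && e₂.WF
  | .ld e₁ e₂ => e₁.WF && e₂.WF

/-- All word variables are registers below `100`. -/
def Stmt.WF : Stmt → Bool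
  | .skip => true
  | .assign d e => d < 100 && e.WF
  | .getC _ e => e.WF
  | .outp e => e.WF
  | .seq s₁ s₂ => s₁.WF && s₂.WF
  | .ite e₁ e₂ s₁ s₂ => e₁.WF && e₂.WF && s₁.WF && s₂.WF
  | .cite _ _ s₁ s₂ => s₁.WF && s₂.WF
  | .whil e₁ e₂ s => e₁.WF && e₂.WF && s.WF

/-- Code that computes an expression into register `t`, with the registers from `t` on as
scratch space. -/
def Expr.code : Expr → ℕ → List Instr
  | .var r, t => [.op .or t r r]
  | .lit v, t => [.const t v]
  | .op o e₁ e₂, t => e₁.code t ++ (e₂.code (t + 1) ++ [.op o t t (t + 1)])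
  | .ld e₁ e₂, t => e₁.code t ++ (e₂.code (t + 1) ++ [.op .add t t (t + 1), .load t t])

/-- The number of instructions of a structured program. -/
def Stmt.size : Stmt → ℕ
  | .skip => 0
  | .assign _ e => e.cost + 1
  | .getC _ e => e.cost + 1
  | .outp e => e.cost + 1
  | .seq s₁ s₂ => s₁.size + s₂.size
  | .ite e₁ e₂ s₁ s₂ => e₁.cost + e₂.cost + 2 + s₁.size + s₂.size
  | .cite _ _ s₁ s₂ => 2 + s₁.size + s₂.size
  | .whil e₁ e₂ s => e₁.cost + e₂.cost + 3 + s.size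

/-- The code of a structured program that is placed at position `p`. -/
def Stmt.code : Stmt → ℕ → List Instr
  | .skip, _ => []
  | .assign d e, _ => e.code 100 ++ [.op .or d 100 100]
  | .getC d e, _ => e.code 100 ++ [.loadCoord d 100]
  | .outp e, _ => e.code 100 ++ [.output 100]
  | .seq s₁ s₂, p => s₁.code p ++ s₂.code (p + s₁.size)
  | .ite e₁ e₂ s₁ s₂, p =>
    e₁.code 100 ++ (e₂.code 101 ++
      (.jumpLt 100 101 (p + e₁.cost + e₂.cost + 2 + s₂.size) ::
        (s₂.code (p + e₁.cost + e₂.cost + 1) ++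
          (.jump (p + e₁.cost + e₂.cost + 2 + s₂.size + s₁.size) ::
            s₁.code (p + e₁.cost + e₂.cost + 2 + s₂.size)))))
  | .cite a₁ a₂ s₁ s₂, p =>
    .jumpCoordLt a₁ a₂ (p + 2 + s₂.size) ::
      (s₂.code (p + 1) ++ (.jump (p + 2 + s₂.size + s₁.size) :: s₁.code (p + 2 + s₂.size)))
  | .whil e₁ e₂ s, p =>
    e₁.code 100 ++ (e₂.code 101 ++
      (.jumpLt 100 101 (p + e₁.cost + e₂.cost + 2) ::
        .jump (p + e₁.cost + e₂.cost + 3 + s.size) ::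
          (s.code (p + e₁.cost + e₂.cost + 2) ++ [.jump p])))

@[simp] theorem Expr.length_code (e : Expr) (t : ℕ) : (e.code t).length = e.cost := by
  induction e generalizing t with
  | var r => rfl
  | lit v => rfl
  | op o e₁ e₂ h₁ h₂ => simp [Expr.code, h₁, h₂]; omega
  | ld e₁ e₂ h₁ h₂ => simp [Expr.code, h₁, h₂]; omega

@[simp] theorem Stmt.length_code (s : Stmt) (p : ℕ) : (s.code p).length = s.size := by
  induction s generalizing p with
  | skip => rfl
  | assign d e => simp [Stmt.code, Stmt.size]
  | getC d e => simp [Stmt.code, Stmt.size]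
  | outp e => simp [Stmt.code, Stmt.size]
  | seq s₁ s₂ h₁ h₂ => simp [Stmt.code, Stmt.size, h₁, h₂]
  | ite e₁ e₂ s₁ s₂ h₁ h₂ => simp [Stmt.code, Stmt.size, h₁, h₂]; omega
  | cite a₁ a₂ s₁ s₂ h₁ h₂ => simp [Stmt.code, Stmt.size, h₁, h₂]; omega
  | whil e₁ e₂ s h => simp [Stmt.code, Stmt.size, h]; omega

/-! ### Correctness of the compiled code -/

theorem runFor_add {w : ℕ} (P : Program) (coords : List (WithTop ℝ)) (t₁ t₂ : ℕ) (c : Config w) :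
    runFor P coords (t₁ + t₂) c = (runFor P coords t₁ c).bind (runFor P coords t₂) := by
  induction t₁ generalizing c with
  | zero => simp [runFor]
  | succ t ih =>
    rw [Nat.add_right_comm]
    simp only [runFor]
    cases step P coords c with
    | none => rfl
    | some c' => simpa using ih c'

theorem runFor_trans {w : ℕ} {P : Program} {coords : List (WithTop ℝ)} {t₁ t₂ : ℕ}
    {c c' c'' : Config w} (h₁ : runFor P coords t₁ c = some c')
    (h₂ : runFor P coords t₂ c' = some c'') : runFor P coords (t₁ + t₂) c = some c'' := by
  rw [runFor_add, h₁]
  exact h₂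

theorem runFor_one {w : ℕ} {P : Program} {coords : List (WithTop ℝ)} {c c' : Config w}
    (h : step P coords c = some c') : runFor P coords 1 c = some c' := by
  simp [runFor, h]

/-- The configuration `c` represents the state `σ` over the memory `M`. -/
structure Sim {w : ℕ} (M : List ℕ) (c : Config w) (σ : St) : Prop where
  reg : ∀ r < 100, (c.reg r).toNat = σ.reg r
  creg : c.coordReg = σ.creg
  mem : c.mem = M.map (BitVec.ofNat w)
  out : c.out.map BitVec.toNat = σ.out

/-- Code with target `t` writes only to registers from `t` on. This last conclusion keeps the first
operand alive in `t` while the second is computed with target `t + 1`, and protects all program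
variables because `t` is at least `100`. -/
theorem Ev.run {w : ℕ} {M : List ℕ} {σ : St} {coords : List (WithTop ℝ)} {P : Program}
    (hM : ∀ x ∈ M, x < 2 ^ w) (hlen : M.length ≤ 2 ^ w) {e : Expr} {v : ℕ} (hv : Ev w M σ e v) :
    ∀ (t : ℕ) (c : Config w), 100 ≤ t → e.WF = true → Holds P c.pc (e.code t) →
      (∀ r < 100, (c.reg r).toNat = σ.reg r) → c.mem = M.map (BitVec.ofNat w) →
      ∃ g : ℕ → BitVec w, runFor P coords e.cost c = some { c with pc := c.pc + e.cost, reg := g } ∧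
        (g t).toNat = v ∧ ∀ r < t, g r = c.reg r := by
  induction hv with
  | var r =>
    intro t c ht hwf hP hreg hmem
    simp only [Expr.WF, decide_eq_true_eq] at hwf
    refine ⟨Function.update c.reg t (c.reg r), ?_, ?_, ?_⟩
    · refine runFor_one ?_
      have := hP.head
      simp [step, this, BinOp.eval]
    · simp [hreg r hwf]
    · intro r' hr'
      rw [Function.update_of_ne (by omega)]
  | lit v h =>
    intro t c ht hwf hP hreg hmem
    refine ⟨Function.update c.reg t (BitVec.ofNat w v), ?_, ?_, ?_⟩
    · refine runFor_one ?_
      have := hP.head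
      simp [step, this]
    · simp [Nat.mod_eq_of_lt h]
    · intro r' hr'
      rw [Function.update_of_ne (by omega)]
  | @op o e₁ e₂ v₁ v₂ h₁ h₂ h ih₁ ih₂ =>
    intro t c ht hwf hP hreg hmem
    simp only [Expr.WF, Bool.and_eq_true] at hwf
    obtain ⟨g₁, hr₁, hg₁, hk₁⟩ := ih₁ t c ht hwf.1 hP.left hreg hmem
    have hP2 := hP.right
    rw [Expr.length_code] at hP2
    obtain ⟨g₂, hr₂, hg₂, hk₂⟩ := ih₂ (t + 1) { c with pc := c.pc + e₁.cost, reg := g₁ } (by omega)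
      hwf.2 hP2.left (fun r hr => by rw [← hreg r hr]; exact congrArg _ (hk₁ r (by omega))) hmem
    have hP3 := hP2.right.head
    rw [Expr.length_code] at hP3
    refine ⟨Function.update g₂ t (o.eval (g₂ t) (g₂ (t + 1))), ?_, ?_, ?_⟩
    · refine runFor_trans (runFor_trans hr₁ hr₂) (runFor_one ?_)
      simp only [step, hP3]
      simp [Nat.add_assoc]
    · have hgt : (g₂ t).toNat = v₁ := by rw [hk₂ t (by omega)]; exact hg₁
      rw [Function.update_self, BinOp.toNat_eval, hgt, hg₂]
      rw [hgt, hg₂]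
      exact h
    · intro r hr
      rw [Function.update_of_ne (by omega), hk₂ r (by omega)]
      exact hk₁ r hr
  | @ld e₁ e₂ v₁ v₂ x h₁ h₂ h ih₁ ih₂ =>
    intro t c ht hwf hP hreg hmem
    simp only [Expr.WF, Bool.and_eq_true] at hwf
    obtain ⟨g₁, hr₁, hg₁, hk₁⟩ := ih₁ t c ht hwf.1 hP.left hreg hmem
    have hP2 := hP.right
    rw [Expr.length_code] at hP2
    obtain ⟨g₂, hr₂, hg₂, hk₂⟩ := ih₂ (t + 1) { c with pc := c.pc + e₁.cost, reg := g₁ } (by omega)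
      hwf.2 hP2.left (fun r hr => by rw [← hreg r hr]; exact congrArg _ (hk₁ r (by omega))) hmem
    have hP3 := hP2.right.head
    have hP4 := hP2.right.tail.head
    rw [Expr.length_code] at hP3 hP4
    have hgt : (g₂ t).toNat = v₁ := by rw [hk₂ t (by omega)]; exact hg₁
    -- No overflow hypothesis is needed for addresses: a successful read lies inside `M`, which is
    -- no longer than the address space.
    have hlt : v₁ + v₂ < 2 ^ w := lt_of_lt_of_le (List.getElem?_eq_some_iff.mp h).1 hlen
    have haddr : (g₂ t + g₂ (t + 1)).toNat = v₁ + v₂ := by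
      rw [BitVec.toNat_add, hgt, hg₂, Nat.mod_eq_of_lt hlt]
    have hx : x < 2 ^ w := hM x (List.mem_of_getElem? h)
    refine ⟨Function.update (Function.update g₂ t (g₂ t + g₂ (t + 1))) t (BitVec.ofNat w x),
      ?_, ?_, ?_⟩
    · refine runFor_trans (c' := { c with
          pc := c.pc + e₁.cost + e₂.cost + 1
          reg := Function.update g₂ t (g₂ t + g₂ (t + 1)) })
        (t₁ := e₁.cost + e₂.cost + 1) (t₂ := 1)
        (runFor_trans (runFor_trans hr₁ hr₂) (runFor_one ?_)) (runFor_one ?_)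
      · simp only [step, hP3]
        simp [BinOp.eval]
      · simp only [step, hP4]
        simp only [Function.update_self, haddr, hmem, List.getElem?_map, h, Option.map_some]
        simp [Nat.add_assoc]
    · rw [Function.update_self, BitVec.toNat_ofNat, Nat.mod_eq_of_lt hx]
    · intro r hr
      rw [Function.update_of_ne (by omega), Function.update_of_ne (by omega), hk₂ r (by omega)]
      exact hk₁ r hr

theorem Ev.run_pair {w : ℕ} {M : List ℕ} {σ : St} {coords : List (WithTop ℝ)} {P : Program}
    (hM : ∀ x ∈ M, x < 2 ^ w) (hlen : M.length ≤ 2 ^ w) {e₁ e₂ : Expr} {v₁ v₂ : ℕ}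
    (h₁ : Ev w M σ e₁ v₁) (h₂ : Ev w M σ e₂ v₂) (c : Config w) (hwf₁ : e₁.WF = true)
    (hwf₂ : e₂.WF = true) (hP : Holds P c.pc (e₁.code 100))
    (hP2 : Holds P (c.pc + e₁.cost) (e₂.code 101)) (hs : Sim M c σ) :
    ∃ g : ℕ → BitVec w, runFor P coords (e₁.cost + e₂.cost) c =
        some { c with pc := c.pc + e₁.cost + e₂.cost, reg := g } ∧
      (g 100).toNat = v₁ ∧ (g 101).toNat = v₂ ∧ ∀ p,
        Sim M { c with pc := p, reg := g } σ := by
  obtain ⟨g₁, hr₁, hg₁, hk₁⟩ := h₁.run hM hlen 100 c le_rfl hwf₁ hP hs.reg hs.mem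
  obtain ⟨g₂, hr₂, hg₂, hk₂⟩ := h₂.run hM hlen 101 { c with pc := c.pc + e₁.cost, reg := g₁ }
    (by omega) hwf₂ hP2
    (fun r hr => by rw [← hs.reg r hr]; exact congrArg _ (hk₁ r (by omega))) hs.mem
  refine ⟨g₂, runFor_trans hr₁ hr₂, by rw [hk₂ 100 (by omega)]; exact hg₁, hg₂,
    fun p => ⟨fun r hr => ?_, hs.creg, hs.mem, hs.out⟩⟩
  rw [← hs.reg r hr]
  show (g₂ r).toNat = _
  rw [hk₂ r (by omega)]
  exact congrArg _ (hk₁ r (by omega))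

/-- The induction is on the execution, not on the program, so that a loop is handled one iteration
at a time. The code must be located at `c.pc` since its jump targets are absolute. The step counts
are exact: a false branch comes before the true one and pays for the jump over it, and every loop
test is followed by a jump either back to the loop head or out of the loop. -/
theorem Exec.run {w : ℕ} {M : List ℕ} {coords : List (WithTop ℝ)} {P : Program}
    (hM : ∀ x ∈ M, x < 2 ^ w) (hlen : M.length ≤ 2 ^ w) {s : Stmt} {σ σ' : St} {t : ℕ}
    (h : Exec w M coords s σ t σ') :
    ∀ c : Config w, s.WF = true → Holds P c.pc (s.code c.pc) → Sim M c σ →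
      ∃ c' : Config w, runFor P coords t c = some c' ∧ c'.pc = c.pc + s.size ∧ Sim M c' σ' := by
  induction h with
  | skip σ => exact fun c _ _ hs => ⟨c, rfl, rfl, hs⟩
  | @assign σ d e v h =>
    intro c hwf hP hs
    simp only [Stmt.WF, Bool.and_eq_true, decide_eq_true_eq] at hwf
    obtain ⟨g, hr, hg, hk⟩ := h.run hM hlen 100 c le_rfl hwf.2 hP.left hs.reg hs.mem
    have hP2 := hP.right.head
    rw [Expr.length_code] at hP2
    refine ⟨{ c with pc := c.pc + e.cost + 1, reg := Function.update g d (g 100) },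
      runFor_trans hr (runFor_one ?_), by simp [Stmt.size, Nat.add_assoc],
      ⟨fun r hr => ?_, hs.creg, hs.mem, hs.out⟩⟩
    · simp [step, hP2, BinOp.eval]
    · by_cases hrd : r = d
      · subst hrd; simp [hg]
      · simp [hrd, ← hs.reg r hr, hk r hr]
  | @getC σ d e v x h hx =>
    intro c hwf hP hs
    obtain ⟨g, hr, hg, hk⟩ := h.run hM hlen 100 c le_rfl hwf hP.left hs.reg hs.mem
    have hP2 := hP.right.head
    rw [Expr.length_code] at hP2
    refine ⟨{ c with pc := c.pc + e.cost + 1, reg := g, coordReg := Function.update c.coordReg d x },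
      runFor_trans hr (runFor_one ?_), by simp [Stmt.size, Nat.add_assoc],
      ⟨fun r hr => ?_, ?_, hs.mem, hs.out⟩⟩
    · simp [step, hP2, hg, hx]
    · simp [← hs.reg r hr, hk r hr]
    · simp [St.setC, hs.creg]
  | @outp σ e v h =>
    intro c hwf hP hs
    obtain ⟨g, hr, hg, hk⟩ := h.run hM hlen 100 c le_rfl hwf hP.left hs.reg hs.mem
    have hP2 := hP.right.head
    rw [Expr.length_code] at hP2
    refine ⟨{ c with pc := c.pc + e.cost + 1, reg := g, out := c.out ++ [g 100] },
      runFor_trans hr (runFor_one ?_), by simp [Stmt.size, Nat.add_assoc],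
      ⟨fun r hr => ?_, hs.creg, hs.mem, ?_⟩⟩
    · simp [step, hP2]
    · simp [← hs.reg r hr, hk r hr]
    · simp [hs.out, hg]
  | @seq s₁ s₂ σ₁ σ₂ σ₃ t₁ t₂ h₁ h₂ ih₁ ih₂ =>
    intro c hwf hP hs
    simp only [Stmt.WF, Bool.and_eq_true] at hwf
    obtain ⟨c₁, hr₁, hp₁, hs₁⟩ := ih₁ c hwf.1 hP.left hs
    have hP2 := hP.right
    rw [Stmt.length_code, ← hp₁] at hP2
    obtain ⟨c₂, hr₂, hp₂, hs₂⟩ := ih₂ c₁ hwf.2 hP2 hs₁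
    exact ⟨c₂, runFor_trans hr₁ hr₂, by simp [Stmt.size, hp₂, hp₁, Nat.add_assoc], hs₂⟩
  | @ite_true e₁ e₂ s₁ s₂ σ σ' v₁ v₂ t h₁ h₂ h hs ih =>
    intro c hwf hP hsim
    simp only [Stmt.WF, Bool.and_eq_true] at hwf
    have hP2 := hP.right
    have hP3 := hP2.right
    have hP4 := hP3.tail.right.tail
    simp only [Expr.length_code, Stmt.length_code] at hP2 hP3 hP4
    obtain ⟨g, hr, hg₁, hg₂, hk⟩ := h₁.run_pair hM hlen h₂ c hwf.1.1.1 hwf.1.1.2 hP.left hP2.left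
      hsim (coords := coords)
    obtain ⟨c', hr', hp', hs'⟩ := ih
      { c with pc := c.pc + e₁.cost + e₂.cost + 2 + s₂.size, reg := g } hwf.1.2
      (by convert hP4 using 1; simp; omega) (hk _)
    refine ⟨c', runFor_trans (runFor_trans hr (runFor_one ?_)) hr', ?_, hs'⟩
    · simp [step, hP3.head, hg₁, hg₂, h]
    · simp only [hp', Stmt.size]; omega
  | @ite_false e₁ e₂ s₁ s₂ σ σ' v₁ v₂ t h₁ h₂ h hs ih =>
    intro c hwf hP hsim
    simp only [Stmt.WF, Bool.and_eq_true] at hwf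
    have hP2 := hP.right
    have hP3 := hP2.right
    have hP4 := hP3.tail.left
    have hP5 := hP3.tail.right.head
    simp only [Expr.length_code, Stmt.length_code] at hP2 hP3 hP4 hP5
    obtain ⟨g, hr, hg₁, hg₂, hk⟩ := h₁.run_pair hM hlen h₂ c hwf.1.1.1 hwf.1.1.2 hP.left hP2.left
      hsim (coords := coords)
    obtain ⟨c', hr', hp', hs'⟩ := ih
      { c with pc := c.pc + e₁.cost + e₂.cost + 1, reg := g } hwf.2 hP4 (hk _)
    refine ⟨{ c' with pc := c.pc + e₁.cost + e₂.cost + 2 + s₂.size + s₁.size }, ?_, ?_,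
      ⟨hs'.reg, hs'.creg, hs'.mem, hs'.out⟩⟩
    · rw [show e₁.cost + e₂.cost + 2 + t = e₁.cost + e₂.cost + 1 + t + 1 by omega]
      refine runFor_trans (runFor_trans (runFor_trans hr (runFor_one ?_)) hr') (runFor_one ?_)
      · simp [step, hP3.head, hg₁, hg₂, h]
      · rw [← hp'] at hP5
        simp [step, hP5]
    · simp only [Stmt.size]; omega
  | @cite_true a₁ a₂ s₁ s₂ σ σ' t h hs ih =>
    intro c hwf hP hsim
    simp only [Stmt.WF, Bool.and_eq_true] at hwf
    have hP4 := hP.tail.right.tail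
    simp only [Stmt.length_code] at hP4
    obtain ⟨c', hr', hp', hs'⟩ := ih
      { c with pc := c.pc + 2 + s₂.size } hwf.1
      (by convert hP4 using 1; simp; omega) ⟨hsim.reg, hsim.creg, hsim.mem, hsim.out⟩
    refine ⟨c', runFor_trans (runFor_one ?_) hr', ?_, hs'⟩
    · simp [step, hP.head, hsim.creg, h]
    · simp only [hp', Stmt.size]; omega
  | @cite_false a₁ a₂ s₁ s₂ σ σ' t h hs ih =>
    intro c hwf hP hsim
    simp only [Stmt.WF, Bool.and_eq_true] at hwf
    have hP4 := hP.tail.left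
    have hP5 := hP.tail.right.head
    simp only [Stmt.length_code] at hP5
    obtain ⟨c', hr', hp', hs'⟩ := ih
      { c with pc := c.pc + 1 } hwf.2 hP4 ⟨hsim.reg, hsim.creg, hsim.mem, hsim.out⟩
    refine ⟨{ c' with pc := c.pc + 2 + s₂.size + s₁.size }, ?_, ?_,
      ⟨hs'.reg, hs'.creg, hs'.mem, hs'.out⟩⟩
    · rw [show 2 + t = 1 + t + 1 by omega]
      refine runFor_trans (runFor_trans (runFor_one ?_) hr') (runFor_one ?_)
      · simp [step, hP.head, hsim.creg, h]
      · rw [← hp'] at hP5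
        simp [step, hP5]
    · simp only [Stmt.size]; omega
  | @whil_true e₁ e₂ s σ σ' σ'' v₁ v₂ t t' h₁ h₂ h hs hw ih ihw =>
    intro c hwf hP hsim
    have hwf' := hwf
    simp only [Stmt.WF, Bool.and_eq_true] at hwf
    have hP2 := hP.right
    have hP3 := hP2.right
    have hP4 := hP3.tail.tail.left
    have hP5 := hP3.tail.tail.right.head
    simp only [Expr.length_code, Stmt.length_code] at hP2 hP3 hP4 hP5
    obtain ⟨g, hr, hg₁, hg₂, hk⟩ := h₁.run_pair hM hlen h₂ c hwf.1.1 hwf.1.2 hP.left hP2.left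
      hsim (coords := coords)
    obtain ⟨c₁, hr₁, hp₁, hs₁⟩ := ih
      { c with pc := c.pc + e₁.cost + e₂.cost + 2, reg := g } hwf.2 hP4 (hk _)
    obtain ⟨c₂, hr₂, hp₂, hs₂⟩ := ihw { c₁ with pc := c.pc } hwf' hP
      ⟨hs₁.reg, hs₁.creg, hs₁.mem, hs₁.out⟩
    refine ⟨c₂, ?_, hp₂, hs₂⟩
    rw [show e₁.cost + e₂.cost + 2 + t + t' = e₁.cost + e₂.cost + 1 + t + 1 + t' by omega]
    refine runFor_trans (runFor_trans (runFor_trans (runFor_trans hr (runFor_one ?_)) hr₁)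
      (runFor_one ?_)) hr₂
    · simp [step, hP3.head, hg₁, hg₂, h]
    · rw [show c.pc + e₁.cost + e₂.cost + 1 + 1 + s.size = c₁.pc by rw [hp₁]] at hP5
      simp [step, hP5]
  | @whil_false e₁ e₂ s σ v₁ v₂ h₁ h₂ h =>
    intro c hwf hP hsim
    simp only [Stmt.WF, Bool.and_eq_true] at hwf
    have hP2 := hP.right
    have hP3 := hP2.right
    have hP4 := hP3.tail.head
    simp only [Expr.length_code] at hP2 hP3 hP4
    obtain ⟨g, hr, hg₁, hg₂, hk⟩ := h₁.run_pair hM hlen h₂ c hwf.1.1 hwf.1.2 hP.left hP2.left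
      hsim (coords := coords)
    refine ⟨{ c with pc := c.pc + e₁.cost + e₂.cost + 3 + s.size, reg := g }, ?_, ?_, hk _⟩
    · rw [show e₁.cost + e₂.cost + 2 = e₁.cost + e₂.cost + 1 + 1 from rfl]
      refine runFor_trans (runFor_trans hr (runFor_one (c' :=
        { c with pc := c.pc + e₁.cost + e₂.cost + 1, reg := g }) ?_)) (runFor_one ?_)
      · simp [step, hP3.head, hg₁, hg₂, h]
      · simp [step, hP4]
    · simp only [Stmt.size]; omega

/-! ## Weakest preconditions -/

/-- The program `s` terminates from `σ`, and `Q` holds of the number of steps and the final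
state. -/
def WP (w : ℕ) (M : List ℕ) (coords : List (WithTop ℝ)) (s : Stmt) (σ : St)
    (Q : ℕ → St → Prop) : Prop :=
  ∃ t σ', Exec w M coords s σ t σ' ∧ Q t σ'

section WP

variable {w : ℕ} {M : List ℕ} {coords : List (WithTop ℝ)} {σ : St} {Q : ℕ → St → Prop}

theorem WP.mono {s : Stmt} {Q' : ℕ → St → Prop} (h : WP w M coords s σ Q')
    (hQ : ∀ t σ', Q' t σ' → Q t σ') : WP w M coords s σ Q := by
  obtain ⟨t, σ', h, hq⟩ := h
  exact ⟨t, σ', h, hQ _ _ hq⟩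

theorem WP.skip (h : Q 0 σ) : WP w M coords .skip σ Q := ⟨_, _, .skip _, h⟩

theorem WP.assign {d : ℕ} {e : Expr} {v : ℕ} (h : Ev w M σ e v) (hq : Q (e.cost + 1) (σ.set d v)) :
    WP w M coords (.assign d e) σ Q := ⟨_, _, .assign _ h, hq⟩

theorem WP.getC {d : ℕ} {e : Expr} {v : ℕ} {x : WithTop ℝ} (h : Ev w M σ e v)
    (hx : coords[v]? = some x) (hq : Q (e.cost + 1) (σ.setC d x)) :
    WP w M coords (.getC d e) σ Q := ⟨_, _, .getC _ h hx, hq⟩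

theorem WP.outp {e : Expr} {v : ℕ} (h : Ev w M σ e v) (hq : Q (e.cost + 1) (σ.emit v)) :
    WP w M coords (.outp e) σ Q := ⟨_, _, .outp h, hq⟩

theorem WP.seq {s₁ s₂ : Stmt}
    (h : WP w M coords s₁ σ fun t₁ σ₁ => WP w M coords s₂ σ₁ fun t₂ σ₂ => Q (t₁ + t₂) σ₂) :
    WP w M coords (.seq s₁ s₂) σ Q := by
  obtain ⟨t₁, σ₁, h₁, t₂, σ₂, h₂, hq⟩ := h
  exact ⟨_, _, .seq h₁ h₂, hq⟩

theorem WP.ite {e₁ e₂ : Expr} {s₁ s₂ : Stmt} {v₁ v₂ : ℕ} (h₁ : Ev w M σ e₁ v₁)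
    (h₂ : Ev w M σ e₂ v₂)
    (ht : v₁ < v₂ → WP w M coords s₁ σ fun t σ' => Q (e₁.cost + e₂.cost + 1 + t) σ')
    (hf : ¬ v₁ < v₂ → WP w M coords s₂ σ fun t σ' => Q (e₁.cost + e₂.cost + 2 + t) σ') :
    WP w M coords (.ite e₁ e₂ s₁ s₂) σ Q := by
  by_cases h : v₁ < v₂
  · obtain ⟨t, σ', he, hq⟩ := ht h
    exact ⟨_, _, .ite_true h₁ h₂ h he, hq⟩
  · obtain ⟨t, σ', he, hq⟩ := hf h
    exact ⟨_, _, .ite_false h₁ h₂ h he, hq⟩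

theorem WP.cite {a₁ a₂ : ℕ} {s₁ s₂ : Stmt}
    (ht : σ.creg a₁ < σ.creg a₂ → WP w M coords s₁ σ fun t σ' => Q (1 + t) σ')
    (hf : ¬ σ.creg a₁ < σ.creg a₂ → WP w M coords s₂ σ fun t σ' => Q (2 + t) σ') :
    WP w M coords (.cite a₁ a₂ s₁ s₂) σ Q := by
  by_cases h : σ.creg a₁ < σ.creg a₂
  · obtain ⟨t, σ', he, hq⟩ := ht h
    exact ⟨_, _, .cite_true h he, hq⟩
  · obtain ⟨t, σ', he, hq⟩ := hf h
    exact ⟨_, _, .cite_false h he, hq⟩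

theorem WP.whil_true {e₁ e₂ : Expr} {s : Stmt} {v₁ v₂ : ℕ} (h₁ : Ev w M σ e₁ v₁)
    (h₂ : Ev w M σ e₂ v₂) (h : v₁ < v₂)
    (hb : WP w M coords s σ fun t σ' =>
      WP w M coords (.whil e₁ e₂ s) σ' fun t' σ'' => Q (e₁.cost + e₂.cost + 2 + t + t') σ'') :
    WP w M coords (.whil e₁ e₂ s) σ Q := by
  obtain ⟨t₁, σ₁, hs₁, t₂, σ₂, hs₂, hq⟩ := hb
  exact ⟨_, _, .whil_true h₁ h₂ h hs₁ hs₂, hq⟩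

theorem WP.whil_false {e₁ e₂ : Expr} {s : Stmt} {v₁ v₂ : ℕ} (h₁ : Ev w M σ e₁ v₁)
    (h₂ : Ev w M σ e₂ v₂) (h : ¬ v₁ < v₂) (hq : Q (e₁.cost + e₂.cost + 2) σ) :
    WP w M coords (.whil e₁ e₂ s) σ Q := ⟨_, _, .whil_false h₁ h₂ h, hq⟩

end WP

/-- The machine program of a structured program. -/
def Stmt.program (s : Stmt) : Program := s.code 0 ++ [.halt]

/-- The structured language has no stores, so `Sim` relates all configurations to the same `M`; this
is why the programs leave the memory as they found it. -/
theorem Exec.answersIn {w : ℕ} {M : List ℕ} {coords : List (WithTop ℝ)}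
    (hM : ∀ x ∈ M, x < 2 ^ w) (hlen : M.length ≤ 2 ^ w) {s : Stmt} (hwf : s.WF = true) {q : Point}
    {σ' : St} {t : ℕ}
    (h : Exec w M coords s ⟨fun _ => 0, (startConfig (w := w) [] q).coordReg, []⟩ t σ') :
    ∃ out : List (BitVec w), AnswersIn s.program (M.map (BitVec.ofNat w)) coords q t out ∧
      out.map BitVec.toNat = σ'.out := by
  have hP : Holds s.program 0 (s.code 0 ++ [.halt]) := fun i x hx => by
    simpa [Stmt.program] using hx
  obtain ⟨c', hr, hp, hs⟩ := h.run hM hlen (P := s.program)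
    (startConfig (M.map (BitVec.ofNat w)) q) hwf hP.left
    ⟨fun r hr => by simp [startConfig], rfl, rfl, rfl⟩
  have hh := hP.right.head
  rw [Stmt.length_code] at hh
  refine ⟨c'.out, ⟨c', hr, ?_, hs.mem, rfl⟩, hs.out⟩
  rw [hp]
  exact hh

end Stabbing

namespace Stabbing

/-! ## Lists -/

theorem filter_orderedInsert {α : Type*} (r : α → α → Prop) [DecidableRel r] [Std.Total r]
    [IsTrans α r] (p : α → Bool) (a : α) (L : List α) (hL : L.Pairwise r) :
    (L.orderedInsert r a).filter p =
      if p a then (L.filter p).orderedInsert r a else L.filter p := by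
  induction L with
  | nil => by_cases h : p a <;> simp [h]
  | cons c L ih =>
    have ih := ih hL.of_cons
    rw [List.orderedInsert_cons]
    by_cases hac : r a c
    · rw [if_pos hac]
      by_cases ha : p a
      · by_cases hc : p c
        · simp [ha, hc, hac]
        -- The neighbour `c` that stopped the insertion is filtered out, so `a` now meets a later
        -- entry `d`; transitivity through `c` stops the insertion there as well.
        · rw [if_pos ha, List.filter_cons_of_pos ha, List.filter_cons_of_neg hc]
          cases hf : L.filter p with
          | nil => simp
          | cons d L' =>
            have hd : d ∈ L := List.mem_of_mem_filter (hf ▸ List.mem_cons_self)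
            rw [List.orderedInsert_cons, if_pos (_root_.trans hac (List.rel_of_pairwise_cons hL hd))]
      · simp [ha]
    · rw [if_neg hac]
      by_cases hc : p c
      · rw [List.filter_cons_of_pos hc, ih, List.filter_cons_of_pos hc]
        by_cases ha : p a <;> simp [ha, hac]
      · rw [List.filter_cons_of_neg hc, ih, List.filter_cons_of_neg hc]

/-- This is stability of the sort. It makes the bottom list of a descendant a subsequence of the
bottom list of its ancestor even when several boxes share the same `x1`, which is what gives ranks
their meaning. -/
theorem filter_insertionSort {α : Type*} (r : α → α → Prop) [DecidableRel r] [Std.Total r]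
    [IsTrans α r] (p : α → Bool) (L : List α) :
    (L.insertionSort r).filter p = (L.filter p).insertionSort r := by
  induction L with
  | nil => rfl
  | cons a L ih =>
    rw [List.insertionSort_cons, filter_orderedInsert r p a _ (List.pairwise_insertionSort r L), ih]
    by_cases h : p a <;> simp [h]

/-- Along the list `p` can only switch from true to false, so its solutions form a prefix. With `p`
the test `x1 ≤ x` this turns a filtered bottom list into a prefix. -/
theorem take_countP_eq_filter {α : Type*} (p : α → Bool) (L : List α)
    (hL : L.Pairwise fun a c => p c → p a) : L.take (L.countP p) = L.filter p := by
  induction L with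
  | nil => rfl
  | cons a L ih =>
    by_cases ha : p a
    · simp [ha, ih hL.of_cons]
    · have h0 : L.countP p = 0 := by
        rw [List.countP_eq_zero]
        intro c hc h
        exact ha (List.rel_of_pairwise_cons hL hc h)
      rw [List.countP_cons_of_neg ha, h0, List.filter_cons_of_neg ha, List.take_zero]
      rw [List.countP_eq_length_filter] at h0
      exact (List.length_eq_zero_iff.mp h0).symm

theorem getElem?_filter_of_getElem? {α : Type*} (p : α → Bool) (L : List α) (j : ℕ) (a : α)
    (h : L[j]? = some a) (ha : p a) : (L.filter p)[(L.take j).countP p]? = some a := by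
  induction L generalizing j with
  | nil => simp at h
  | cons c L ih =>
    cases j with
    | zero =>
      simp only [List.getElem?_cons_zero, Option.some.injEq] at h
      subst h
      simp [ha]
    | succ j =>
      have := ih j (by simpa using h)
      by_cases hc : p c <;> simpa [hc] using this

theorem countP_take_succ {α : Type*} (p : α → Bool) (L : List α) (j : ℕ) (a : α)
    (h : L[j]? = some a) :
    (L.take (j + 1)).countP p = (L.take j).countP p + if p a then 1 else 0 := by
  rw [List.take_add_one, h, List.countP_append]
  simp [List.countP_cons]

/-! ## Packing small numbers into words -/

theorem exists_packed (φ : ℕ) (F : ℕ → ℕ) (hF : ∀ e, F e < 2 ^ φ) (f : ℕ) :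
    ∃ x < 2 ^ (φ * f), ∀ e < f, x / 2 ^ (φ * e) % 2 ^ φ = F e := by
  induction f generalizing F with
  | zero => exact ⟨0, by simp, by simp⟩
  | succ f ih =>
    obtain ⟨x, hx, hxe⟩ := ih (fun e => F (e + 1)) (fun e => hF _)
    refine ⟨x * 2 ^ φ + F 0, ?_, ?_⟩
    · calc x * 2 ^ φ + F 0 < x * 2 ^ φ + 2 ^ φ := by have := hF 0; omega
        _ = (x + 1) * 2 ^ φ := by ring
        _ ≤ 2 ^ (φ * f) * 2 ^ φ := Nat.mul_le_mul_right _ hx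
        _ = 2 ^ (φ * (f + 1)) := by rw [← pow_add, Nat.mul_succ]
    · intro e he
      cases e with
      | zero => simp [Nat.mod_eq_of_lt (hF 0)]
      | succ e =>
        rw [← hxe e (by omega), Nat.mul_succ, Nat.add_comm (φ * e), pow_add, ← Nat.div_div_eq_div_mul,
          Nat.add_comm, Nat.add_mul_div_right _ _ (by positivity), Nat.div_eq_of_lt (hF 0),
          Nat.zero_add]

/-- The number of ones among the lowest `s` bits. -/
def popCount (s x : ℕ) : ℕ := (List.range s).countP fun e => x / 2 ^ e % 2 = 1

/-- Masking a chunk to its lowest `r` bits turns a partial count into a full one, so a single table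
over `s`-bit words serves every position inside a chunk. -/
theorem popCount_mod (s r x : ℕ) (hr : r ≤ s) :
    popCount s (x % 2 ^ r) = (List.range r).countP fun e => x / 2 ^ e % 2 = 1 := by
  obtain ⟨k, rfl⟩ := Nat.exists_eq_add_of_le hr
  rw [popCount, List.range_add, List.countP_append]
  have h1 : ((List.range k).map (r + ·)).countP (fun e => x % 2 ^ r / 2 ^ e % 2 = 1) = 0 := by
    rw [List.countP_eq_zero]
    intro e he
    obtain ⟨e', -, rfl⟩ := List.mem_map.mp he
    have : x % 2 ^ r / 2 ^ (r + e') = 0 :=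
      Nat.div_eq_of_lt (lt_of_lt_of_le (Nat.mod_lt _ (by positivity))
        (Nat.pow_le_pow_right (by norm_num) (by omega)))
    simp [this]
  rw [h1, Nat.add_zero]
  refine List.countP_congr fun e he => ?_
  rw [List.mem_range] at he
  have h := Nat.testBit_mod_two_pow x r e
  rw [Nat.testBit_eq_decide_div_mod_eq, Nat.testBit_eq_decide_div_mod_eq] at h
  simp only [he, decide_true, Bool.true_and] at h
  rw [h]

/-! ## Bottom lists -/

section BottomList

variable {n : ℕ} (b : Fin n → CanonicalBox)

theorem RangeTree.bottomList_perm (v : RangeTree n) : (v.bottomList b).Perm v.leaves :=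
  List.perm_insertionSort _ _

theorem RangeTree.length_bottomList (v : RangeTree n) :
    (v.bottomList b).length = v.leaves.length :=
  List.length_insertionSort _ _

theorem RangeTree.mem_bottomList {v : RangeTree n} {i : Fin n} :
    i ∈ v.bottomList b ↔ i ∈ v.leaves :=
  (v.bottomList_perm b).mem_iff

instance : Std.Total fun i j : Fin n => (b i).x1 ≤ (b j).x1 := ⟨fun _ _ => le_total _ _⟩
instance : IsTrans (Fin n) fun i j => (b i).x1 ≤ (b j).x1 := ⟨fun _ _ _ => le_trans⟩

theorem RangeTree.bottomList_pairwise (v : RangeTree n) :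
    (v.bottomList b).Pairwise fun i j => (b i).x1 ≤ (b j).x1 :=
  List.pairwise_insertionSort _ _

theorem RangeTree.filter_bottomList {u v : RangeTree n}
    (h : v.leaves.filter (· ∈ u.leaves) = u.leaves) :
    (v.bottomList b).filter (· ∈ u.leaves) = u.bottomList b := by
  rw [RangeTree.bottomList, filter_insertionSort, h]
  rfl

open scoped Classical in
/-- The number of boxes below a node whose `x`-range contains `x`. -/
noncomputable def RangeTree.count (x : ℝ) (v : RangeTree n) : ℕ :=
  v.leaves.countP fun i => (b i).x1 ≤ x

/-- The boxes below a node whose `x`-range contains `x`, sorted by `x1`. -/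
noncomputable def RangeTree.piece (x : ℝ) (v : RangeTree n) : List (Fin n) :=
  (v.bottomList b).take (v.count b x)

theorem RangeTree.count_le (x : ℝ) (v : RangeTree n) : v.count b x ≤ v.leaves.length :=
  List.countP_le_length

theorem RangeTree.length_piece (x : ℝ) (v : RangeTree n) :
    (v.piece b x).length = v.count b x := by
  rw [RangeTree.piece, List.length_take, RangeTree.length_bottomList]
  exact min_eq_left (v.count_le b x)

open scoped Classical in
theorem RangeTree.piece_eq_filter (x : ℝ) (v : RangeTree n) :
    v.piece b x = (v.bottomList b).filter fun i => (b i).x1 ≤ x := by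
  rw [RangeTree.piece, RangeTree.count, ← (v.bottomList_perm b).countP_eq, take_countP_eq_filter]
  refine (v.bottomList_pairwise b).imp fun {i j} h => ?_
  simpa using fun h' => h.trans h'

/-- The number of leaf descendants of `u` among the first `j` entries of `P(v)`. -/
noncomputable def RangeTree.rank (v u : RangeTree n) (j : ℕ) : ℕ :=
  ((v.bottomList b).take j).countP (· ∈ u.leaves)

/-- The prefix of `P(v)` selected by `x`, restricted to the leaves of `u`, is the prefix of `P(u)`
selected by `x`. Thus prefix lengths are handed down from node to node without searching by `x`
again. -/
theorem RangeTree.rank_count {u v : RangeTree n} (x : ℝ)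
    (h : v.leaves.filter (· ∈ u.leaves) = u.leaves) :
    v.rank b u (v.count b x) = u.count b x := by
  classical
  have h1 := RangeTree.piece_eq_filter b x v
  rw [RangeTree.piece] at h1
  rw [RangeTree.rank, h1, List.countP_filter, RangeTree.count, ← (u.bottomList_perm b).countP_eq,
    ← RangeTree.filter_bottomList b h, List.countP_filter]
  refine List.countP_congr fun i _ => ?_
  simp [and_comm]

/-- `P(u)` is a subsequence of `P(v)`, so the place of an entry in it is the number of earlier
entries that survive. This is the step by which an entry is followed towards its leaf. -/
theorem RangeTree.getElem?_rank {u v : RangeTree n} {j : ℕ} {i : Fin n}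
    (h : v.leaves.filter (· ∈ u.leaves) = u.leaves) (hj : (v.bottomList b)[j]? = some i)
    (hi : i ∈ u.leaves) : (u.bottomList b)[v.rank b u j]? = some i := by
  rw [← RangeTree.filter_bottomList b h]
  exact getElem?_filter_of_getElem? _ _ _ _ hj (by simpa using hi)

theorem RangeTree.rank_le (v u : RangeTree n) (j : ℕ) : v.rank b u j ≤ j :=
  List.countP_le_length.trans (by rw [List.length_take]; exact min_le_left _ _)

theorem filter_leaves_right {l r : RangeTree n} (h : (RangeTree.node l r).leaves.Nodup) :
    (RangeTree.node l r).leaves.filter (· ∈ r.leaves) = r.leaves := by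
  rw [RangeTree.leaves, List.nodup_append] at h
  rw [RangeTree.leaves, List.filter_append, List.filter_eq_nil_iff.mpr, List.nil_append,
    List.filter_eq_self.mpr (by simp)]
  intro i hi
  simpa using fun hr => h.2.2 i hi i hr rfl

theorem filter_leaves_left {l r : RangeTree n} (h : (RangeTree.node l r).leaves.Nodup) :
    (RangeTree.node l r).leaves.filter (· ∈ l.leaves) = l.leaves := by
  rw [RangeTree.leaves, List.nodup_append] at h
  rw [RangeTree.leaves, List.filter_append, List.filter_eq_self.mpr (by simp),
    List.filter_eq_nil_iff.mpr, List.append_nil]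
  intro i hi
  simpa using fun hr => h.2.2 i hr i hi rfl

theorem count_node (x : ℝ) (l r : RangeTree n) :
    (RangeTree.node l r).count b x = l.count b x + r.count b x := by
  simp [RangeTree.count, RangeTree.leaves]

end BottomList

end Stabbing

namespace Stabbing

noncomputable section

open scoped Classical

/-! ## Queries in range trees -/

section RangeTree

variable {n : ℕ} (b : Fin n → CanonicalBox)

/-- The key of the first leaf. -/
def RangeTree.firstKey (key : Fin n → WithTop ℝ) : RangeTree n → WithTop ℝ
  | .nil => ⊤
  | .leaf i => key i
  | .node l _ => l.firstKey key

/-- The maximal subtrees all of whose keys are at most `y` (or above `y` if `up`), found along a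
path. -/
def RangeTree.canon (key : Fin n → WithTop ℝ) (y : WithTop ℝ) (up : Bool) :
    RangeTree n → List (RangeTree n)
  | .nil => []
  | .leaf i => if decide (y < key i) = up then [.leaf i] else []
  | .node l r =>
    if y < r.firstKey key then (if up then r :: l.canon key y up else l.canon key y up)
    else (if up then r.canon key y up else l :: r.canon key y up)

/-- The tree is nonempty and all its nodes with height `h` have between `2 ^ h` and `2 ^ (h + 1)`
leaf descendants. -/
def RangeTree.Bal : ℕ → RangeTree n → Prop
  | _, .nil => False
  | h, .leaf _ => h = 0
  | h, .node l r => 2 ^ h ≤ (RangeTree.node l r).leaves.length ∧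
      (RangeTree.node l r).leaves.length ≤ 2 ^ (h + 1) ∧ l.Bal (h - 1) ∧ r.Bal (h - 1)

theorem RangeTree.leaves_ofList (L : List (Fin n)) : (RangeTree.ofList L).leaves = L := by
  induction L using RangeTree.ofList.induct with
  | case1 => rw [RangeTree.ofList]; rfl
  | case2 i => rw [RangeTree.ofList]; rfl
  | case3 i j L ih₁ ih₂ =>
    rw [RangeTree.ofList, RangeTree.leaves, ih₁, ih₂, List.take_append_drop]

theorem RangeTree.bal_ofList (L : List (Fin n)) (h : ℕ) (h₁ : 2 ^ h ≤ L.length)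
    (h₂ : L.length ≤ 2 ^ (h + 1)) : (RangeTree.ofList L).Bal h := by
  induction L using RangeTree.ofList.induct generalizing h with
  | case1 => simp at h₁
  | case2 i =>
    rw [RangeTree.ofList]
    by_contra hh
    have : 2 ^ 1 ≤ 2 ^ h := Nat.pow_le_pow_right (by norm_num) (Nat.one_le_iff_ne_zero.mpr hh)
    simp only [List.length_singleton] at h₁
    omega
  | case3 i j L ih₁ ih₂ =>
    set M := i :: j :: L with hM
    have hlen : 2 ≤ M.length := by simp [hM]
    have hml : M.length = (M.take (M.length / 2)).length + (M.drop (M.length / 2)).length := by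
      rw [← List.length_append, List.take_append_drop]
    have htl : (M.take (M.length / 2)).length = M.length / 2 := by
      rw [List.length_take]; omega
    rw [hM, RangeTree.ofList, ← hM]
    refine ⟨?_, ?_, ?_, ?_⟩
    · rw [RangeTree.leaves, leaves_ofList, leaves_ofList, List.take_append_drop]; exact h₁
    · rw [RangeTree.leaves, leaves_ofList, leaves_ofList, List.take_append_drop]; exact h₂
    -- At height `0` the list has exactly two entries, and the truncated `h - 1` is again `0`: both
    -- halves are single leaves.
    · cases h with
      | zero => exact ih₁ 0 (by norm_num at *; omega) (by norm_num at *; omega)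
      | succ h =>
        rw [pow_succ] at h₁ h₂
        exact ih₁ h (by omega) (by omega)
    · cases h with
      | zero => exact ih₂ 0 (by norm_num at *; omega) (by norm_num at *; omega)
      | succ h =>
        rw [pow_succ] at h₁ h₂
        have := pow_succ 2 h
        exact ih₂ h (by omega) (by omega)

theorem RangeTree.Bal.length_pos {h : ℕ} {T : RangeTree n} (hT : T.Bal h) :
    0 < T.leaves.length := by
  induction T generalizing h with
  | nil => exact hT.elim
  | leaf i => simp [RangeTree.leaves]
  | node l r ih₁ ih₂ =>
    have := ih₁ hT.2.2.1
    simp only [RangeTree.leaves, List.length_append]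
    omega

theorem RangeTree.Bal.firstKey_spec {h : ℕ} {T : RangeTree n} (hT : T.Bal h)
    (key : Fin n → WithTop ℝ) : ∃ i L, T.leaves = i :: L ∧ T.firstKey key = key i := by
  induction T generalizing h with
  | nil => exact hT.elim
  | leaf i => exact ⟨i, [], rfl, rfl⟩
  | node l r ih₁ ih₂ =>
    obtain ⟨i, L, hL, hk⟩ := ih₁ hT.2.2.1
    exact ⟨i, L ++ r.leaves, by rw [RangeTree.leaves, hL]; rfl, hk⟩

/-- The leaves are sorted by `key`, so comparing `y` with the first key of the right child settles
one child completely: either all keys on the right exceed `y`, or no key on the left does. The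
settled child is taken whole or dropped, and the recursion continues in the other one. -/
theorem RangeTree.Bal.leaves_canon_perm {h : ℕ} {T : RangeTree n} (hT : T.Bal h)
    (key : Fin n → WithTop ℝ) (hs : T.leaves.Pairwise fun i j => key i ≤ key j) (y : WithTop ℝ)
    (up : Bool) : ((T.canon key y up).flatMap RangeTree.leaves).Perm
      (T.leaves.filter fun i => decide (y < key i) = up) := by
  induction T generalizing h with
  | nil => exact hT.elim
  | leaf i =>
    by_cases hi : decide (y < key i) = up <;> simp [RangeTree.canon, RangeTree.leaves, hi]
  | node l r ih₁ ih₂ =>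
    rw [RangeTree.leaves, List.pairwise_append] at hs
    have ih₁ := ih₁ hT.2.2.1 hs.1
    have ih₂ := ih₂ hT.2.2.2 hs.2.1
    obtain ⟨i, L, hL, hk⟩ := hT.2.2.2.firstKey_spec key
    rw [RangeTree.canon, RangeTree.leaves, List.filter_append, hk]
    have hir : i ∈ r.leaves := by rw [hL]; exact List.mem_cons_self
    by_cases hy : y < key i
    · have hr : ∀ j ∈ r.leaves, y < key j := by
        intro j hj
        rw [hL] at hj
        rcases List.mem_cons.mp hj with rfl | hj
        · exact hy
        · exact hy.trans_le (List.rel_of_pairwise_cons (R := fun i j => key i ≤ key j) (hL ▸ hs.2.1) hj)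
      rw [if_pos hy]
      cases up with
      | false =>
        have hf : r.leaves.filter (fun i => decide (y < key i) = false) = [] :=
          List.filter_eq_nil_iff.mpr fun j hj => by simpa using hr j hj
        rw [hf, List.append_nil]
        simpa using ih₁
      | true =>
        have hf : r.leaves.filter (fun i => decide (y < key i) = true) = r.leaves :=
          List.filter_eq_self.mpr fun j hj => by simpa using hr j hj
        rw [hf]
        simp only [if_true, List.flatMap_cons]
        exact List.perm_append_comm.trans (ih₁.append_right _)
    · have hl : ∀ j ∈ l.leaves, ¬ y < key j := fun j hj =>
        not_lt.mpr ((hs.2.2 j hj i hir).trans (not_lt.mp hy))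
      rw [if_neg hy]
      cases up with
      | true =>
        have hf : l.leaves.filter (fun i => decide (y < key i) = true) = [] :=
          List.filter_eq_nil_iff.mpr fun j hj => by simpa using hl j hj
        rw [hf, List.nil_append]
        simpa using ih₂
      | false =>
        have hf : l.leaves.filter (fun i => decide (y < key i) = false) = l.leaves :=
          List.filter_eq_self.mpr fun j hj => by simpa using hl j hj
        rw [hf]
        simpa using ih₂.append_left _

theorem RangeTree.piece_perm (x : ℝ) (v : RangeTree n) :
    (v.piece b x).Perm (v.leaves.filter fun i => (b i).x1 ≤ x) := by
  rw [RangeTree.piece_eq_filter]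
  exact (v.bottomList_perm b).filter _

theorem flatMap_piece_perm (x : ℝ) (vs : List (RangeTree n)) :
    (vs.flatMap (RangeTree.piece b x)).Perm
      ((vs.flatMap RangeTree.leaves).filter fun i => (b i).x1 ≤ x) := by
  induction vs with
  | nil => rfl
  | cons v vs ih =>
    rw [List.flatMap_cons, List.flatMap_cons, List.filter_append]
    exact (v.piece_perm b x).append ih

/-- The height of a range tree. -/
def RangeTree.height : RangeTree n → ℕ
  | .nil => 0
  | .leaf _ => 0
  | .node l r => max l.height r.height + 1

theorem RangeTree.length_canon_le (key : Fin n → WithTop ℝ) (y : WithTop ℝ) (up : Bool)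
    (T : RangeTree n) : (T.canon key y up).length ≤ T.height + 1 := by
  induction T with
  | nil => simp [RangeTree.canon]
  | leaf i => rw [RangeTree.canon]; split_ifs <;> simp
  | node l r ih₁ ih₂ =>
    rw [RangeTree.canon, RangeTree.height]
    split_ifs <;> first | omega | (rw [List.length_cons]; omega)

theorem RangeTree.mem_subtrees_self {h : ℕ} {T : RangeTree n} (hT : T.Bal h) : T ∈ T.subtrees := by
  cases T with
  | nil => exact hT.elim
  | leaf i => simp [RangeTree.subtrees]
  | node l r => simp [RangeTree.subtrees]

theorem RangeTree.Bal.mem_subtrees_of_mem_canon {h : ℕ} {T : RangeTree n} (hT : T.Bal h)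
    (key : Fin n → WithTop ℝ) (y : WithTop ℝ) (up : Bool) {v : RangeTree n}
    (hv : v ∈ T.canon key y up) : v ∈ T.subtrees := by
  induction T generalizing h with
  | nil => exact hT.elim
  | leaf i =>
    rw [RangeTree.canon] at hv
    split_ifs at hv
    · simpa [RangeTree.subtrees] using hv
    · simp at hv
  | node l r ih₁ ih₂ =>
    have ih₁ := ih₁ hT.2.2.1
    have ih₂ := ih₂ hT.2.2.2
    have h₁ := mem_subtrees_self hT.2.2.1
    have h₂ := mem_subtrees_self hT.2.2.2
    rw [RangeTree.canon] at hv
    simp only [RangeTree.subtrees, List.mem_cons, List.mem_append]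
    split_ifs at hv
    · rcases List.mem_cons.mp hv with rfl | hv
      · exact Or.inr (Or.inr h₂)
      · exact Or.inr (Or.inl (ih₁ hv))
    · exact Or.inr (Or.inl (ih₁ hv))
    · exact Or.inr (Or.inr (ih₂ hv))
    · rcases List.mem_cons.mp hv with rfl | hv
      · exact Or.inr (Or.inl h₁)
      · exact Or.inr (Or.inr (ih₂ hv))

/-- The extra level comes from the nodes of height index `0` that still have two leaves. -/
theorem RangeTree.Bal.height_le {h : ℕ} {T : RangeTree n} (hT : T.Bal h) : T.height ≤ h + 1 := by
  induction T generalizing h with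
  | nil => exact hT.elim
  | leaf i => simp [RangeTree.height]
  | node l r ih₁ ih₂ =>
    cases h with
    | zero =>
      have h1 := hT.2.1
      have key : ∀ T : RangeTree n, T.Bal 0 → T.leaves.length ≤ 1 → T.height = 0 := by
        intro T hT h1
        cases T with
        | nil => rfl
        | leaf => rfl
        | node l r =>
          have := hT.2.2.1.length_pos
          have := hT.2.2.2.length_pos
          simp only [RangeTree.leaves, List.length_append] at h1
          omega
      have := hT.2.2.1.length_pos
      have := hT.2.2.2.length_pos
      simp only [RangeTree.leaves, List.length_append] at h1
      rw [RangeTree.height, key l hT.2.2.1 (by omega), key r hT.2.2.2 (by omega)]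
      simp
    | succ h =>
      have h1 := ih₁ hT.2.2.1
      have h2 := ih₂ hT.2.2.2
      rw [RangeTree.height]
      omega

theorem RangeTree.ofList_cases (L : List (Fin n)) :
    (L = [] ∧ RangeTree.ofList L = .nil) ∨ (RangeTree.ofList L).Bal (Nat.log 2 L.length) := by
  rcases eq_or_ne L [] with rfl | hL
  · exact Or.inl ⟨rfl, by rw [RangeTree.ofList]⟩
  · have : L.length ≠ 0 := by simpa using hL
    exact Or.inr (RangeTree.bal_ofList L _ (Nat.pow_log_le_self 2 this)
      (Nat.lt_pow_succ_log_self (by norm_num) _).le)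

theorem RangeTree.leaves_canon_ofList_perm (key : Fin n → WithTop ℝ) (L : List (Fin n))
    (hs : L.Pairwise fun i j => key i ≤ key j) (y : WithTop ℝ) (up : Bool) :
    (((RangeTree.ofList L).canon key y up).flatMap RangeTree.leaves).Perm
      (L.filter fun i => decide (y < key i) = up) := by
  rcases RangeTree.ofList_cases L with ⟨rfl, h⟩ | h
  · rw [h]; rfl
  · have := h.leaves_canon_perm key (by rwa [RangeTree.leaves_ofList]) y up
    rwa [RangeTree.leaves_ofList] at this

end RangeTree

/-! ## Queries in interval trees -/

section IntervalTree

variable {n : ℕ} (b : Fin n → CanonicalBox)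

/-- The range tree nodes visited by a query in an interval tree. -/
def IntervalTree.visits (y : ℝ) : IntervalTree n → List (RangeTree n)
  | .nil => []
  | .node m lo up l r =>
    if (y : WithTop ℝ) < m then lo.canon (fun i => (b i).y1) y false ++ l.visits y
    else up.canon (fun i => (b i).y2) y true ++ r.visits y

/-- Used in both upper layers to separate the boxes found at the present node (`a`) from those found
further down (`c`). -/
theorem filter_perm_split {α : Type*} (L : List α) (p a c : α → Prop) [DecidablePred p]
    [DecidablePred a] [DecidablePred c]
    (h : ∀ i ∈ L, p i ↔ a i ∨ c i) (hd : ∀ i ∈ L, a i → ¬ c i) :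
    (L.filter (fun i => a i) ++ L.filter (fun i => c i)).Perm (L.filter fun i => p i) := by
  have h1 : L.filter (fun i => a i) = (L.filter fun i => p i).filter fun i => a i := by
    rw [List.filter_filter]
    refine List.filter_congr fun i hi => ?_
    have := h i hi
    by_cases h1 : a i <;> simp_all
  have h2 : L.filter (fun i => c i) = (L.filter fun i => p i).filter fun i => !decide (a i) := by
    rw [List.filter_filter]
    refine List.filter_congr fun i hi => ?_
    have := h i hi
    have := hd i hi
    by_cases h1 : a i <;> simp_all
  rw [h1, h2]
  exact List.filter_append_perm _ _

/-- If `y` lies left of the median, a box containing the median has `y` below its upper end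
automatically, so only `y1 ≤ y` is tested, and no box to the right of the median can contain `y`. If
`y` is at or right of the median, the lower end is automatic and `y < y2` is tested. -/
theorem IntervalTree.visits_perm (y : ℝ) (L : List (Fin n)) :
    (((IntervalTree.build b L).visits b y).flatMap RangeTree.leaves).Perm
      (L.filter fun i => y ∈ (b i).yRange) := by
  induction L using IntervalTree.build.induct b with
  | case1 => rw [IntervalTree.build]; simp [ IntervalTree.visits]
  | case2 L hL ih₁ ih₂ =>
    rw [IntervalTree.build, dif_neg hL, IntervalTree.visits]
    split_ifs with hy
    · rw [List.flatMap_append]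
      refine ((RangeTree.leaves_canon_ofList_perm (fun i => ((b i).y1 : WithTop ℝ)) _ ?_ _ _).append
        ih₁).trans ?_
      · refine (List.pairwise_insertionSort
          (fun i j : Fin n => (b i).y1 ≤ (b j).y1) _).imp fun h => ?_
        exact WithTop.coe_le_coe.mpr h
      · refine ((((List.perm_insertionSort _ _).filter _).append_right _)).trans ?_
        rw [yMiddle, yLeft, List.filter_filter, List.filter_filter]
        simp only [← Bool.decide_and]
        refine (List.Perm.of_eq ?_).trans (filter_perm_split L _
          (fun i => ¬ ((y : WithTop ℝ) < (b i).y1) ∧ ((b i).y1 : WithTop ℝ) ≤ yMedian b L ∧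
            yMedian b L < (b i).y2)
          (fun i => y ∈ (b i).yRange ∧ (b i).y2 ≤ yMedian b L) ?_ ?_)
        · congr 1; exact List.filter_congr fun i _ => by simp
        · intro i _
          have hlt := (b i).y1_lt_y2
          simp only [CanonicalBox.yRange, Set.mem_ofPred_eq, WithTop.coe_lt_coe, not_lt]
          constructor
          · rintro ⟨h1, h2⟩
            by_cases h3 : (b i).y2 ≤ yMedian b L
            · exact Or.inr ⟨⟨h1, h2⟩, h3⟩
            · exact Or.inl ⟨h1, (WithTop.coe_le_coe.mpr h1).trans hy.le, not_le.mp h3⟩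
          · rintro (⟨h1, h2, h3⟩ | ⟨h1, h2⟩)
            · exact ⟨h1, hy.trans h3⟩
            · exact h1
        · intro i _ h1 h2
          exact absurd h1.2.2 (not_lt.mpr h2.2)
    · rw [List.flatMap_append]
      refine ((RangeTree.leaves_canon_ofList_perm (fun i => (b i).y2) _ ?_ _ _).append
        ih₂).trans ?_
      · exact List.pairwise_insertionSort
          (fun i j : Fin n => (b i).y2 ≤ (b j).y2) _
      · refine ((((List.perm_insertionSort _ _).filter _).append_right _)).trans ?_
        rw [yMiddle, yRight, List.filter_filter, List.filter_filter]
        simp only [← Bool.decide_and]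
        refine (List.Perm.of_eq ?_).trans (filter_perm_split L _
          (fun i => ((y : WithTop ℝ) < (b i).y2) ∧ ((b i).y1 : WithTop ℝ) ≤ yMedian b L ∧
            yMedian b L < (b i).y2)
          (fun i => y ∈ (b i).yRange ∧ yMedian b L < (b i).y1) ?_ ?_)
        · congr 1; exact List.filter_congr fun i _ => by simp
        · intro i _
          have hlt := (b i).y1_lt_y2
          rw [not_lt] at hy
          simp only [CanonicalBox.yRange, Set.mem_ofPred_eq]
          constructor
          · rintro ⟨h1, h2⟩
            by_cases h3 : yMedian b L < (b i).y1
            · exact Or.inr ⟨⟨h1, h2⟩, h3⟩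
            · exact Or.inl ⟨h2, not_lt.mp h3, hy.trans_lt h2⟩
          · rintro (⟨h1, h2, h3⟩ | ⟨h1, h2⟩)
            · exact ⟨WithTop.coe_le_coe.mp (h2.trans hy), h1⟩
            · exact h1
        · intro i _ h1 h2
          exact absurd h2.2 (not_lt.mpr h1.2.1)

/-- The height of an interval tree. -/
def IntervalTree.depth : IntervalTree n → ℕ
  | .nil => 0
  | .node _ _ _ l r => max l.depth r.depth + 1

theorem IntervalTree.length_visits_le (y : ℝ) (H : ℕ) (t : IntervalTree n)
    (ht : ∀ T ∈ t.rangeTrees, T.height ≤ H) :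
    (t.visits b y).length ≤ t.depth * (H + 1) := by
  induction t with
  | nil => simp [IntervalTree.visits]
  | node m lo up l r ih₁ ih₂ =>
    simp only [IntervalTree.rangeTrees, List.mem_cons, List.mem_append] at ht
    have ih₁ := ih₁ fun T hT => ht T (by tauto)
    have ih₂ := ih₂ fun T hT => ht T (by tauto)
    have h1 := RangeTree.length_canon_le (fun i => ((b i).y1 : WithTop ℝ)) y false lo
    have h2 := RangeTree.length_canon_le (fun i => (b i).y2) y true up
    have h3 := ht lo (by tauto)
    have h4 := ht up (by tauto)
    have h5 := Nat.mul_le_mul_right (H + 1) (le_max_left l.depth r.depth)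
    have h6 := Nat.mul_le_mul_right (H + 1) (le_max_right l.depth r.depth)
    rw [IntervalTree.visits, IntervalTree.depth, Nat.add_mul]
    split_ifs <;> rw [List.length_append] <;> omega

theorem IntervalTree.rangeTrees_build (L : List (Fin n)) :
    ∀ T ∈ (IntervalTree.build b L).rangeTrees, ∃ L', L'.length ≤ L.length ∧
      T = RangeTree.ofList L' := by
  induction L using IntervalTree.build.induct b with
  | case1 => rw [IntervalTree.build]; simp [ IntervalTree.rangeTrees]
  | case2 L hL ih₁ ih₂ =>
    rw [IntervalTree.build, dif_neg hL, IntervalTree.rangeTrees]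
    have hm : (yMiddle b L).length ≤ L.length := List.length_filter_le _ _
    intro T hT
    simp only [List.mem_cons, List.mem_append] at hT
    rcases hT with rfl | rfl | hT | hT
    · exact ⟨_, by rwa [List.length_insertionSort], rfl⟩
    · exact ⟨_, by rwa [List.length_insertionSort], rfl⟩
    · obtain ⟨L', h, rfl⟩ := ih₁ T hT
      exact ⟨L', h.trans (length_yLeft_lt b L hL).le, rfl⟩
    · obtain ⟨L', h, rfl⟩ := ih₂ T hT
      exact ⟨L', h.trans (length_yRight_lt b L hL).le, rfl⟩

theorem RangeTree.height_ofList_le {L : List (Fin n)} {m : ℕ} (h : L.length ≤ m) :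
    (RangeTree.ofList L).height ≤ Nat.log 2 m + 1 := by
  rcases RangeTree.ofList_cases L with ⟨rfl, h'⟩ | h'
  · rw [h']; simp [RangeTree.height]
  · exact h'.height_le.trans (Nat.succ_le_succ (Nat.log_mono_right h))

theorem IntervalTree.mem_subtrees_of_mem_visits (y : ℝ) (t : IntervalTree n)
    (ht : ∀ T ∈ t.rangeTrees, ∃ L, T = RangeTree.ofList L) {v : RangeTree n}
    (hv : v ∈ t.visits b y) : ∃ T ∈ t.rangeTrees, v ∈ T.subtrees := by
  have key : ∀ T : RangeTree n, (∃ L, T = RangeTree.ofList L) → ∀ (k : Fin n → WithTop ℝ) up,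
      v ∈ T.canon k y up → v ∈ T.subtrees := by
    rintro T ⟨L, rfl⟩ k up h
    rcases RangeTree.ofList_cases L with ⟨rfl, h'⟩ | h'
    · rw [h'] at h; simp [RangeTree.canon] at h
    · exact h'.mem_subtrees_of_mem_canon _ _ _ h
  induction t with
  | nil => simp [IntervalTree.visits] at hv
  | node m lo up l r ih₁ ih₂ =>
    simp only [IntervalTree.rangeTrees, List.mem_cons, List.mem_append] at ht ⊢
    rw [IntervalTree.visits] at hv
    split_ifs at hv
    · rcases List.mem_append.mp hv with hv | hv
      · exact ⟨lo, by tauto, key lo (ht lo (by tauto)) _ _ hv⟩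
      · obtain ⟨T, hT, h⟩ := ih₁ (fun T hT => ht T (by tauto)) hv
        exact ⟨T, by tauto, h⟩
    · rcases List.mem_append.mp hv with hv | hv
      · exact ⟨up, by tauto, key up (ht up (by tauto)) _ _ hv⟩
      · obtain ⟨T, hT, h⟩ := ih₂ (fun T hT => ht T (by tauto)) hv
        exact ⟨T, by tauto, h⟩

/-! ### Logarithmic depth of the interval trees -/

theorem yEndpoints_sublist {L L' : List (Fin n)} (h : L'.Sublist L) :
    (yEndpoints b L').Sublist (yEndpoints b L) := by
  induction h with
  | slnil => exact List.Sublist.refl _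
  | cons a _ ih => exact ih.trans (by simp only [yEndpoints, List.flatMap_cons]; exact List.sublist_append_right _ _)
  | cons_cons a _ ih =>
    simp only [yEndpoints, List.flatMap_cons]
    exact (List.Sublist.refl _).append ih

/-- The lower median is the sorted entry with index `L.length - 1`, so everything strictly below it
is among the earlier entries. Allowing any `c` up to the median makes it possible to compare the
medians of two lists. -/
theorem countP_lt_yEndpoints_le (L : List (Fin n)) (hL : L ≠ []) {c : WithTop ℝ}
    (hc : c ≤ yMedian b L) : (yEndpoints b L).countP (fun t => t < c) ≤ L.length - 1 := by
  obtain ⟨hlt, hm⟩ := yMedian_eq_getElem b L hL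
  set s := (yEndpoints b L).insertionSort (· ≤ ·) with hs
  have hsorted : s.Pairwise (· ≤ ·) := List.pairwise_insertionSort _ _
  rw [← (List.perm_insertionSort (· ≤ ·) (yEndpoints b L)).countP_eq, ← hs,
    ← List.take_append_drop (L.length - 1) s, List.countP_append]
  have hz : (s.drop (L.length - 1)).countP (fun t => t < c) = 0 := by
    rw [List.countP_eq_zero]
    intro t ht
    rw [List.mem_iff_getElem] at ht
    obtain ⟨k, hk, rfl⟩ := ht
    rw [List.getElem_drop]
    simp only [decide_eq_true_eq, not_lt]
    refine hc.trans ?_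
    rw [hm]
    rcases Nat.eq_zero_or_pos k with rfl | hkpos
    · exact le_of_eq rfl
    · exact List.pairwise_iff_getElem.mp hsorted _ _ _ _ (by omega)
  have ht : (s.take (L.length - 1)).countP (fun t => t < c) ≤ L.length - 1 :=
    le_trans List.countP_le_length (by rw [List.length_take]; omega)
  omega

theorem countP_gt_yEndpoints_le (L : List (Fin n)) (hL : L ≠ []) :
    (yEndpoints b L).countP (fun t => yMedian b L < t) ≤ L.length := by
  obtain ⟨hlt, hm⟩ := yMedian_eq_getElem b L hL
  have hpos : 0 < L.length := List.length_pos_iff.mpr hL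
  set s := (yEndpoints b L).insertionSort (· ≤ ·) with hs
  have hsl : s.length = 2 * L.length := by
    rw [hs, List.length_insertionSort, length_yEndpoints]
  have hsorted : s.Pairwise (· ≤ ·) := List.pairwise_insertionSort _ _
  rw [← (List.perm_insertionSort (· ≤ ·) (yEndpoints b L)).countP_eq, ← hs,
    ← List.take_append_drop L.length s, List.countP_append]
  have hz : (s.take L.length).countP (fun t => yMedian b L < t) = 0 := by
    rw [List.countP_eq_zero]
    intro t ht
    rw [List.mem_iff_getElem] at ht
    obtain ⟨k, hk, rfl⟩ := ht
    rw [List.length_take] at hk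
    rw [List.getElem_take]
    simp only [decide_eq_true_eq, not_lt]
    rw [hm]
    rcases Nat.lt_or_ge k (L.length - 1) with h | h
    · exact List.pairwise_iff_getElem.mp hsorted _ _ _ _ h
    · exact le_of_eq (by congr 1; omega)
  have ht : (s.drop L.length).countP (fun t => yMedian b L < t) ≤ L.length :=
    le_trans List.countP_le_length (by rw [List.length_drop]; omega)
  omega

theorem le_countP_yEndpoints (p : WithTop ℝ → Bool) (M : List (Fin n))
    (h : ∀ i ∈ M, p (b i).y1) : M.length ≤ (yEndpoints b M).countP p := by
  induction M with
  | nil => simp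
  | cons i M ih =>
    have h2 := ih fun j hj => h j (by simp [hj])
    simp only [yEndpoints] at h2 ⊢
    rw [List.flatMap_cons, List.countP_append, List.countP_cons]
    simp only [h i (by simp), if_true, List.length_cons]
    omega

theorem two_mul_le_countP_yEndpoints (p : WithTop ℝ → Bool) (M : List (Fin n))
    (h : ∀ i ∈ M, p (b i).y1) (h' : ∀ i ∈ M, p (b i).y2) :
    2 * M.length ≤ (yEndpoints b M).countP p := by
  induction M with
  | nil => simp
  | cons i M ih =>
    have h2 := ih (fun j hj => h j (by simp [hj])) (fun j hj => h' j (by simp [hj]))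
    simp only [yEndpoints] at h2 ⊢
    rw [List.flatMap_cons, List.countP_append, List.countP_cons, List.countP_cons]
    simp only [h i (by simp), h' i (by simp), if_true, List.length_cons, List.countP_nil]
    omega

/-- A box to the right has both endpoints strictly above the median, and at most half of the
endpoints are there. -/
theorem two_mul_length_yRight_le (L : List (Fin n)) (hL : L ≠ []) :
    2 * (yRight b L).length ≤ L.length := by
  have hmem : ∀ i ∈ yRight b L, yMedian b L < ((b i).y1 : WithTop ℝ) := fun i hi => by
    simpa using (List.mem_filter.mp hi).2
  refine (two_mul_le_countP_yEndpoints b (fun t => yMedian b L < t) _ ?_ ?_).trans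
    (((yEndpoints_sublist b List.filter_sublist).countP_le).trans (countP_gt_yEndpoints_le b L hL))
  · intro i hi; simpa using hmem i hi
  · intro i hi; simpa using (hmem i hi).trans (b i).y1_lt_y2

/-- One step to the left need not halve the list, because the upper endpoints may tie with the
median. The lower endpoints of the left boxes are strictly below it, however, which is enough to
push the median of the left list strictly below the old one. After a second left step both endpoints
of every remaining box are strictly below the old median. -/
theorem two_mul_length_yLeft_yLeft_lt (L : List (Fin n)) (hL : L ≠ []) :
    2 * (yLeft b (yLeft b L)).length < L.length := by
  have hpos : 0 < L.length := List.length_pos_iff.mpr hL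
  have hmem : ∀ L : List (Fin n), ∀ i ∈ yLeft b L, (b i).y2 ≤ yMedian b L := fun L i hi => by
    simpa using (List.mem_filter.mp hi).2
  rcases eq_or_ne (yLeft b L) [] with h0 | h0
  · rw [h0]; simpa [yLeft] using hpos
  have hmed : yMedian b (yLeft b L) < yMedian b L := by
    by_contra hcon
    have h1 := countP_lt_yEndpoints_le b (yLeft b L) h0 (not_lt.mp hcon)
    have h2 := le_countP_yEndpoints b (fun t => t < yMedian b L) (yLeft b L) (fun i hi => by
      simpa using (b i).y1_lt_y2.trans_le (hmem L i hi))
    have := List.length_pos_iff.mpr h0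
    omega
  have h3 := two_mul_le_countP_yEndpoints b (fun t => t < yMedian b L) (yLeft b (yLeft b L))
    (fun i hi => by
      simpa using (b i).y1_lt_y2.trans ((hmem _ i hi).trans_lt hmed))
    (fun i hi => by simpa using (hmem _ i hi).trans_lt hmed)
  have h4 := (yEndpoints_sublist b ((List.filter_sublist (l := yLeft b L)
    (p := fun i => (b i).y2 ≤ yMedian b (yLeft b L))).trans
      (List.filter_sublist (l := L)))).countP_le (p := fun t => t < yMedian b L)
  have h5 := countP_lt_yEndpoints_le b L hL le_rfl
  have h6 := h3.trans (h4.trans h5)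
  omega

/-- Two levels are needed per halving: a right step halves at once, a left step only together with
the step after it. -/
theorem IntervalTree.depth_build_le (k : ℕ) (L : List (Fin n)) (hL : L.length < 2 ^ k) :
    (IntervalTree.build b L).depth ≤ 2 * k := by
  induction k generalizing L with
  | zero =>
    have : L = [] := by simpa using hL
    rw [IntervalTree.build, dif_pos this]
    simp [IntervalTree.depth]
  | succ k ih =>
    rw [pow_succ] at hL
    rw [IntervalTree.build]
    split_ifs with h0
    · simp [IntervalTree.depth]
    have h1 := two_mul_length_yRight_le b L h0
    have h2 := two_mul_length_yLeft_yLeft_lt b L h0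
    have hr := ih (yRight b L) (by omega)
    have hl : (IntervalTree.build b (yLeft b L)).depth ≤ 2 * k + 1 := by
      rw [IntervalTree.build]
      split_ifs with h0'
      · simp [IntervalTree.depth]
      have h3 := two_mul_length_yRight_le b (yLeft b L) h0'
      have h4 := length_yLeft_lt b L h0
      have h5 := ih (yLeft b (yLeft b L)) (by omega)
      have h6 := ih (yRight b (yLeft b L)) (by omega)
      rw [IntervalTree.depth]
      omega
    rw [IntervalTree.depth]
    omega

end IntervalTree

end

end Stabbing

namespace Stabbing

noncomputable section

open scoped Classical

/-! ## Queries in segment trees -/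

section SegmentTree

variable {n : ℕ} (b : Fin n → CanonicalBox)

/-- The range tree nodes visited by a query in the three-layer structure. -/
def SegmentTree.visits (y z : ℝ) : SegmentTree n → List (RangeTree n)
  | .leaf m => m.visits b y
  | .node k m l r => m.visits b y ++ if z < k then l.visits y z else r.visits y z

/-- The height of a segment tree. -/
def SegmentTree.depth : SegmentTree n → ℕ
  | .leaf _ => 1
  | .node _ _ l r => max l.depth r.depth + 1

/-- The increasing list `keys` cuts the interval `I` into nonempty parts. -/
structure Cuts (keys : List ℝ) (I : Set ℝ) : Prop where
  sorted : keys.Pairwise (· < ·)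
  mem : ∀ k ∈ keys, k ∈ I
  ordConnected : I.OrdConnected
  bot : ∃ t ∈ I, ∀ k ∈ keys, t < k

theorem Cuts.nonempty {keys : List ℝ} {I : Set ℝ} (h : Cuts keys I) : I.Nonempty :=
  let ⟨t, ht, _⟩ := h.bot
  ⟨t, ht⟩

theorem Cuts.split {keys : List ℝ} {I : Set ℝ} (h : Cuts keys I) (hk : keys ≠ []) :
    ∃ (hlt : keys.length / 2 < keys.length),
      (∀ e ∈ keys.take (keys.length / 2), e < keys[keys.length / 2]) ∧
      (∀ e ∈ keys.drop (keys.length / 2 + 1), keys[keys.length / 2] < e) ∧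
      (∀ e ∈ keys, e ∈ keys.take (keys.length / 2) ∨ e = keys[keys.length / 2] ∨
        e ∈ keys.drop (keys.length / 2 + 1)) := by
  have hlt : keys.length / 2 < keys.length :=
    Nat.div_lt_self (List.length_pos_iff.mpr hk) (by norm_num)
  have hs := h.sorted
  have hdec : keys = keys.take (keys.length / 2) ++
      keys[keys.length / 2] :: keys.drop (keys.length / 2 + 1) := by
    rw [List.getElem_cons_drop, List.take_append_drop]
  have hs' := hs
  rw [hdec, List.pairwise_append, List.pairwise_cons] at hs'
  refine ⟨hlt, fun e he => hs'.2.2 e he _ List.mem_cons_self, fun e he => hs'.2.1.1 e he,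
    fun e he => ?_⟩
  rw [hdec] at he
  simpa only [List.mem_append, List.mem_cons] using he

theorem Cuts.left {keys : List ℝ} {I : Set ℝ} (h : Cuts keys I) (hk : keys ≠ [])
    (hlt : keys.length / 2 < keys.length) :
    Cuts (keys.take (keys.length / 2)) (I ∩ Set.Iio keys[keys.length / 2]) := by
  obtain ⟨_, h1, h2, h3⟩ := h.split hk
  have := h.ordConnected
  obtain ⟨t, ht, htk⟩ := h.bot
  exact ⟨h.sorted.sublist (List.take_sublist _ _),
    fun k hk => ⟨h.mem k (List.mem_of_mem_take hk), h1 k hk⟩,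
    h.ordConnected.inter Set.ordConnected_Iio,
    t, ⟨ht, htk _ (List.getElem_mem _)⟩, fun k hk => htk k (List.mem_of_mem_take hk)⟩

theorem Cuts.right {keys : List ℝ} {I : Set ℝ} (h : Cuts keys I) (hk : keys ≠ [])
    (hlt : keys.length / 2 < keys.length) :
    Cuts (keys.drop (keys.length / 2 + 1)) (I ∩ Set.Ici keys[keys.length / 2]) := by
  obtain ⟨_, h1, h2, h3⟩ := h.split hk
  exact ⟨h.sorted.sublist (List.drop_sublist _ _),
    fun k hk => ⟨h.mem k (List.mem_of_mem_drop hk), (h2 k hk).le⟩,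
    h.ordConnected.inter Set.ordConnected_Ici,
    _, ⟨h.mem _ (List.getElem_mem _), Set.mem_Ici.mpr le_rfl⟩, h2⟩

/-- Every endpoint of a `z`-range is one of the keys or does not cut `I`. -/
def Covers (keys : List ℝ) (I : Set ℝ) : Prop :=
  ∀ (i : Fin n) (e : ℝ), e = (b i).z1 ∨ (e : WithTop ℝ) = (b i).z2 →
    e ∈ keys ∨ I ⊆ Set.Iio e ∨ I ⊆ Set.Ici e

variable {b} in
theorem Covers.left {keys : List ℝ} {I : Set ℝ} (hc : Covers b keys I) (h : Cuts keys I)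
    (hk : keys ≠ []) (hlt : keys.length / 2 < keys.length) :
    Covers b (keys.take (keys.length / 2)) (I ∩ Set.Iio keys[keys.length / 2]) := by
  obtain ⟨_, h1, h2, h3⟩ := h.split hk
  intro i e he
  rcases hc i e he with h' | h' | h'
  · rcases h3 e h' with h' | rfl | h'
    · exact Or.inl h'
    · exact Or.inr (Or.inl Set.inter_subset_right)
    · exact Or.inr (Or.inl (Set.inter_subset_right.trans (Set.Iio_subset_Iio (h2 e h').le)))
  · exact Or.inr (Or.inl (Set.inter_subset_left.trans h'))
  · exact Or.inr (Or.inr (Set.inter_subset_left.trans h'))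

variable {b} in
theorem Covers.right {keys : List ℝ} {I : Set ℝ} (hc : Covers b keys I) (h : Cuts keys I)
    (hk : keys ≠ []) (hlt : keys.length / 2 < keys.length) :
    Covers b (keys.drop (keys.length / 2 + 1)) (I ∩ Set.Ici keys[keys.length / 2]) := by
  obtain ⟨_, h1, h2, h3⟩ := h.split hk
  intro i e he
  rcases hc i e he with h' | h' | h'
  · rcases h3 e h' with h' | rfl | h'
    · exact Or.inr (Or.inr (Set.inter_subset_right.trans (Set.Ici_subset_Ici.mpr (h1 e h').le)))
    · exact Or.inr (Or.inr Set.inter_subset_right)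
    · exact Or.inl h'
  · exact Or.inr (Or.inl (Set.inter_subset_left.trans h'))
  · exact Or.inr (Or.inr (Set.inter_subset_left.trans h'))

/-- The condition `¬ J ⊆ zRange` excludes the boxes already collected higher up. At an inner node
the remaining boxes split according to whether they cover `I`: those that do are assigned here, the
others satisfy the condition for the child, whose parent interval is `I`. At a leaf no endpoint cuts
`I`, so a box that contains `z` covers all of `I`. -/
theorem SegmentTree.visits_perm (y z : ℝ) (keys : List ℝ) (J I : Set ℝ) (hI : Cuts keys I)
    (hc : Covers b keys I) (hIJ : I ⊆ J) (hz : z ∈ I) :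
    (((SegmentTree.build b keys J I).visits b y z).flatMap RangeTree.leaves).Perm
      ((List.finRange n).filter fun i =>
        z ∈ (b i).zRange ∧ y ∈ (b i).yRange ∧ ¬ J ⊆ (b i).zRange) := by
  induction keys, J, I using SegmentTree.build.induct with
  | case1 J I =>
    rw [SegmentTree.build, dif_pos rfl, SegmentTree.visits]
    refine (IntervalTree.visits_perm b y _).trans ?_
    rw [assigned, List.filter_filter]
    refine List.Perm.of_eq (List.filter_congr fun i _ => ?_)
    rw [Bool.eq_iff_iff]
    simp only [Bool.and_eq_true, decide_eq_true_eq]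
    constructor
    · rintro ⟨h1, h2, h3⟩
      exact ⟨h2 hz, h1, h3⟩
    · rintro ⟨h1, h2, h3⟩
      refine ⟨h2, fun t ht => ⟨?_, ?_⟩, h3⟩
      · rcases hc i (b i).z1 (Or.inl rfl) with h | h | h
        · simp at h
        · exact absurd h1.1 (not_le.mpr (h hz))
        · exact h ht
      · rcases eq_or_ne (b i).z2 ⊤ with h4 | h4
        · rw [h4]; exact WithTop.coe_lt_top t
        · obtain ⟨e, he⟩ := WithTop.ne_top_iff_exists.mp h4
          rw [← he]
          rcases hc i e (Or.inr he) with h | h | h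
          · simp at h
          · exact WithTop.coe_lt_coe.mpr (h ht)
          · have := h1.2
            rw [← he, WithTop.coe_lt_coe] at this
            exact absurd this (not_lt.mpr (h hz))
  | case2 keys J I hk hlt ih₁ ih₂ =>
    rw [SegmentTree.build, dif_neg hk, SegmentTree.visits, List.flatMap_append]
    have hstep : (((if z < keys[keys.length / 2] then
        SegmentTree.visits b y z (SegmentTree.build b (keys.take (keys.length / 2)) I
          (I ∩ Set.Iio keys[keys.length / 2]))
        else SegmentTree.visits b y z (SegmentTree.build b (keys.drop (keys.length / 2 + 1)) I
          (I ∩ Set.Ici keys[keys.length / 2])))).flatMap RangeTree.leaves).Perm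
        ((List.finRange n).filter fun i =>
          z ∈ (b i).zRange ∧ y ∈ (b i).yRange ∧ ¬ I ⊆ (b i).zRange) := by
      split_ifs with h
      · exact ih₁ (hI.left hk hlt) (hc.left hI hk hlt) Set.inter_subset_left ⟨hz, h⟩
      · exact ih₂ (hI.right hk hlt) (hc.right hI hk hlt) Set.inter_subset_left ⟨hz, not_lt.mp h⟩
    refine ((IntervalTree.visits_perm b y _).append hstep).trans ?_
    rw [assigned, List.filter_filter]
    refine (List.Perm.of_eq ?_).trans (filter_perm_split (List.finRange n) _
      (fun i => y ∈ (b i).yRange ∧ I ⊆ (b i).zRange ∧ ¬ J ⊆ (b i).zRange)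
      (fun i => z ∈ (b i).zRange ∧ y ∈ (b i).yRange ∧ ¬ I ⊆ (b i).zRange) ?_ ?_)
    · congr 1
      exact List.filter_congr fun i _ => by simp
    · intro i _
      constructor
      · rintro ⟨h1, h2, h3⟩
        by_cases h4 : I ⊆ (b i).zRange
        · exact Or.inl ⟨h2, h4, h3⟩
        · exact Or.inr ⟨h1, h2, h4⟩
      · rintro (⟨h1, h2, h3⟩ | ⟨h1, h2, h3⟩)
        · exact ⟨h2 hz, h1, h3⟩
        · exact ⟨h1, h2, fun h => h3 (hIJ.trans h)⟩
    · intro i _ h1 h2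
      exact h2.2.2 h1.2.1

/-! ### The query in the whole structure, and the depth of the segment tree -/

theorem zKeys_spec (e : ℝ) : e ∈ zKeys b ↔
    ∃ i, e = (b i).z1 ∨ (e : WithTop ℝ) = (b i).z2 := by
  rw [zKeys, Finset.mem_sort, Finset.mem_union, Finset.mem_image, Finset.mem_image]
  constructor
  · rintro (⟨i, -, rfl⟩ | ⟨i, hi, rfl⟩)
    · exact ⟨i, Or.inl rfl⟩
    · simp only [Finset.mem_filter, Finset.mem_univ, true_and] at hi
      obtain ⟨e, he⟩ := WithTop.ne_top_iff_exists.mp hi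
      exact ⟨i, Or.inr (by rw [← he]; rfl)⟩
  · rintro ⟨i, rfl | he⟩
    · exact Or.inl ⟨i, Finset.mem_univ _, rfl⟩
    · refine Or.inr ⟨i, ?_, by rw [← he]; rfl⟩
      simp only [Finset.mem_filter, Finset.mem_univ, true_and]
      rw [← he]
      exact WithTop.coe_ne_top

theorem length_zKeys_le : (zKeys b).length ≤ 2 * n := by
  rw [zKeys, Finset.length_sort]
  refine (Finset.card_union_le _ _).trans ?_
  have h1 := Finset.card_image_le (s := Finset.univ) (f := fun i => (b i).z1)
  have h2 := (Finset.card_image_le (s := Finset.univ.filter fun i => (b i).z2 ≠ ⊤)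
    (f := fun i => (b i).z2.untopD 0)).trans (Finset.card_filter_le _ _)
  simp only [Finset.card_univ, Fintype.card_fin] at h1 h2
  omega

theorem cuts_zKeys : Cuts (zKeys b) Set.univ := by
  refine ⟨(Finset.sortedLT_sort _).pairwise, fun _ _ => trivial, Set.ordConnected_univ, ?_⟩
  obtain ⟨t, ht⟩ := (zKeys b).toFinset.finite_toSet.bddBelow
  refine ⟨t - 1, trivial, fun k hk => ?_⟩
  have := ht (List.mem_toFinset.mpr hk)
  linarith

theorem covers_zKeys : Covers b (zKeys b) Set.univ := fun i e he =>
  Or.inl ((zKeys_spec b e).mpr ⟨i, he⟩)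

theorem not_univ_subset_zRange (i : Fin n) : ¬ Set.univ ⊆ (b i).zRange := fun h => by
  have := (h (Set.mem_univ ((b i).z1 - 1))).1
  linarith

/-- The visited range tree nodes contribute exactly the boxes that contain the query point. -/
theorem flatMap_piece_visits_perm (q : Point) :
    (((structureOf b).visits b q.y q.z).flatMap (RangeTree.piece b q.x)).Perm
      ((List.finRange n).filter fun i => q ∈ (b i).region) := by
  refine (flatMap_piece_perm b q.x _).trans ?_
  refine ((SegmentTree.visits_perm b q.y q.z (zKeys b) Set.univ Set.univ (cuts_zKeys b)
    (covers_zKeys b) subset_rfl trivial).filter _).trans ?_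
  rw [List.filter_filter]
  refine List.Perm.of_eq (List.filter_congr fun i _ => ?_)
  have := not_univ_subset_zRange b i
  rw [Bool.eq_iff_iff]
  have hr : q ∈ (b i).region ↔ (b i).x1 ≤ q.x ∧ q.y ∈ (b i).yRange ∧ q.z ∈ (b i).zRange := Iff.rfl
  simp only [Bool.and_eq_true, decide_eq_true_eq, hr]
  tauto

theorem SegmentTree.depth_build_le (h : ℕ) (keys : List ℝ) (J I : Set ℝ)
    (hk : keys.length < 2 ^ h) : (SegmentTree.build b keys J I).depth ≤ h + 1 := by
  induction h generalizing keys J I with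
  | zero =>
    have : keys = [] := by simpa using hk
    rw [SegmentTree.build, dif_pos this]
    simp [SegmentTree.depth]
  | succ h ih =>
    rw [pow_succ] at hk
    rw [SegmentTree.build]
    split_ifs with h0
    · simp [SegmentTree.depth]
    · have h1 := ih (keys.take (keys.length / 2)) I (I ∩ Set.Iio (keys[keys.length / 2]'(
        Nat.div_lt_self (List.length_pos_iff.mpr h0) (by norm_num))))
        (by rw [List.length_take]; omega)
      have h2 := ih (keys.drop (keys.length / 2 + 1)) I (I ∩ Set.Ici (keys[keys.length / 2]'(
        Nat.div_lt_self (List.length_pos_iff.mpr h0) (by norm_num))))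
        (by rw [List.length_drop]; omega)
      rw [SegmentTree.depth]
      omega

theorem SegmentTree.length_visits_le (y z : ℝ) (D : ℕ) (t : SegmentTree n)
    (ht : ∀ m ∈ t.intervalTrees, (m.visits b y).length ≤ D) :
    (t.visits b y z).length ≤ t.depth * D := by
  induction t with
  | leaf m => simpa [SegmentTree.visits, SegmentTree.depth] using ht m (by simp [intervalTrees])
  | node k m l r ih₁ ih₂ =>
    simp only [intervalTrees, List.mem_cons, List.mem_append] at ht
    have ih₁ := ih₁ fun m hm => ht m (by tauto)
    have ih₂ := ih₂ fun m hm => ht m (by tauto)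
    have h0 := ht m (by tauto)
    have h5 := Nat.mul_le_mul_right D (le_max_left l.depth r.depth)
    have h6 := Nat.mul_le_mul_right D (le_max_right l.depth r.depth)
    rw [SegmentTree.visits, SegmentTree.depth, Nat.add_mul, List.length_append]
    split_ifs <;> omega

theorem SegmentTree.exists_of_mem_visits (y z : ℝ) (t : SegmentTree n) {v : RangeTree n}
    (hv : v ∈ t.visits b y z) : ∃ m ∈ t.intervalTrees, v ∈ m.visits b y := by
  induction t with
  | leaf m => exact ⟨m, by simp [intervalTrees], hv⟩
  | node k m l r ih₁ ih₂ =>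
    simp only [intervalTrees, List.mem_cons, List.mem_append]
    rw [SegmentTree.visits, List.mem_append] at hv
    rcases hv with hv | hv
    · exact ⟨m, by tauto, hv⟩
    · split_ifs at hv
      · obtain ⟨m', h, h'⟩ := ih₁ hv
        exact ⟨m', by tauto, h'⟩
      · obtain ⟨m', h, h'⟩ := ih₂ hv
        exact ⟨m', by tauto, h'⟩

theorem SegmentTree.intervalTrees_build (keys : List ℝ) (J I : Set ℝ) :
    ∀ m ∈ (SegmentTree.build b keys J I).intervalTrees,
      ∃ J' I', m = IntervalTree.build b (assigned b J' I') := by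
  induction keys, J, I using SegmentTree.build.induct with
  | case1 J I =>
    rw [SegmentTree.build, dif_pos rfl]
    intro m hm
    simp only [intervalTrees, List.mem_singleton] at hm
    exact ⟨_, _, hm⟩
  | case2 keys J I hk hlt ih₁ ih₂ =>
    rw [SegmentTree.build, dif_neg hk]
    intro m hm
    simp only [intervalTrees, List.mem_cons, List.mem_append] at hm
    rcases hm with hm | hm | hm
    · exact ⟨_, _, hm⟩
    · exact ih₁ m hm
    · exact ih₂ m hm

theorem length_assigned_le_card (J I : Set ℝ) : (assigned b J I).length ≤ n :=
  (List.length_filter_le _ _).trans (by simp)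

/-! ## The number of boxes in the structure -/

/-- The number of endpoints of `z`-ranges in a set. -/
def endpointsIn (I : Set ℝ) : ℕ :=
  (List.finRange n).countP (fun i => (b i).z1 ∈ I) +
    (List.finRange n).countP (fun i => ∃ e ∈ I, (e : WithTop ℝ) = (b i).z2)

theorem countP_or_le {α : Type*} (L : List α) (p q r : α → Prop) [DecidablePred p]
    [DecidablePred q] [DecidablePred r]
    (h : ∀ i ∈ L, p i → q i ∨ r i) :
    L.countP (fun i => p i) ≤ L.countP (fun i => q i) + L.countP (fun i => r i) := by
  induction L with
  | nil => simp
  | cons a L ih =>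
    have ih := ih fun i hi => h i (List.mem_cons_of_mem _ hi)
    have ha := h a List.mem_cons_self
    simp only [List.countP_cons]
    by_cases h1 : p a <;> by_cases h2 : q a <;> by_cases h3 : r a <;>
      simp_all <;> omega

theorem countP_add_le {α : Type*} (L : List α) (p q r : α → Prop) [DecidablePred p]
    [DecidablePred q] [DecidablePred r]
    (h : ∀ i ∈ L, q i ∨ r i → p i) (hd : ∀ i ∈ L, q i → ¬ r i) :
    L.countP (fun i => q i) + L.countP (fun i => r i) ≤ L.countP (fun i => p i) := by
  induction L with
  | nil => simp
  | cons a L ih =>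
    have ih := ih (fun i hi => h i (List.mem_cons_of_mem _ hi))
      (fun i hi => hd i (List.mem_cons_of_mem _ hi))
    have ha := h a List.mem_cons_self
    have hb := hd a List.mem_cons_self
    simp only [List.countP_cons]
    by_cases h1 : p a <;> by_cases h2 : q a <;> by_cases h3 : r a <;>
      simp_all <;> omega

/-- An assigned box contains some point of `I` and misses some point of `J`. One of its endpoints
separates the two points, and it lies in `J` because `J` is an interval. -/
theorem length_assigned_le {J I : Set ℝ} (hJ : J.OrdConnected) (hI : I.Nonempty) (hIJ : I ⊆ J) :
    (assigned b J I).length ≤ endpointsIn b J := by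
  rw [assigned, ← List.countP_eq_length_filter, endpointsIn]
  refine countP_or_le _ _ _ _ fun i _ ⟨h1, h2⟩ => ?_
  obtain ⟨u, hu⟩ := hI
  obtain ⟨t, ht, htn⟩ := Set.not_subset.mp h2
  have hur := h1 hu
  by_cases hz : (b i).z1 ≤ t
  · have h3 : (b i).z2 ≤ t := by
      by_contra h
      exact htn ⟨hz, not_le.mp h⟩
    obtain ⟨e, he⟩ := WithTop.ne_top_iff_exists.mp (ne_top_of_le_ne_top WithTop.coe_ne_top h3)
    refine Or.inr ⟨e, ?_, he⟩
    have h4 := hur.2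
    rw [← he] at h3 h4
    exact hJ.out (hIJ hu) ht ⟨(WithTop.coe_lt_coe.mp h4).le, WithTop.coe_le_coe.mp h3⟩
  · exact Or.inl (hJ.out ht (hIJ hu) ⟨(not_le.mp hz).le, hur.1⟩)

theorem endpointsIn_split (I : Set ℝ) (k : ℝ) :
    endpointsIn b (I ∩ Set.Iio k) + endpointsIn b (I ∩ Set.Ici k) ≤ endpointsIn b I := by
  have h1 := countP_add_le (List.finRange n) (fun i => (b i).z1 ∈ I)
    (fun i => (b i).z1 ∈ I ∩ Set.Iio k) (fun i => (b i).z1 ∈ I ∩ Set.Ici k)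
    (fun i _ h => by rcases h with h | h <;> exact h.1)
    (fun i _ h h' => absurd (Set.mem_Iio.mp h.2) (not_lt.mpr h'.2))
  have h2 := countP_add_le (List.finRange n) (fun i => ∃ e ∈ I, (e : WithTop ℝ) = (b i).z2)
    (fun i => ∃ e ∈ I ∩ Set.Iio k, (e : WithTop ℝ) = (b i).z2)
    (fun i => ∃ e ∈ I ∩ Set.Ici k, (e : WithTop ℝ) = (b i).z2)
    (fun i _ h => by rcases h with ⟨e, h, he⟩ | ⟨e, h, he⟩ <;> exact ⟨e, h.1, he⟩)
    (fun i _ ⟨e, h, he⟩ ⟨e', h', he'⟩ => by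
      have : e = e' := WithTop.coe_injective (he.trans he'.symm)
      subst this
      exact absurd (Set.mem_Iio.mp h.2) (not_lt.mpr h'.2))
  refine le_trans (le_of_eq ?_) (Nat.add_le_add h1 h2)
  rw [endpointsIn, endpointsIn, Nat.add_add_add_comm]
  congr!

theorem endpointsIn_le (I : Set ℝ) : endpointsIn b I ≤ 2 * n := by
  have h1 : (List.finRange n).countP (fun i => (b i).z1 ∈ I) ≤ n :=
    List.countP_le_length.trans (by simp)
  have h2 : (List.finRange n).countP (fun i => ∃ e ∈ I, (e : WithTop ℝ) = (b i).z2) ≤ n :=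
    List.countP_le_length.trans (by simp)
  rw [endpointsIn]
  omega

/-- The number of boxes stored in an interval tree. -/
def IntervalTree.boxes : IntervalTree n → ℕ
  | .nil => 0
  | .node _ lo _ l r => lo.leaves.length + l.boxes + r.boxes

/-- The total number of boxes stored in the interval trees of a segment tree. -/
def SegmentTree.boxes : SegmentTree n → ℕ
  | .leaf m => m.boxes
  | .node _ m l r => m.boxes + l.boxes + r.boxes

/-- The number of nodes of a segment tree. -/
def SegmentTree.nodes : SegmentTree n → ℕ
  | .leaf _ => 1
  | .node _ _ l r => 1 + l.nodes + r.nodes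

theorem length_yMiddle_add (L : List (Fin n)) :
    (yMiddle b L).length + (yLeft b L).length + (yRight b L).length = L.length := by
  have key : ∀ (m : WithTop ℝ) (M : List (Fin n)),
      (M.filter fun i => ((b i).y1 : WithTop ℝ) ≤ m ∧ m < (b i).y2).length +
        (M.filter fun i => (b i).y2 ≤ m).length +
        (M.filter fun i => m < ((b i).y1 : WithTop ℝ)).length = M.length := by
    intro m M
    induction M with
    | nil => rfl
    | cons i M ih =>
      have hlt := (b i).y1_lt_y2
      simp only [List.filter_cons, decide_eq_true_eq]
      by_cases h1 : (b i).y2 ≤ m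
      · have h2 : ¬ m < ((b i).y1 : WithTop ℝ) := not_lt.mpr (hlt.le.trans h1)
        simp only [h1, h2, not_lt.mpr h1, and_false, if_true, if_false, List.length_cons]
        omega
      · by_cases h2 : m < ((b i).y1 : WithTop ℝ)
        · simp only [h1, h2, not_le.mpr h2, false_and, if_true, if_false, List.length_cons]
          omega
        · simp only [h1, h2, not_le.mp h1, not_lt.mp h2, and_self, if_true, if_false,
            List.length_cons]
          omega
  exact key _ L

theorem IntervalTree.boxes_build (L : List (Fin n)) :
    (IntervalTree.build b L).boxes = L.length := by
  induction L using IntervalTree.build.induct b with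
  | case1 => rw [IntervalTree.build]; simp [IntervalTree.boxes]
  | case2 L hL ih₁ ih₂ =>
    have := length_yMiddle_add b L
    rw [IntervalTree.build, dif_neg hL, IntervalTree.boxes, lowerTree, RangeTree.leaves_ofList,
      List.length_insertionSort]
    omega

/-- Each node charges the boxes assigned to its two children to the endpoints in its own interval,
at most twice per endpoint. The children share these endpoints between them, so the charge is `2 *
endpointsIn` per level. The boxes assigned to the node itself are kept as a separate term, to be
charged by the parent. -/
theorem SegmentTree.boxes_build_le (h : ℕ) (keys : List ℝ) (J I : Set ℝ) (hI : Cuts keys I)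
    (hh : (SegmentTree.build b keys J I).depth ≤ h) :
    (SegmentTree.build b keys J I).boxes ≤
      (assigned b J I).length + 2 * h * endpointsIn b I := by
  induction keys, J, I using SegmentTree.build.induct generalizing h with
  | case1 J I =>
    rw [SegmentTree.build, dif_pos rfl, SegmentTree.boxes]
    exact (IntervalTree.boxes_build b _).le.trans (Nat.le_add_right _ _)
  | case2 keys J I hk hlt ih₁ ih₂ =>
    rw [SegmentTree.build, dif_neg hk, SegmentTree.depth] at hh
    rw [SegmentTree.build, dif_neg hk, SegmentTree.boxes]
    obtain ⟨h, rfl⟩ : ∃ k, h = k + 1 := ⟨h - 1, by omega⟩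
    have h1 := ih₁ h (hI.left hk hlt) (by omega)
    have h2 := ih₂ h (hI.right hk hlt) (by omega)
    have h3 := length_assigned_le b hI.ordConnected (hI.left hk hlt).nonempty Set.inter_subset_left
    have h4 := length_assigned_le b hI.ordConnected (hI.right hk hlt).nonempty
      Set.inter_subset_left
    have h5 := Nat.mul_le_mul_left (2 * h) (endpointsIn_split b I keys[keys.length / 2])
    have h6 := IntervalTree.boxes_build b (assigned b J I)
    rw [Nat.mul_add] at h5
    have h7 : 2 * (h + 1) * endpointsIn b I = 2 * h * endpointsIn b I + 2 * endpointsIn b I := by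
      ring
    omega

theorem SegmentTree.nodes_build (keys : List ℝ) (J I : Set ℝ) :
    (SegmentTree.build b keys J I).nodes = 2 * keys.length + 1 := by
  induction keys, J, I using SegmentTree.build.induct with
  | case1 J I => rw [SegmentTree.build, dif_pos rfl]; rfl
  | case2 keys J I hk hlt ih₁ ih₂ =>
    rw [SegmentTree.build, dif_neg hk, SegmentTree.nodes, ih₁, ih₂, List.length_take,
      List.length_drop]
    omega

end SegmentTree

end

end Stabbing

namespace Stabbing

/-! ## Jump lengths

From height `h` a search for a leaf jumps down by `jumpLen B K h` levels, a power of `B` below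
`B ^ K` that divides `h`. -/

/-- The largest `B ^ j` with `j ≤ K` that divides `h` and is at most `h / 3`, or `1`. -/
def jumpLen (B K h : ℕ) : ℕ :=
  B ^ Nat.findGreatest (fun j => B ^ j ∣ h ∧ 3 * B ^ j ≤ h) K

theorem jumpLen_cases (B K h : ℕ) :
    jumpLen B K h = 1 ∨ ∃ j, 0 < j ∧ j ≤ K ∧ jumpLen B K h = B ^ j ∧ B ^ j ∣ h ∧ 3 * B ^ j ≤ h := by
  rcases Nat.eq_zero_or_pos (Nat.findGreatest (fun j => B ^ j ∣ h ∧ 3 * B ^ j ≤ h) K) with h0 | h0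
  · left; rw [jumpLen, h0, pow_zero]
  · right
    have := Nat.findGreatest_of_ne_zero (P := fun j => B ^ j ∣ h ∧ 3 * B ^ j ≤ h) rfl h0.ne'
    exact ⟨_, h0, Nat.findGreatest_le _, rfl, this.1, this.2⟩

theorem jumpLen_pos (B K h : ℕ) (hB : 0 < B) : 0 < jumpLen B K h := by
  rw [jumpLen]; positivity

theorem dvd_jumpLen {B K h j : ℕ} (hj : j ≤ K) (hd : B ^ j ∣ h) (h3 : 3 * B ^ j ≤ h) :
    B ^ j ∣ jumpLen B K h :=
  Nat.pow_dvd_pow B (Nat.le_findGreatest hj ⟨hd, h3⟩)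

/-- The number of jumps of given lengths from height `h` down to `0`. -/
def jumpSteps (d : ℕ → ℕ) : ℕ → ℕ
  | 0 => 0
  | h + 1 => 1 + jumpSteps d (h + 1 - max 1 (d (h + 1)))
  termination_by h => h
  decreasing_by omega

theorem jumpSteps_eq (d : ℕ → ℕ) {h : ℕ} (hh : 0 < h) (hd : 0 < d h) :
    jumpSteps d h = 1 + jumpSteps d (h - d h) := by
  obtain ⟨h, rfl⟩ : ∃ k, h = k + 1 := ⟨h - 1, by omega⟩
  rw [jumpSteps, max_eq_right hd]

/-- This is the descent near the bottom. While `h` is a multiple of `B ^ j` above `2 * B ^ j`, every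
jump is a positive multiple of `B ^ j` and preserves divisibility. Once `h ≤ 2 * B ^ j`, it is at
most `2 * B` times the next smaller power, so each smaller power costs at most `2 * B` further
jumps. -/
theorem jumpSteps_le_of_dvd {B K : ℕ} (hB : 0 < B) (j : ℕ) (hj : j ≤ K) (q h : ℕ)
    (hd : B ^ j ∣ h) (hq : h ≤ q * B ^ j) : jumpSteps (jumpLen B K) h ≤ q + 2 * B * j := by
  induction j generalizing q h with
  | zero =>
    rw [pow_zero, mul_one] at hq
    induction q generalizing h with
    | zero =>
      have : h = 0 := by omega
      subst this; simp [jumpSteps]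
    | succ q ihq =>
      rcases Nat.eq_zero_or_pos h with rfl | hh
      · simp [jumpSteps]
      have hp := jumpLen_pos B K h hB
      rw [jumpSteps_eq _ hh hp]
      have := ihq (h - jumpLen B K h) (by simp) (by omega)
      omega
  | succ j ihj =>
    have hpos : 0 < B ^ (j + 1) := by positivity
    have low : ∀ h, B ^ (j + 1) ∣ h → h ≤ 2 * B ^ (j + 1) →
        jumpSteps (jumpLen B K) h ≤ 2 * B * (j + 1) := by
      intro h hd hle
      have := ihj (by omega) (2 * B) h ((Nat.pow_dvd_pow B (by omega)).trans hd)
        (by rw [pow_succ] at hle; calc h ≤ _ := hle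
              _ = _ := by ring)
      calc _ ≤ _ := this
        _ = _ := by ring
    induction q generalizing h with
    | zero =>
      have : h = 0 := by omega
      subst this; simp [jumpSteps]
    | succ q ihq =>
      by_cases h2 : h ≤ 2 * B ^ (j + 1)
      · exact (low h hd h2).trans (by omega)
      · obtain ⟨a, rfl⟩ := hd
        have ha : 3 ≤ a := by
          by_contra hc
          have := Nat.mul_le_mul_left (B ^ (j + 1)) (show a ≤ 2 by omega)
          omega
        have h3 : 3 * B ^ (j + 1) ≤ B ^ (j + 1) * a := by
          rw [mul_comm]; exact Nat.mul_le_mul_left _ ha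
        have hdv := dvd_jumpLen hj (Dvd.intro _ rfl) h3
        have hp := jumpLen_pos B K (B ^ (j + 1) * a) hB
        have hge := Nat.le_of_dvd hp hdv
        rw [jumpSteps_eq _ (by omega) hp]
        have := ihq (B ^ (j + 1) * a - jumpLen B K (B ^ (j + 1) * a))
          (Nat.dvd_sub (Dvd.intro _ rfl) hdv) (by rw [Nat.add_mul] at hq; omega)
        omega

/-- In base `B` the digits of `h` below the `j`-th vanish and the `j`-th is `r`. As long as `r` is
not zero the jump is exactly `B ^ j` and lowers the digit by one; when it is zero, the next digit
takes over. So at most `B` jumps are spent per digit until `B ^ K` divides `h`. If `h` drops below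
`3 * B ^ j` before that, `jumpSteps_le_of_dvd` finishes with quotient `3`. -/
theorem jumpSteps_le {B K : ℕ} (hB : 2 ≤ B) (k j : ℕ) (hk : j + k = K) (r a h : ℕ) (hr : r < B)
    (hh : h = a * B ^ (j + 1) + r * B ^ j) (hle : h ≤ B ^ (K + 1)) :
    jumpSteps (jumpLen B K) h ≤ r + k * B + (B + 2 * B * K + 3) := by
  induction k generalizing j r a h with
  | zero =>
    have : j = K := by omega
    subst this
    have := jumpSteps_le_of_dvd (K := j) (by omega : 0 < B) j le_rfl B h
      (by rw [hh, pow_succ']; exact ⟨a * B + r, by ring⟩) (by rw [← pow_succ']; exact hle)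
    omega
  | succ k ih =>
    have hpos : 0 < B ^ j := by positivity
    have hdvd : B ^ j ∣ h := by rw [hh, pow_succ']; exact ⟨a * B + r, by ring⟩
    induction r generalizing h with
    | zero =>
      have h1 := ih (j + 1) (by omega) (a % B) (a / B) h (Nat.mod_lt _ (by omega))
        (by
          rw [hh, zero_mul, add_zero, pow_succ' B (j + 1)]
          conv_lhs => rw [← Nat.div_add_mod a B]
          ring) hle
      have := Nat.mod_lt a (show 0 < B by omega)
      rw [Nat.add_mul]
      omega
    | succ r ihr =>
      by_cases h3 : 3 * B ^ j ≤ h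
      · have hnd : ¬ B ^ (j + 1) ∣ h := by
          intro hdv
          rw [hh, Nat.dvd_add_right (Dvd.intro_left _ rfl), pow_succ'] at hdv
          have := Nat.le_of_dvd (by omega) (Nat.dvd_of_mul_dvd_mul_right hpos hdv)
          omega
        have hd : jumpLen B K h = B ^ j := by
          rw [jumpLen]
          congr 1
          refine le_antisymm ?_ (Nat.le_findGreatest (by omega) ⟨hdvd, h3⟩)
          by_contra hc
          have h0 := Nat.findGreatest_of_ne_zero
            (P := fun j => B ^ j ∣ h ∧ 3 * B ^ j ≤ h) (n := K) rfl (by omega)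
          exact hnd ((Nat.pow_dvd_pow B (by omega)).trans h0.1)
        rw [jumpSteps_eq _ (by omega) (by omega), hd]
        have := ihr (h - B ^ j) (by omega) (by rw [hh, Nat.add_mul]; omega) (by omega)
          (Nat.dvd_sub hdvd dvd_rfl)
        omega
      · have h1 := jumpSteps_le_of_dvd (K := K) (by omega : 0 < B) j (by omega) 3 h hdvd (by omega)
        have h2 := Nat.mul_le_mul_left (2 * B) (show j ≤ K by omega)
        omega

/-- A jump of length `B ^ j` starts only at a multiple of `B ^ j`. Up to `H` there are at most `H /
B ^ j` of these, so each power contributes at most `H` in total, and there are `K` powers besides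
`1`. -/
theorem sum_jumpLen_le (B K H : ℕ) :
    ∑ h ∈ Finset.range (H + 1), jumpLen B K h ≤ (K + 1) * (H + 1) := by
  have hle : ∀ h ∈ Finset.range (H + 1), jumpLen B K h ≤
      1 + ∑ j ∈ Finset.range K, if h ≠ 0 ∧ B ^ (j + 1) ∣ h then B ^ (j + 1) else 0 := by
    intro h _
    rcases jumpLen_cases B K h with h1 | ⟨j, hj, hjK, h1, h2, h3⟩
    · omega
    · rcases Nat.eq_zero_or_pos h with rfl | hh
      · omega
      have := Finset.single_le_sum
        (f := fun j => if h ≠ 0 ∧ B ^ (j + 1) ∣ h then B ^ (j + 1) else 0) (fun _ _ => Nat.zero_le _)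
        (Finset.mem_range.mpr (show j - 1 < K by omega))
      have h4 : (if h ≠ 0 ∧ B ^ (j - 1 + 1) ∣ h then B ^ (j - 1 + 1) else 0) = B ^ j := by
        rw [show j - 1 + 1 = j by omega, if_pos ⟨hh.ne', h2⟩]
      rw [h1, ← h4]
      exact this.trans (Nat.le_add_left _ _)
  refine (Finset.sum_le_sum hle).trans ?_
  rw [Finset.sum_add_distrib, Finset.sum_comm]
  have : ∀ j ∈ Finset.range K, (∑ h ∈ Finset.range (H + 1),
      if h ≠ 0 ∧ B ^ (j + 1) ∣ h then B ^ (j + 1) else 0) ≤ H := by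
    intro j _
    rw [← Finset.sum_filter, Finset.sum_const, smul_eq_mul]
    have := Nat.card_multiples' H (B ^ (j + 1))
    rw [Nat.succ_eq_add_one] at this
    rw [this]
    exact Nat.div_mul_le_self _ _
  have h1 := Finset.sum_le_card_nsmul _ _ _ this
  simp only [Finset.sum_const, Finset.card_range, smul_eq_mul, mul_one] at h1 ⊢
  nlinarith

/-- Jump lengths for heights up to `Λ` that are short on average and that lead from any height to
`0` in `O(Λ ^ ε)` jumps. -/
structure JumpSchedule (ε : ℝ) (c Λ : ℕ) (d : ℕ → ℕ) : Prop where
  cases : ∀ h, d h = 1 ∨ (2 ≤ d h ∧ 3 * d h ≤ h)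
  sum_le : ∀ H ≤ Λ, ∑ h ∈ Finset.range (H + 1), d h ≤ c * Λ
  sum_inv_le : ∀ H ≤ Λ,
    ∑ h ∈ Finset.range (H + 1), (if d h = 1 then 0 else ((2 : ℝ) ^ d h)⁻¹) ≤ c
  steps_le : ∀ h ≤ Λ, (jumpSteps d h : ℝ) ≤ c * (Λ : ℝ) ^ ε

theorem exists_jumpSchedule (ε : ℝ) (hε : 0 < ε) :
    ∃ c : ℕ, ∀ Λ : ℕ, 1 ≤ Λ → ∃ d, JumpSchedule ε c Λ d := by
  set K := ⌈1 / ε⌉₊ with hK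
  -- Exponentials beat polynomials: `c₀` bounds `B ^ (K + 1) / 2 ^ B` over all `B`. Every jump
  -- longer than `1` has length at least `B`, and there are at most about `B ^ (K + 1)` heights, so
  -- this bounds the sum of the inverses.
  obtain ⟨c₀, hc₀⟩ := (tendsto_pow_const_div_const_pow_of_one_lt (K + 1)
    (by norm_num : (1 : ℝ) < 2)).bddAbove_range
  have hc₀' : ∀ B : ℕ, (B : ℝ) ^ (K + 1) ≤ c₀ * 2 ^ B := fun B => by
    have := hc₀ (Set.mem_range_self B)
    rwa [div_le_iff₀ (by positivity)] at this
  -- The three constants serve `sum_le`, `sum_inv_le` and `steps_le`, in this order.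
  refine ⟨max (2 * (K + 1)) (max (⌈2 * c₀⌉₊) (4 * (3 + 3 * K) + 3)), fun Λ hΛ => ?_⟩
  set c := max (2 * (K + 1)) (max (⌈2 * c₀⌉₊) (4 * (3 + 3 * K) + 3)) with hc
  have hcl1 : 2 * (K + 1) ≤ c := le_max_left _ _
  have hcl2 : ⌈2 * c₀⌉₊ ≤ c := (le_max_left _ _).trans (le_max_right _ _)
  have hcl3 : 4 * (3 + 3 * K) + 3 ≤ c := (le_max_right _ _).trans (le_max_right _ _)
  have hΛ' : (1 : ℝ) ≤ Λ := by exact_mod_cast hΛ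
  set x : ℝ := (Λ : ℝ) ^ ((1 : ℝ) / (K + 1 : ℕ)) with hx
  have hx1 : 1 ≤ x := Real.one_le_rpow hΛ' (by positivity)
  -- Adding `2` ensures `B ≥ 2` also for small `Λ`; since `x ≥ 1`, still `B ≤ 4 * x`.
  set B := ⌈x⌉₊ + 2 with hB
  have hB2 : 2 ≤ B := by omega
  have hxB : x ≤ B := by
    rw [hB]; push_cast
    linarith [Nat.le_ceil x]
  have hBx : (B : ℝ) ≤ 4 * x := by
    rw [hB]; push_cast
    linarith [Nat.ceil_lt_add_one (show 0 ≤ x by linarith)]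
  have hxε : x ≤ (Λ : ℝ) ^ ε := by
    refine Real.rpow_le_rpow_of_exponent_le hΛ' ?_
    rw [div_le_iff₀ (by positivity)]
    have h1 : 1 / ε ≤ K := Nat.le_ceil _
    rw [div_le_iff₀ hε] at h1
    push_cast
    nlinarith
  have hxK : x ^ (K + 1) = Λ := by
    rw [hx, ← Real.rpow_natCast, ← Real.rpow_mul (by positivity), one_div,
      inv_mul_cancel₀ (by positivity), Real.rpow_one]
  have hΛB : Λ ≤ B ^ (K + 1) := by
    have : (Λ : ℝ) ≤ (B : ℝ) ^ (K + 1) := by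
      rw [← hxK]; exact pow_le_pow_left₀ (by linarith) hxB _
    exact_mod_cast this
  refine ⟨jumpLen B K, ⟨fun h => ?_, fun H hH => ?_, fun H hH => ?_, fun h hh => ?_⟩⟩
  · rcases jumpLen_cases B K h with h1 | ⟨j, hj, -, h1, -, h3⟩
    · exact Or.inl h1
    · refine Or.inr ⟨?_, by rwa [h1]⟩
      rw [h1]
      exact hB2.trans (Nat.le_self_pow hj.ne' _)
  · refine (sum_jumpLen_le B K H).trans ?_
    calc (K + 1) * (H + 1) ≤ (K + 1) * (2 * Λ) := Nat.mul_le_mul_left _ (by omega)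
      _ = 2 * (K + 1) * Λ := by ring
      _ ≤ c * Λ := Nat.mul_le_mul_right _ hcl1
  · have hle : ∀ h ∈ Finset.range (H + 1),
        (if jumpLen B K h = 1 then 0 else ((2 : ℝ) ^ jumpLen B K h)⁻¹) ≤ ((2 : ℝ) ^ B)⁻¹ := by
      intro h _
      split_ifs with h0
      · positivity
      · rcases jumpLen_cases B K h with h1 | ⟨j, hj, -, h1, -, -⟩
        · exact absurd h1 h0
        · rw [h1]
          gcongr
          · norm_num
          · exact Nat.le_self_pow hj.ne' _
    have h1 := Finset.sum_le_card_nsmul _ _ _ hle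
    refine h1.trans ?_
    rw [Finset.card_range, nsmul_eq_mul, ← div_eq_mul_inv, div_le_iff₀ (by positivity)]
    have h2 : ((H + 1 : ℕ) : ℝ) ≤ 2 * (B : ℝ) ^ (K + 1) := by
      have : H + 1 ≤ 2 * B ^ (K + 1) := by omega
      exact_mod_cast this
    have h3 : (2 * c₀ : ℝ) ≤ c := (Nat.le_ceil _).trans (by exact_mod_cast hcl2)
    calc ((H + 1 : ℕ) : ℝ) ≤ 2 * (c₀ * 2 ^ B) := h2.trans (by linarith [hc₀' B])
      _ = (2 * c₀) * 2 ^ B := by ring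
      _ ≤ c * 2 ^ B := by gcongr
  · have h1 := jumpSteps_le hB2 K 0 (by omega) (h % B) (h / B) h (Nat.mod_lt _ (by omega))
      (by rw [zero_add, pow_one, pow_zero, mul_one, mul_comm, Nat.div_add_mod]) (hh.trans hΛB)
    have h2 := Nat.mod_lt h (show 0 < B by omega)
    have h3 : jumpSteps (jumpLen B K) h ≤ (3 + 3 * K) * B + 3 := by nlinarith
    have h4 : (jumpSteps (jumpLen B K) h : ℝ) ≤ (3 + 3 * K) * B + 3 := by exact_mod_cast h3
    have h5 : ((4 * (3 + 3 * K) + 3 : ℕ) : ℝ) ≤ c := by exact_mod_cast hcl3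
    push_cast at h5
    calc (jumpSteps (jumpLen B K) h : ℝ) ≤ (3 + 3 * K) * B + 3 := h4
      _ ≤ (3 + 3 * K) * (4 * x) + 3 * x := by
        have : (3 + 3 * K : ℝ) * B ≤ (3 + 3 * K) * (4 * x) :=
          mul_le_mul_of_nonneg_left hBx (by positivity)
        linarith
      _ = (4 * (3 + 3 * K) + 3) * x := by ring
      _ ≤ c * (Λ : ℝ) ^ ε := mul_le_mul h5 hxε (by linarith) (by positivity)

end Stabbing

namespace Stabbing

noncomputable section

/-! ## Range trees with addresses -/

/-- Range trees whose nodes carry the addresses of their records. -/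
inductive LTree (n : ℕ) where
  | leaf (a : ℕ) (i : Fin n) : LTree n
  | node (a : ℕ) (l r : LTree n) : LTree n

namespace LTree

variable {n : ℕ}

/-- The address of the root. -/
def addr : LTree n → ℕ
  | .leaf a _ => a
  | .node a _ _ => a

/-- The tree without the addresses. -/
def erase : LTree n → RangeTree n
  | .leaf _ i => .leaf i
  | .node _ l r => .node l.erase r.erase

/-- The first leaf. -/
def first : LTree n → Fin n
  | .leaf _ i => i
  | .node _ l _ => l.first

theorem firstKey_erase (key : Fin n → WithTop ℝ) (T : LTree n) :
    T.erase.firstKey key = key T.first := by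
  induction T with
  | leaf a i => rfl
  | node a l r ih _ => exact ih

/-- The descendants `d` levels below the root. -/
def desc : ℕ → LTree n → List (LTree n)
  | 0, T => [T]
  | _ + 1, .leaf _ _ => []
  | d + 1, .node _ l r => l.desc d ++ r.desc d

/-- All addresses are below `N`. -/
def Below (N : ℕ) : LTree n → Prop
  | .leaf a _ => a < N
  | .node a l r => a < N ∧ l.Below N ∧ r.Below N

theorem Below.addr_lt {N : ℕ} {T : LTree n} (h : T.Below N) : T.addr < N := by
  cases T with
  | leaf a i => exact h
  | node a l r => exact h.1

theorem Below.of_mem_desc {N d : ℕ} {T u : LTree n} (h : T.Below N) (hu : u ∈ T.desc d) :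
    u.Below N := by
  induction d generalizing T with
  | zero => simp only [desc, List.mem_singleton] at hu; rwa [hu]
  | succ d ih =>
    cases T with
    | leaf a i => simp [desc] at hu
    | node a l r =>
      rcases List.mem_append.mp hu with hu | hu
      · exact ih h.2.1 hu
      · exact ih h.2.2 hu

/-- In a balanced tree a leaf occurs only at height index `0`, so the first `h` levels are complete.
Hence `d` bits suffice to name a descendant `d` levels down. -/
theorem length_desc {h d : ℕ} {T : LTree n} (hT : T.erase.Bal h) (hd : d ≤ h) :
    (T.desc d).length = 2 ^ d := by
  induction d generalizing T h with
  | zero => rfl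
  | succ d ih =>
    cases T with
    | leaf a i => have : h = 0 := hT; omega
    | node a l r =>
      rw [desc, List.length_append, ih hT.2.2.1 (by omega), ih hT.2.2.2 (by omega), pow_succ]
      omega

theorem leaves_desc {h d : ℕ} {T : LTree n} (hT : T.erase.Bal h) (hd : d ≤ h) :
    (T.desc d).flatMap (fun u => u.erase.leaves) = T.erase.leaves := by
  induction d generalizing T h with
  | zero => simp [desc]
  | succ d ih =>
    cases T with
    | leaf a i => have : h = 0 := hT; omega
    | node a l r =>
      rw [desc, List.flatMap_append, ih hT.2.2.1 (by omega), ih hT.2.2.2 (by omega)]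
      rfl

theorem leaves_subset_of_mem_desc {d : ℕ} {T u : LTree n} (hu : u ∈ T.desc d) :
    u.erase.leaves ⊆ T.erase.leaves := by
  induction d generalizing T with
  | zero => simp only [desc, List.mem_singleton] at hu; rw [hu]; exact List.Subset.refl _
  | succ d ih =>
    cases T with
    | leaf a i => simp [desc] at hu
    | node a l r =>
      rcases List.mem_append.mp hu with hu | hu
      · exact List.Subset.trans (ih hu) (List.subset_append_left _ _)
      · exact List.Subset.trans (ih hu) (List.subset_append_right _ _)

theorem filter_leaves_of_mem_desc {d : ℕ} {T u : LTree n} (hT : T.erase.leaves.Nodup)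
    (hu : u ∈ T.desc d) : T.erase.leaves.filter (· ∈ u.erase.leaves) = u.erase.leaves := by
  induction d generalizing T with
  | zero =>
    simp only [desc, List.mem_singleton] at hu
    rw [hu, List.filter_eq_self.mpr (by simp)]
  | succ d ih =>
    cases T with
    | leaf a i => simp [desc] at hu
    | node a l r =>
      rw [erase, RangeTree.leaves, List.nodup_append] at hT
      rw [erase, RangeTree.leaves, List.filter_append]
      rcases List.mem_append.mp hu with hu | hu
      · rw [ih hT.1 hu, List.filter_eq_nil_iff.mpr, List.append_nil]
        intro i hi
        simpa using fun h => hT.2.2 i (leaves_subset_of_mem_desc hu h) i hi rfl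
      · rw [ih hT.2.1 hu, List.filter_eq_nil_iff.mpr, List.nil_append]
        intro i hi
        simpa using fun h => hT.2.2 i hi i (leaves_subset_of_mem_desc hu h) rfl

end LTree

/-! ## Tables in memory -/

theorem Holds.table {M : List ℕ} {p N : ℕ} {g : ℕ → ℕ}
    (h : Holds M p ((List.range N).map g)) {i : ℕ} (hi : i < N) : M[p + i]? = some (g i) :=
  h i (g i) (by simp [hi])

section Tables

variable {n : ℕ} (b : Fin n → CanonicalBox)

/-- The packed bit vector of a node over `M`. -/
def BitsAt (w : ℕ) (M : List ℕ) (v r : RangeTree n) (p : ℕ) : Prop :=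
  ∀ (j : ℕ) (i : Fin n), (v.bottomList b)[j]? = some i →
    ∃ x, M[p + j / w]? = some x ∧ (x.testBit (j % w) = true ↔ i ∈ r.leaves)

/-- The rank directory of a node: for every chunk of `s` entries of the bottom list, the number
of earlier entries in the right child, and the bits of the chunk. -/
def RankAt (s : ℕ) (M : List ℕ) (v r : RangeTree n) (p : ℕ) : Prop :=
  ∀ j ≤ v.leaves.length, ∃ c x, M[p + 2 * (j / s)]? = some c ∧
    M[p + (2 * (j / s) + 1)]? = some x ∧ c + popCount s (x % 2 ^ (j % s)) = v.rank b r j ∧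
    ∀ i, (v.bottomList b)[j]? = some i → (x / 2 ^ (j % s) % 2 = 1 ↔ i ∈ r.leaves)

open scoped Classical in
/-- The bit of the `j`-th entry of the bottom list. -/
def bitOf (v r : RangeTree n) (j : ℕ) : ℕ :=
  if ∃ i ∈ r.leaves, (v.bottomList b)[j]? = some i then 1 else 0

theorem bitOf_lt (v r : RangeTree n) (j : ℕ) : bitOf b v r j < 2 ^ 1 := by
  rw [bitOf]; split_ifs <;> norm_num

theorem bitOf_eq_one {v r : RangeTree n} {j : ℕ} {i : Fin n}
    (h : (v.bottomList b)[j]? = some i) : bitOf b v r j = 1 ↔ i ∈ r.leaves := by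
  rw [bitOf]
  constructor
  · intro h1
    split_ifs at h1 with h2
    · obtain ⟨i', hi', h'⟩ := h2
      rw [h, Option.some.injEq] at h'
      rwa [h']
  · intro h1
    rw [if_pos ⟨i, h1, h⟩]

theorem exists_bits (w : ℕ) (hw : 0 < w) (v r : RangeTree n) :
    ∃ xs : List ℕ, xs.length = v.leaves.length / w + 1 ∧ (∀ x ∈ xs, x < 2 ^ w) ∧
      ∀ M p, Holds M p xs → BitsAt b w M v r p := by
  choose g hg hg' using fun q =>
    exists_packed 1 (fun e => bitOf b v r (q * w + e)) (fun e => bitOf_lt b v r _) w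
  refine ⟨(List.range (v.leaves.length / w + 1)).map g, by simp, ?_, ?_⟩
  · intro x hx
    obtain ⟨q, -, rfl⟩ := List.mem_map.mp hx
    simpa using hg q
  · intro M p hM j i hj
    have hlt := (List.getElem?_eq_some_iff.mp hj).1
    rw [RangeTree.length_bottomList] at hlt
    refine ⟨_, hM.table (Nat.lt_succ_of_le (Nat.div_le_div_right hlt.le)), ?_⟩
    rw [Nat.testBit_eq_decide_div_mod_eq, decide_eq_true_eq, ← bitOf_eq_one b hj]
    have := hg' (j / w) (j % w) (Nat.mod_lt _ hw)
    simp only [one_mul, pow_one, Nat.div_add_mod'] at this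
    rw [this]

theorem rank_eq_countP (v r : RangeTree n) (j : ℕ) :
    v.rank b r j = (List.range j).countP fun e => bitOf b v r e = 1 := by
  induction j with
  | zero => simp [RangeTree.rank]
  | succ j ih =>
    rw [List.range_succ, List.countP_append, ← ih, RangeTree.rank, RangeTree.rank]
    cases h : (v.bottomList b)[j]? with
    | none =>
      have hl := List.getElem?_eq_none_iff.mp h
      rw [List.take_of_length_le hl, List.take_of_length_le (hl.trans (Nat.le_succ j))]
      simp [bitOf, h]
    | some i =>
      rw [countP_take_succ _ _ _ _ h]
      have := bitOf_eq_one b (r := r) h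
      by_cases hi : i ∈ r.leaves <;> simp [hi, this]

theorem rank_add (v r : RangeTree n) (j k : ℕ) :
    v.rank b r (j + k) =
      v.rank b r j + (List.range k).countP fun e => bitOf b v r (j + e) = 1 := by
  rw [rank_eq_countP, rank_eq_countP, List.range_add, List.countP_append, List.countP_map]
  rfl

theorem exists_ranks (s w : ℕ) (hs : 0 < s) (hsw : s ≤ w) (v r : RangeTree n)
    (hv : v.leaves.length < 2 ^ w) :
    ∃ xs : List ℕ, xs.length = 2 * (v.leaves.length / s + 1) ∧ (∀ x ∈ xs, x < 2 ^ w) ∧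
      ∀ M p, Holds M p xs → RankAt b s M v r p := by
  choose g hg hg' using fun q =>
    exists_packed 1 (fun e => bitOf b v r (q * s + e)) (fun e => bitOf_lt b v r _) s
  -- The directory interleaves two tables: even entries hold the rank at the start of a chunk, odd
  -- entries the bits of the chunk. There is one chunk for each quotient up to `length / s`, since
  -- ranks are also asked at the very end of the list.
  set G : ℕ → ℕ := fun t => if t % 2 = 0 then v.rank b r (t / 2 * s) else g (t / 2) with hG
  refine ⟨(List.range (2 * (v.leaves.length / s + 1))).map G, by simp, ?_, ?_⟩
  · intro x hx
    obtain ⟨q, -, rfl⟩ := List.mem_map.mp hx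
    simp only [hG]
    split_ifs
    · refine lt_of_le_of_lt (List.countP_le_length.trans ?_) hv
      rw [List.length_take, RangeTree.length_bottomList]
      exact min_le_right _ _
    · have := hg (q / 2)
      rw [one_mul] at this
      exact this.trans_le (Nat.pow_le_pow_right (by norm_num) hsw)
  · intro M p hM j hj
    have hlt := Nat.div_le_div_right (c := s) hj
    have hmod := Nat.mod_lt j hs
    have hg'' : ∀ e < s, g (j / s) / 2 ^ e % 2 = bitOf b v r (j / s * s + e) := fun e he => by
      simpa using hg' (j / s) e he
    refine ⟨v.rank b r (j / s * s), g (j / s), ?_, ?_, ?_, ?_⟩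
    · rw [hM.table (by omega)]
      simp [hG]
    · rw [hM.table (by omega)]
      simp only [hG]
      rw [if_neg (by omega), show (2 * (j / s) + 1) / 2 = j / s by omega]
    · rw [popCount_mod _ _ _ hmod.le]
      conv_rhs => rw [← Nat.div_add_mod' j s, rank_add]
      congr 1
      refine List.countP_congr fun e he => ?_
      rw [List.mem_range] at he
      rw [hg'' e (he.trans hmod)]
    · intro i hi
      rw [hg'' _ hmod, Nat.div_add_mod', bitOf_eq_one b hi]

/-- The jump tables of a node for jumps of `d` levels. The field of an entry of the bottom list
tells the descendant that it belongs to and its position there relative to the start of its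
block of `2 ^ (2 * d)` entries; `f` fields are packed into a word. -/
def JumpAt (d f : ℕ) (M : List ℕ) (T : LTree n) (child base fields : ℕ) : Prop :=
  ∀ (j : ℕ) (i : Fin n), (T.erase.bottomList b)[j]? = some i → ∃ c off x y, ∃ u ∈ T.desc d,
    i ∈ u.erase.leaves ∧ M[child + c]? = some u.addr ∧
    M[fields + j / f]? = some x ∧ x / 2 ^ (3 * d * (j % f)) % 2 ^ (3 * d) = c * 2 ^ (2 * d) + off ∧
    off < 2 ^ (2 * d) ∧
    M[base + (j / 2 ^ (2 * d) * 2 ^ d + c)]? = some y ∧ y + off = T.erase.rank b u.erase j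

/-- A rank grows by at most one per entry, so inside a block of `2 ^ (2 * d)` entries the difference
to the base value fits into `2 * d` bits. -/
theorem rank_le_rank_add (v u : RangeTree n) (j k : ℕ) :
    v.rank b u j ≤ v.rank b u (j + k) ∧ v.rank b u (j + k) ≤ v.rank b u j + k := by
  rw [rank_add]
  have : ((List.range k).countP fun e => bitOf b v u (j + e) = 1) ≤ k :=
    List.countP_le_length.trans (by simp)
  omega

/-- Storing the full target position of every entry would take too many bits. The base table keeps
full ranks only at block starts, one for each of the `2 ^ d` descendants, and the packed fields keep
the descendant number and the small remainder. The hypothesis `3 * d ≤ s` guarantees that at least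
one field fits into `s` bits. -/
theorem exists_jumps (d s w h : ℕ) (T : LTree n) (hT : T.erase.Bal h) (hd : 0 < d) (hdh : d ≤ h)
    (hds : 3 * d ≤ s) (hsw : s ≤ w) (hv : T.erase.leaves.length < 2 ^ w) (hb : T.Below (2 ^ w)) :
    ∃ ct bt ft : List ℕ, ct.length = 2 ^ d ∧
      bt.length = (T.erase.leaves.length / 2 ^ (2 * d) + 1) * 2 ^ d ∧
      ft.length = T.erase.leaves.length / (s / (3 * d)) + 1 ∧
      (∀ x ∈ ct, x < 2 ^ w) ∧ (∀ x ∈ bt, x < 2 ^ w) ∧ (∀ x ∈ ft, x < 2 ^ w) ∧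
      ∀ M p₁ p₂ p₃, Holds M p₁ ct → Holds M p₂ bt → Holds M p₃ ft →
        JumpAt b d (s / (3 * d)) M T p₁ p₂ p₃ := by
  classical
  set len := T.erase.leaves.length with hlen
  set f := s / (3 * d) with hf
  have hf0 : 0 < f := Nat.div_pos hds (by omega)
  have hD : (T.desc d).length = 2 ^ d := T.length_desc hT hdh
  have hDpos : 0 < 2 ^ d := by positivity
  -- Positions beyond the end of the bottom list get the field `0`; they only fill up the last word.
  have hpick : ∀ j : ℕ, ∃ c off, c < 2 ^ d ∧ off < 2 ^ (2 * d) ∧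
      ∀ i, (T.erase.bottomList b)[j]? = some i → ∃ u, (T.desc d)[c]? = some u ∧
        i ∈ u.erase.leaves ∧
        T.erase.rank b u.erase (j / 2 ^ (2 * d) * 2 ^ (2 * d)) + off =
          T.erase.rank b u.erase j := by
    intro j
    cases hj : (T.erase.bottomList b)[j]? with
    | none => exact ⟨0, 0, hDpos, by positivity, by simp⟩
    | some i =>
      have hi : i ∈ T.erase.leaves := (RangeTree.mem_bottomList b).mp (List.mem_of_getElem? hj)
      rw [← LTree.leaves_desc hT hdh, List.mem_flatMap] at hi
      obtain ⟨u, hu, hiu⟩ := hi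
      obtain ⟨c, hc⟩ := List.mem_iff_getElem?.mp hu
      have h1 := rank_le_rank_add b T.erase u.erase (j / 2 ^ (2 * d) * 2 ^ (2 * d))
        (j % 2 ^ (2 * d))
      rw [Nat.div_add_mod'] at h1
      have h2 := Nat.mod_lt j (show 0 < 2 ^ (2 * d) by positivity)
      refine ⟨c, T.erase.rank b u.erase j -
        T.erase.rank b u.erase (j / 2 ^ (2 * d) * 2 ^ (2 * d)), ?_, by omega, ?_⟩
      · rw [← hD]; exact (List.getElem?_eq_some_iff.mp hc).1
      · intro i' hi'
        rw [Option.some.injEq] at hi'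
        subst hi'
        exact ⟨u, hc, hiu, by omega⟩
  choose C O hC hO hCO using hpick
  have hfield : ∀ j, C j * 2 ^ (2 * d) + O j < 2 ^ (3 * d) := fun j => by
    have h1 := hC j
    have h2 := hO j
    calc C j * 2 ^ (2 * d) + O j < (C j + 1) * 2 ^ (2 * d) := by rw [Nat.add_mul]; omega
      _ ≤ 2 ^ d * 2 ^ (2 * d) := Nat.mul_le_mul_right _ h1
      _ = 2 ^ (3 * d) := by rw [← pow_add]; congr 1; omega
  choose g hg hg' using fun q =>
    exists_packed (3 * d) (fun e => C (q * f + e) * 2 ^ (2 * d) + O (q * f + e))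
      (fun e => hfield _) f
  -- Entry `t` of the base table belongs to block `t / 2 ^ d` and descendant `t % 2 ^ d`. The
  -- default `0` never matters, because there are exactly `2 ^ d` descendants.
  refine ⟨(T.desc d).map LTree.addr,
    (List.range ((len / 2 ^ (2 * d) + 1) * 2 ^ d)).map fun t =>
      ((T.desc d)[t % 2 ^ d]?.map fun u =>
        T.erase.rank b u.erase (t / 2 ^ d * 2 ^ (2 * d))).getD 0,
    (List.range (len / f + 1)).map g, by simp [hD], by simp, by simp, ?_, ?_, ?_, ?_⟩
  · intro x hx
    obtain ⟨u, hu, rfl⟩ := List.mem_map.mp hx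
    exact (hb.of_mem_desc hu).addr_lt
  · intro x hx
    obtain ⟨t, -, rfl⟩ := List.mem_map.mp hx
    cases (T.desc d)[t % 2 ^ d]? with
    | none => simp
    | some u =>
      refine lt_of_le_of_lt (List.countP_le_length.trans ?_) hv
      rw [List.length_take, RangeTree.length_bottomList]
      exact min_le_right _ _
  · intro x hx
    obtain ⟨q, -, rfl⟩ := List.mem_map.mp hx
    refine (hg q).trans_le (Nat.pow_le_pow_right (by norm_num) ?_)
    exact (Nat.mul_div_le s (3 * d)).trans hsw
  · intro M p₁ p₂ p₃ h₁ h₂ h₃ j i hj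
    obtain ⟨u, hu, hiu, hr⟩ := hCO j i hj
    have hlt := (List.getElem?_eq_some_iff.mp hj).1
    rw [RangeTree.length_bottomList, ← hlen] at hlt
    have hq := Nat.div_le_div_right (c := 2 ^ (2 * d)) hlt.le
    have hidx : j / 2 ^ (2 * d) * 2 ^ d + C j < (len / 2 ^ (2 * d) + 1) * 2 ^ d := by
      have := Nat.mul_le_mul_right (2 ^ d) hq
      have := hC j
      rw [Nat.add_mul]
      omega
    refine ⟨C j, O j, g (j / f), _, u, List.mem_of_getElem? hu, hiu, ?_, ?_, ?_, hO j,
      h₂.table hidx, ?_⟩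
    · exact h₁ _ _ (by simp [hu])
    · exact h₃.table (Nat.lt_succ_of_le (Nat.div_le_div_right hlt.le))
    · have := hg' (j / f) (j % f) (Nat.mod_lt _ hf0)
      rwa [Nat.div_add_mod'] at this
    · rw [Nat.add_comm (_ * _), Nat.add_mul_mod_self_right, Nat.mod_eq_of_lt (hC j), hu,
        Nat.add_mul_div_right _ _ hDpos, Nat.div_eq_of_lt (hC j), Nat.zero_add]
      exact hr

end Tables

end

end Stabbing

namespace Stabbing

noncomputable section

/-! ## The layout of the structure in memory -/

/-- The parameters of the layout: the boxes, the word size, the chunk size and the jump lengths. -/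
structure Layout (n : ℕ) where
  b : Fin n → CanonicalBox
  w : ℕ
  s : ℕ
  d : ℕ → ℕ

/-- The parameters fit together. -/
structure Layout.Valid {n : ℕ} (Λ : Layout n) : Prop where
  s_pos : 0 < Λ.s
  two_pow_le : 2 ^ Λ.s ≤ n
  lt_two_pow : n < 2 ^ (Λ.s + 1)
  small : 5 * n + 15 < 2 ^ Λ.w
  jump : ∀ h, Λ.d h = 1 ∨ (2 ≤ Λ.d h ∧ 3 * Λ.d h ≤ h)

theorem Layout.Valid.s_le {n : ℕ} {Λ : Layout n} (hΛ : Λ.Valid) : Λ.s ≤ Λ.w := by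
  have h1 := hΛ.two_pow_le
  have h2 := hΛ.small
  exact ((Nat.pow_lt_pow_iff_right (by norm_num)).mp (show 2 ^ Λ.s < 2 ^ Λ.w by omega)).le

/-- The coordinate cells: the five coordinates of every box. -/
def coordsOf {n : ℕ} (b : Fin n → CanonicalBox) : List (WithTop ℝ) :=
  (List.finRange n).flatMap fun i => (b i).coordinates

theorem getElem?_flatMap_of_length {α β : Type*} {f : α → List β} {m : ℕ}
    (hf : ∀ a, (f a).length = m) (L : List α) (j k : ℕ) (hk : k < m) (a : α) (ha : L[j]? = some a) :
    (L.flatMap f)[m * j + k]? = (f a)[k]? := by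
  induction L generalizing j with
  | nil => simp at ha
  | cons c L ih =>
    rw [List.flatMap_cons]
    cases j with
    | zero =>
      simp only [List.getElem?_cons_zero, Option.some.injEq] at ha
      subst ha
      rw [mul_zero, zero_add, List.getElem?_append_left (by rw [hf]; exact hk)]
    | succ j =>
      rw [List.getElem?_append_right (by rw [hf, Nat.mul_succ]; omega), hf,
        show m * (j + 1) + k - m = m * j + k by rw [Nat.mul_succ]; omega]
      exact ih j (by simpa using ha)

theorem getElem?_coordsOf {n : ℕ} (b : Fin n → CanonicalBox) (i : Fin n) (k : ℕ) (hk : k < 5) :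
    (coordsOf b)[5 * (i : ℕ) + k]? = (b i).coordinates[k]? :=
  getElem?_flatMap_of_length (f := fun i => (b i).coordinates) (fun _ => rfl) (List.finRange n) i k
    hk i (by simp)

theorem length_coordsOf {n : ℕ} (b : Fin n → CanonicalBox) : (coordsOf b).length = 5 * n := by
  simp [coordsOf, CanonicalBox.coordinates, mul_comm]

theorem exists_getElem?_coordsOf {n : ℕ} (b : Fin n → CanonicalBox) (i : Fin n) (v : WithTop ℝ)
    (hv : v ∈ (b i).coordinates) : ∃ p < 5 * n, (coordsOf b)[p]? = some v := by
  have : v ∈ coordsOf b := List.mem_flatMap.mpr ⟨i, List.mem_finRange i, hv⟩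
  obtain ⟨p, hp⟩ := List.mem_iff_getElem?.mp this
  exact ⟨p, by rw [← length_coordsOf b]; exact (List.getElem?_eq_some_iff.mp hp).1, hp⟩

section Layout

variable {n : ℕ} (Λ : Layout n)

/-- The record of an internal range tree node starts at `a`; `o` selects the coordinate by which
the leaves are sorted and `h` is the height. -/
def LTree.NodeLaid (o : ℕ) (M : List ℕ) (h a : ℕ) (l r : LTree n) : Prop :=
  M[a]? = some 2 ∧ M[a + 1]? = some l.addr ∧ M[a + 2]? = some r.addr ∧
  (∃ p, M[a + 3]? = some p ∧ BitsAt Λ.b Λ.w M (LTree.node a l r).erase r.erase p) ∧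
  M[a + 4]? = some (5 * (r.first : ℕ) + o) ∧
  (∃ p, M[a + 5]? = some p ∧ RankAt Λ.b Λ.s M (LTree.node a l r).erase r.erase p) ∧
  ((Λ.d h = 1 ∧ M[a + 6]? = some 0) ∨
    (2 ≤ Λ.d h ∧ 3 * Λ.d h ≤ h ∧ M[a + 6]? = some (3 * Λ.d h) ∧
      M[a + 7]? = some (Λ.s / (3 * Λ.d h)) ∧ M[a + 8]? = some (2 ^ (2 * Λ.d h)) ∧
      M[a + 9]? = some (2 ^ Λ.d h) ∧ ∃ p₁ p₂ p₃, M[a + 10]? = some p₁ ∧ M[a + 11]? = some p₂ ∧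
      M[a + 12]? = some p₃ ∧
      JumpAt Λ.b (Λ.d h) (Λ.s / (3 * Λ.d h)) M (LTree.node a l r) p₁ p₂ p₃))

/-- The records of a range tree of height `h` with all tables. -/
def LTree.Laid (o : ℕ) (M : List ℕ) : ℕ → LTree n → Prop
  | _, .leaf a i => M[a]? = some 1 ∧ M[a + 1]? = some (i : ℕ)
  | h, .node a l r => LTree.NodeLaid Λ o M h a l r ∧ l.Laid o M (h - 1) ∧ r.Laid o M (h - 1)

theorem LTree.Laid.of_mem_desc {o : ℕ} {M : List ℕ} {h d : ℕ} {T u : LTree n}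
    (hT : T.Laid Λ o M h) (hu : u ∈ T.desc d) : u.Laid Λ o M (h - d) := by
  induction d generalizing T h with
  | zero => simp only [desc, List.mem_singleton] at hu; rwa [hu]
  | succ d ih =>
    cases T with
    | leaf a i => simp [desc] at hu
    | node a l r =>
      rw [show h - (d + 1) = h - 1 - d by omega]
      rcases List.mem_append.mp hu with hu | hu
      · exact ih hT.2.1 hu
      · exact ih hT.2.2 hu

theorem LTree.bal_of_mem_desc {h d : ℕ} {T u : LTree n}
    (hT : T.erase.Bal h) (hu : u ∈ T.desc d) : u.erase.Bal (h - d) := by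
  induction d generalizing T h with
  | zero => simp only [desc, List.mem_singleton] at hu; rwa [hu]
  | succ d ih =>
    cases T with
    | leaf a i => simp [desc] at hu
    | node a l r =>
      rw [show h - (d + 1) = h - 1 - d by omega]
      rcases List.mem_append.mp hu with hu | hu
      · exact ih hT.2.2.1 hu
      · exact ih hT.2.2.2 hu

/-- The range tree `t` is laid out with its root at `p`. -/
def RangeTree.Laid (o : ℕ) (M : List ℕ) (t : RangeTree n) (p : ℕ) : Prop :=
  (t = .nil ∧ M[p]? = some 0) ∨ ∃ h, ∃ T : LTree n, h ≤ Λ.s ∧ T.erase = t ∧ T.addr = p ∧ t.Bal h ∧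
    t.leaves.Nodup ∧ T.Laid Λ o M h

/-- The interval tree is laid out with its root at the given address. A node also has the list
of its boxes, sorted by `x1`. -/
def IntervalTree.Laid (M : List ℕ) : IntervalTree n → ℕ → Prop
  | .nil, a => M[a]? = some 0
  | .node m lo up l r, a => M[a]? = some 1 ∧
      (∃ p, M[a + 1]? = some p ∧ (coordsOf Λ.b)[p]? = some m) ∧
      (∃ p, M[a + 2]? = some p ∧ lo.Laid Λ 1 M p) ∧
      (∃ p, M[a + 3]? = some p ∧ up.Laid Λ 2 M p) ∧
      (∃ p, M[a + 4]? = some p ∧ IntervalTree.Laid M l p) ∧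
      (∃ p, M[a + 5]? = some p ∧ IntervalTree.Laid M r p) ∧
      ∃ (X : List (Fin n)) (p : ℕ), M[a + 6]? = some X.length ∧ M[a + 7]? = some p ∧
        Holds M p (X.map Fin.val) ∧ (X.Pairwise fun i j => (Λ.b i).x1 ≤ (Λ.b j).x1) ∧
        X.Perm lo.leaves ∧ X.Perm up.leaves ∧ X.length ≤ n

/-- The segment tree is laid out with its root at the given address. -/
def SegmentTree.Laid (M : List ℕ) : SegmentTree n → ℕ → Prop
  | .leaf m, a => M[a]? = some 0 ∧ (∃ p, M[a + 1]? = some p ∧ m.Laid Λ M p)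
  | .node k m l r, a => M[a]? = some 1 ∧
      (∃ p, M[a + 1]? = some p ∧ m.Laid Λ M p) ∧
      (∃ p, M[a + 2]? = some p ∧ (coordsOf Λ.b)[p]? = some (k : WithTop ℝ)) ∧
      (∃ p, M[a + 3]? = some p ∧ SegmentTree.Laid M l p) ∧
      (∃ p, M[a + 4]? = some p ∧ SegmentTree.Laid M r p)

/-! ### The layout contains the three-layer structure -/

variable {Λ}

theorem getElem?_map_ofNat {w : ℕ} {M : List ℕ} {a x : ℕ} (h : M[a]? = some x) :
    (M.map (BitVec.ofNat w))[a]? = some (BitVec.ofNat w x) := by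
  simp [h]

theorem toNat_ofNat_of_getElem? {w : ℕ} {M : List ℕ} (hM : ∀ x ∈ M, x < 2 ^ w) {a x : ℕ}
    (h : M[a]? = some x) : (BitVec.ofNat w x).toNat = x := by
  rw [BitVec.toNat_ofNat, Nat.mod_eq_of_lt (hM x (List.mem_of_getElem? h))]

theorem BitsAt.bitVectorAt {b : Fin n → CanonicalBox} {w : ℕ} {M : List ℕ} {l r : RangeTree n}
    {p : ℕ} (h : BitsAt b w M (.node l r) r p) (hw : 0 < w) :
    BitVectorAt b (M.map (BitVec.ofNat w)) (.node l r) r p := by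
  intro j i hj
  obtain ⟨x, hx, hb⟩ := h j i hj
  refine ⟨_, getElem?_map_ofNat hx, ?_⟩
  rw [← hb, BitVec.getLsbD_ofNat]
  simp [Nat.mod_lt j hw]

theorem LTree.Laid.storedAt {o : ℕ} {M : List ℕ} {h : ℕ} {T : LTree n} (hT : T.Laid Λ o M h)
    (hM : ∀ x ∈ M, x < 2 ^ Λ.w) (hw : 0 < Λ.w) :
    T.erase.StoredAt Λ.b (M.map (BitVec.ofNat Λ.w)) T.addr := by
  induction T generalizing h with
  | leaf a i => exact ⟨getElem?_map_ofNat hT.1, getElem?_map_ofNat hT.2⟩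
  | node a l r ih₁ ih₂ =>
    obtain ⟨⟨h0, h1, h2, ⟨p, h3, hb⟩, -⟩, hl, hr⟩ := hT
    refine ⟨getElem?_map_ofNat h0, ⟨_, getElem?_map_ofNat h1, ?_⟩, ⟨_, getElem?_map_ofNat h2, ?_⟩,
      ⟨_, getElem?_map_ofNat h3, ?_⟩⟩
    · rw [toNat_ofNat_of_getElem? hM h1]; exact ih₁ hl
    · rw [toNat_ofNat_of_getElem? hM h2]; exact ih₂ hr
    · rw [toNat_ofNat_of_getElem? hM h3]; exact hb.bitVectorAt hw

theorem RangeTree.Laid.storedAt {o : ℕ} {M : List ℕ} {t : RangeTree n} {p : ℕ}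
    (ht : t.Laid Λ o M p) (hM : ∀ x ∈ M, x < 2 ^ Λ.w) (hw : 0 < Λ.w) :
    t.StoredAt Λ.b (M.map (BitVec.ofNat Λ.w)) p := by
  rcases ht with ⟨rfl, h⟩ | ⟨h, T, -, rfl, rfl, -, -, hT⟩
  · exact getElem?_map_ofNat h
  · exact hT.storedAt hM hw

theorem IntervalTree.Laid.storedAt {M : List ℕ} {t : IntervalTree n} {p : ℕ}
    (ht : t.Laid Λ M p) (hM : ∀ x ∈ M, x < 2 ^ Λ.w) (hw : 0 < Λ.w) :
    t.StoredAt Λ.b (M.map (BitVec.ofNat Λ.w)) (coordsOf Λ.b) p := by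
  induction t generalizing p with
  | nil => exact getElem?_map_ofNat ht
  | node m lo up l r ih₁ ih₂ =>
    obtain ⟨h0, ⟨p1, h1, c1⟩, ⟨p2, h2, c2⟩, ⟨p3, h3, c3⟩, ⟨p4, h4, c4⟩, ⟨p5, h5, c5⟩, -⟩ := ht
    refine ⟨getElem?_map_ofNat h0, ⟨_, getElem?_map_ofNat h1, ?_⟩, ⟨_, getElem?_map_ofNat h2, ?_⟩,
      ⟨_, getElem?_map_ofNat h3, ?_⟩, ⟨_, getElem?_map_ofNat h4, ?_⟩,
      ⟨_, getElem?_map_ofNat h5, ?_⟩⟩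
    · rw [toNat_ofNat_of_getElem? hM h1]; exact c1
    · rw [toNat_ofNat_of_getElem? hM h2]; exact c2.storedAt hM hw
    · rw [toNat_ofNat_of_getElem? hM h3]; exact c3.storedAt hM hw
    · rw [toNat_ofNat_of_getElem? hM h4]; exact ih₁ c4
    · rw [toNat_ofNat_of_getElem? hM h5]; exact ih₂ c5

theorem SegmentTree.Laid.storedAt {M : List ℕ} {t : SegmentTree n} {p : ℕ}
    (ht : t.Laid Λ M p) (hM : ∀ x ∈ M, x < 2 ^ Λ.w) (hw : 0 < Λ.w) :
    t.StoredAt Λ.b (M.map (BitVec.ofNat Λ.w)) (coordsOf Λ.b) p := by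
  induction t generalizing p with
  | leaf m =>
    obtain ⟨h0, p1, h1, c1⟩ := ht
    refine ⟨getElem?_map_ofNat h0, _, getElem?_map_ofNat h1, ?_⟩
    rw [toNat_ofNat_of_getElem? hM h1]; exact c1.storedAt hM hw
  | node k m l r ih₁ ih₂ =>
    obtain ⟨h0, ⟨p1, h1, c1⟩, ⟨p2, h2, c2⟩, ⟨p3, h3, c3⟩, ⟨p4, h4, c4⟩⟩ := ht
    refine ⟨getElem?_map_ofNat h0, ⟨_, getElem?_map_ofNat h1, ?_⟩, ⟨_, getElem?_map_ofNat h2, ?_⟩,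
      ⟨_, getElem?_map_ofNat h3, ?_⟩, ⟨_, getElem?_map_ofNat h4, ?_⟩⟩
    · rw [toNat_ofNat_of_getElem? hM h1]; exact c1.storedAt hM hw
    · rw [toNat_ofNat_of_getElem? hM h2]; exact c2
    · rw [toNat_ofNat_of_getElem? hM h3]; exact ih₁ c3
    · rw [toNat_ofNat_of_getElem? hM h4]; exact ih₂ c4

/-! ### Construction of the layout -/

/-- The number of words for the jump tables of a node with `len` leaf descendants. -/
def jumpSize (s d len : ℕ) : ℕ :=
  if d = 1 then 0 else 2 ^ d + (len / 2 ^ (2 * d) + 1) * 2 ^ d + (len / (s / (3 * d)) + 1)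

variable (Λ) in
/-- A bound for the number of words of a range tree of height `h`. -/
def RangeTree.words : ℕ → RangeTree n → ℕ
  | _, .nil => 1
  | _, .leaf _ => 2
  | h, .node l r => 13 + 3 * ((RangeTree.node l r).leaves.length / Λ.s + 1) +
      jumpSize Λ.s (Λ.d h) (RangeTree.node l r).leaves.length + l.words (h - 1) + r.words (h - 1)

/-- When `Λ.d h = 1` the tables are empty and the word at offset `6` is `0`, which tells the query
to go down one level by the rank directory; the later words of the record are then fillers. The
pointers are left arbitrary so that the caller can place the tables. -/
theorem exists_jumpTables (hΛ : Λ.Valid) {h : ℕ} {T : LTree n} (hT : T.erase.Bal h) (hh : h ≤ Λ.s)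
    (hv : T.erase.leaves.length < 2 ^ Λ.w) (hb : T.Below (2 ^ Λ.w)) :
    ∃ ct bt ft : List ℕ, ∃ v₆ v₇ v₈ v₉ : ℕ,
      ct.length + bt.length + ft.length ≤ jumpSize Λ.s (Λ.d h) T.erase.leaves.length ∧
      (∀ x ∈ ct, x < 2 ^ Λ.w) ∧ (∀ x ∈ bt, x < 2 ^ Λ.w) ∧ (∀ x ∈ ft, x < 2 ^ Λ.w) ∧
      v₆ < 2 ^ Λ.w ∧ v₇ < 2 ^ Λ.w ∧ v₈ < 2 ^ Λ.w ∧ v₉ < 2 ^ Λ.w ∧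
      ∀ (M : List ℕ) (a p₁ p₂ p₃ : ℕ), Holds M p₁ ct → Holds M p₂ bt → Holds M p₃ ft →
        M[a + 6]? = some v₆ → M[a + 7]? = some v₇ → M[a + 8]? = some v₈ → M[a + 9]? = some v₉ →
        M[a + 10]? = some p₁ → M[a + 11]? = some p₂ → M[a + 12]? = some p₃ →
        (Λ.d h = 1 ∧ M[a + 6]? = some 0) ∨
          (2 ≤ Λ.d h ∧ 3 * Λ.d h ≤ h ∧ M[a + 6]? = some (3 * Λ.d h) ∧
            M[a + 7]? = some (Λ.s / (3 * Λ.d h)) ∧ M[a + 8]? = some (2 ^ (2 * Λ.d h)) ∧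
            M[a + 9]? = some (2 ^ Λ.d h) ∧ ∃ p₁ p₂ p₃, M[a + 10]? = some p₁ ∧
            M[a + 11]? = some p₂ ∧ M[a + 12]? = some p₃ ∧
            JumpAt Λ.b (Λ.d h) (Λ.s / (3 * Λ.d h)) M T p₁ p₂ p₃) := by
  have hw0 : 0 < 2 ^ Λ.w := by positivity
  rcases hΛ.jump h with h1 | ⟨h2, h3⟩
  · exact ⟨[], [], [], 0, 0, 0, 0, by simp, by simp, by simp, by simp, hw0, hw0, hw0, hw0,
      fun M a p₁ p₂ p₃ _ _ _ h6 _ _ _ _ _ _ => Or.inl ⟨h1, h6⟩⟩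
  · obtain ⟨ct, bt, ft, hct, hbt, hft, hc, hb, hf, hJ⟩ := exists_jumps Λ.b (Λ.d h) Λ.s Λ.w h T hT
      (by omega) (by omega) (by omega) hΛ.s_le hv hb
    have hsw := hΛ.s_le
    have hww : Λ.w < 2 ^ Λ.w := Nat.lt_two_pow_self
    have hdiv := Nat.div_le_self Λ.s (3 * Λ.d h)
    refine ⟨ct, bt, ft, 3 * Λ.d h, Λ.s / (3 * Λ.d h), 2 ^ (2 * Λ.d h), 2 ^ Λ.d h, ?_, hc, hb, hf,
      by omega, by omega, Nat.pow_lt_pow_right (by norm_num) (by omega),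
      Nat.pow_lt_pow_right (by norm_num) (by omega), ?_⟩
    · rw [jumpSize, if_neg (by omega), hct, hbt, hft]
    · intro M a p₁ p₂ p₃ k₁ k₂ k₃ h6 h7 h8 h9 h10 h11 h12
      exact Or.inr ⟨h2, h3, h6, h7, h8, h9, p₁, p₂, p₃, h10, h11, h12, hJ M _ _ _ k₁ k₂ k₃⟩

/-- The records of the children come first, then the tables, and the record of the node last, so
that every pointer is known when it is written. The bit vectors are packed into full `w`-bit words
as the structure requires; the queries use the rank directory with its chunks of `s` bits instead.
-/
theorem exists_rangeTree_laid (hΛ : Λ.Valid) (o : ℕ) (ho : o ≤ 2) (t : RangeTree n) :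
    ∀ (h base : ℕ), t.Bal h → h ≤ Λ.s → t.leaves.length < 2 ^ Λ.w →
      base + t.words Λ h < 2 ^ Λ.w →
      ∃ (T : LTree n) (ext : List ℕ), T.erase = t ∧ T.Below (2 ^ Λ.w) ∧
        ext.length ≤ t.words Λ h ∧ (∀ x ∈ ext, x < 2 ^ Λ.w) ∧
        ∀ M, Holds M base ext → T.Laid Λ o M h := by
  have hsmall := hΛ.small
  induction t with
  | nil => exact fun h base hT => hT.elim
  | leaf i =>
    intro h base _ _ _ hbase
    simp only [RangeTree.words] at hbase
    have hi := i.isLt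
    refine ⟨.leaf base i, [1, i], rfl, ?_, le_rfl, ?_, fun M hM => ⟨hM.head, hM.tail.head⟩⟩
    · exact show base < _ by omega
    · intro x hx
      simp only [List.mem_cons, List.not_mem_nil, or_false] at hx
      omega
  | node l r ih₁ ih₂ =>
    intro h base hT hh hv hbase
    rw [RangeTree.words] at hbase ⊢
    have hv' := hv
    simp only [RangeTree.leaves, List.length_append] at hv'
    obtain ⟨Tl, el, rfl, hbl, hel, hxl, hMl⟩ := ih₁ (h - 1) base hT.2.2.1 (by omega) (by omega)
      (by omega)
    obtain ⟨Tr, er, rfl, hbr, her, hxr, hMr⟩ := ih₂ (h - 1) (base + el.length) hT.2.2.2 (by omega)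
      (by omega) (by omega)
    have hsw := hΛ.s_le
    have hs0 := hΛ.s_pos
    obtain ⟨xb, hxb, hxbw, hxbM⟩ := exists_bits Λ.b Λ.w (by omega)
      (.node Tl.erase Tr.erase) Tr.erase
    obtain ⟨xr, hxr', hxrw, hxrM⟩ := exists_ranks Λ.b Λ.s Λ.w hs0 hsw
      (.node Tl.erase Tr.erase) Tr.erase hv
    have hbits : (RangeTree.node Tl.erase Tr.erase).leaves.length / Λ.w ≤
        (RangeTree.node Tl.erase Tr.erase).leaves.length / Λ.s :=
      Nat.div_le_div_left hsw hs0
    have hi := Tr.first.isLt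
    set b₁ := base + el.length with hb₁
    set b₂ := b₁ + er.length with hb₂
    set b₃ := b₂ + xb.length with hb₃
    set b₄ := b₃ + xr.length with hb₄
    have hext : ∃ a, b₄ ≤ a ∧ ∃ ct bt ft : List ℕ, ∃ v₆ v₇ v₈ v₉ : ℕ,
        a = b₄ + ct.length + bt.length + ft.length ∧
        ct.length + bt.length + ft.length ≤ jumpSize Λ.s (Λ.d h)
          (RangeTree.node Tl.erase Tr.erase).leaves.length ∧
        (∀ x ∈ ct, x < 2 ^ Λ.w) ∧ (∀ x ∈ bt, x < 2 ^ Λ.w) ∧ (∀ x ∈ ft, x < 2 ^ Λ.w) ∧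
        v₆ < 2 ^ Λ.w ∧ v₇ < 2 ^ Λ.w ∧ v₈ < 2 ^ Λ.w ∧ v₉ < 2 ^ Λ.w ∧
        ∀ M, Holds M b₄ ct → Holds M (b₄ + ct.length) bt → Holds M (b₄ + ct.length + bt.length) ft →
          M[a + 6]? = some v₆ → M[a + 7]? = some v₇ → M[a + 8]? = some v₈ → M[a + 9]? = some v₉ →
          M[a + 10]? = some b₄ → M[a + 11]? = some (b₄ + ct.length) →
          M[a + 12]? = some (b₄ + ct.length + bt.length) →
          (Λ.d h = 1 ∧ M[a + 6]? = some 0) ∨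
            (2 ≤ Λ.d h ∧ 3 * Λ.d h ≤ h ∧ M[a + 6]? = some (3 * Λ.d h) ∧
              M[a + 7]? = some (Λ.s / (3 * Λ.d h)) ∧ M[a + 8]? = some (2 ^ (2 * Λ.d h)) ∧
              M[a + 9]? = some (2 ^ Λ.d h) ∧ ∃ p₁ p₂ p₃, M[a + 10]? = some p₁ ∧
              M[a + 11]? = some p₂ ∧ M[a + 12]? = some p₃ ∧
              JumpAt Λ.b (Λ.d h) (Λ.s / (3 * Λ.d h)) M (.node a Tl Tr) p₁ p₂ p₃) := by
      obtain ⟨ct, bt, ft, v₆, v₇, v₈, v₉, hlen, hc, hb, hf, g₆, g₇, g₈, g₉, hJ⟩ :=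
        exists_jumpTables hΛ (T := .node 0 Tl Tr) hT hh hv ⟨by positivity, hbl, hbr⟩
      refine ⟨b₄ + ct.length + bt.length + ft.length, by omega, ct, bt, ft, v₆, v₇, v₈, v₉, rfl,
        hlen, hc, hb, hf, g₆, g₇, g₈, g₉, fun M k₁ k₂ k₃ h6 h7 h8 h9 h10 h11 h12 => ?_⟩
      rcases hJ M _ _ _ _ k₁ k₂ k₃ h6 h7 h8 h9 h10 h11 h12 with hJ | hJ
      · exact Or.inl hJ
      · refine Or.inr ?_
        obtain ⟨i2, i3, i6, i7, i8, i9, p₁, p₂, p₃, i10, i11, i12, hJ⟩ := hJ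
        refine ⟨i2, i3, i6, i7, i8, i9, p₁, p₂, p₃, i10, i11, i12, fun j i hj => ?_⟩
        obtain ⟨c, off, x, y, u, hu, rest⟩ := hJ j i hj
        refine ⟨c, off, x, y, u, ?_, rest⟩
        -- The tables were obtained for a root with address `0`, since the true address follows them
        -- in memory. Descendants at positive depth do not see the address of the root, so the
        -- tables stay valid.
        rcases hΛ.jump h with h1 | h1
        · omega
        · obtain ⟨k, hk⟩ : ∃ k, Λ.d h = k + 1 := ⟨Λ.d h - 1, by omega⟩
          rw [hk] at hu ⊢
          exact hu
    obtain ⟨a, ha, ct, bt, ft, v₆, v₇, v₈, v₉, hadef, hlen, hc, hb, hf, g₆, g₇, g₈, g₉, hJ⟩ := hext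
    refine ⟨.node a Tl Tr, el ++ (er ++ (xb ++ (xr ++ (ct ++ (bt ++ (ft ++
      [2, Tl.addr, Tr.addr, b₂, 5 * (Tr.first : ℕ) + o, b₃, v₆, v₇, v₈, v₉, b₄, b₄ + ct.length,
        b₄ + ct.length + bt.length])))))), rfl, ⟨by omega, hbl, hbr⟩, ?_, ?_, ?_⟩
    · simp only [List.length_append, List.length_cons, List.length_nil]
      omega
    · have := hbl.addr_lt
      have := hbr.addr_lt
      intro x hx
      simp only [List.mem_append, List.mem_cons, List.not_mem_nil, or_false] at hx
      rcases hx with hx | hx | hx | hx | hx | hx | hx | hx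
      · exact hxl x hx
      · exact hxr x hx
      · exact hxbw x hx
      · exact hxrw x hx
      · exact hc x hx
      · exact hb x hx
      · exact hf x hx
      · omega
    · intro M hM
      have m1 := hM.right
      have m2 := m1.right
      have m3 := m2.right
      have m4 := m3.right
      have m5 := m4.right
      have m6 := m5.right
      have m7 := m6.right
      rw [← hb₁] at m1 m2 m3 m4 m5 m6 m7
      rw [← hb₂] at m2 m3 m4 m5 m6 m7
      rw [← hb₃] at m3 m4 m5 m6 m7
      rw [← hb₄] at m4 m5 m6 m7
      rw [← hadef] at m7
      refine ⟨⟨m7.head, m7.tail.head, m7.tail.tail.head,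
        ⟨b₂, m7.tail.tail.tail.head, hxbM M b₂ m2.left⟩, m7.tail.tail.tail.tail.head,
        ⟨b₃, m7.tail.tail.tail.tail.tail.head, hxrM M b₃ m3.left⟩, ?_⟩, hMl M hM.left,
        hMr M m1.left⟩
      have m8 := m7.tail.tail.tail.tail.tail.tail
      have m9 := m8.tail.tail.tail.tail
      exact hJ M m4.left m5.left m6.left m8.head m8.tail.head m8.tail.tail.head
        m8.tail.tail.tail.head m9.head m9.tail.head m9.tail.tail.head

end Layout

end

end Stabbing

namespace Stabbing

noncomputable section

section Layout

variable {n : ℕ} {Λ : Layout n}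

/-! ### The number of words -/

/-- From `3 * d ≤ h` follows `2 ^ (2 * d) ≤ len`, so the child table and both parts of the base
table are each at most `len / 2 ^ d`. Rounding down in `s / (3 * d)` loses at most a factor `2`,
hence the `6`. -/
theorem jumpSize_le (s d h len : ℕ) (hs : h ≤ s) (hlen : 2 ^ h ≤ len)
    (hd : d = 1 ∨ (2 ≤ d ∧ 3 * d ≤ h)) :
    (jumpSize s d len : ℝ) ≤
      1 + len * (6 * d / s + 3 * if d = 1 then 0 else ((2 : ℝ) ^ d)⁻¹) := by
  rw [jumpSize]
  rcases hd with rfl | ⟨h2, h3⟩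
  · simp; positivity
  · have hd1 : d ≠ 1 := by omega
    rw [if_neg hd1, if_neg hd1]
    have hs0 : (0 : ℝ) < s := by exact_mod_cast (show 0 < s by omega)
    have h4 : 2 ^ (2 * d) ≤ len :=
      (Nat.pow_le_pow_right (by norm_num) (by omega)).trans hlen
    have h4' : (2 : ℝ) ^ d * 2 ^ d ≤ len := by
      rw [← pow_add, ← two_mul]; exact_mod_cast h4
    have hp : (0 : ℝ) < 2 ^ d := by positivity
    have e1 : (2 : ℝ) ^ d ≤ len * ((2 : ℝ) ^ d)⁻¹ := by
      rw [← div_eq_mul_inv, le_div_iff₀ hp]; exact h4'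
    have e2 : ((len / 2 ^ (2 * d) : ℕ) : ℝ) * 2 ^ d ≤ len * ((2 : ℝ) ^ d)⁻¹ := by
      have : ((len / 2 ^ (2 * d) : ℕ) : ℝ) ≤ len / 2 ^ (2 * d) := by
        have := Nat.cast_div_le (α := ℝ) (m := len) (n := 2 ^ (2 * d))
        simpa using this
      calc ((len / 2 ^ (2 * d) : ℕ) : ℝ) * 2 ^ d ≤ len / 2 ^ (2 * d) * 2 ^ d := by gcongr
        _ = len * ((2 : ℝ) ^ d)⁻¹ := by
          rw [two_mul, pow_add]; field_simp
    have e3 : ((len / (s / (3 * d)) : ℕ) : ℝ) ≤ len * (6 * d / s) := by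
      have h5 : 0 < s / (3 * d) := Nat.div_pos (by omega) (by omega)
      have h6 : s ≤ 6 * d * (s / (3 * d)) := by
        have h7 := Nat.div_add_mod s (3 * d)
        have h8 := Nat.mod_lt s (show 0 < 3 * d by omega)
        have h9 : 3 * d ≤ 3 * d * (s / (3 * d)) := Nat.le_mul_of_pos_right _ h5
        have h10 : 6 * d * (s / (3 * d)) = 3 * d * (s / (3 * d)) + 3 * d * (s / (3 * d)) := by ring
        omega
      have h6' : (s : ℝ) ≤ 6 * d * (s / (3 * d) : ℕ) := by exact_mod_cast h6
      have h5' : (0 : ℝ) < (s / (3 * d) : ℕ) := by exact_mod_cast h5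
      refine Nat.cast_div_le.trans ?_
      rw [mul_div_assoc', div_le_div_iff₀ h5' hs0, mul_assoc]
      exact mul_le_mul_of_nonneg_left h6' (by positivity)
    push_cast
    linarith

variable (Λ) in
/-- The number of words per box for the tables of the nodes of height `h`. -/
def levelCost (h : ℕ) : ℝ :=
  (3 + 6 * Λ.d h) / Λ.s + 3 * if Λ.d h = 1 then 0 else ((2 : ℝ) ^ Λ.d h)⁻¹

theorem levelCost_nonneg (h : ℕ) : 0 ≤ levelCost Λ h := by
  rw [levelCost]
  split_ifs <;> positivity

theorem RangeTree.Bal.eq_leaf {h : ℕ} {t : RangeTree n} (ht : t.Bal h) (hl : t.leaves.length ≤ 1) :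
    ∃ i, t = .leaf i := by
  cases t with
  | nil => exact ht.elim
  | leaf i => exact ⟨i, rfl⟩
  | node l r =>
    have h1 := ht.2.2.1.length_pos
    have h2 := ht.2.2.2.length_pos
    simp only [RangeTree.leaves, List.length_append] at hl
    omega

/-- A tree with `len` leaves has `2 * len - 1` nodes, and `17` covers the constant part of each: the
`13` words of a record and the rounding of the tables. The parts proportional to the list lengths
are paid level by level, as the nodes of one height share the leaves. -/
theorem RangeTree.Bal.words_le (hΛ : Λ.Valid) {h : ℕ} {t : RangeTree n} (ht : t.Bal h)
    (hh : h ≤ Λ.s) : (t.words Λ h : ℝ) ≤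
      17 * (2 * t.leaves.length - 1) +
        t.leaves.length * ∑ k ∈ Finset.range (h + 1), levelCost Λ k := by
  induction t generalizing h with
  | nil => exact ht.elim
  | leaf i =>
    have := Finset.sum_nonneg fun k (_ : k ∈ Finset.range (h + 1)) => levelCost_nonneg (Λ := Λ) k
    simp only [RangeTree.words, RangeTree.leaves, List.length_singleton]
    push_cast
    linarith
  | node l r ih₁ ih₂ =>
    have hjs := jumpSize_le Λ.s (Λ.d h) h _ hh ht.1 (hΛ.jump h)
    have hadd : (RangeTree.node l r).leaves.length = l.leaves.length + r.leaves.length := by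
      simp [RangeTree.leaves]
    have hs0 : (0 : ℝ) < Λ.s := by exact_mod_cast hΛ.s_pos
    have hdiv : (((RangeTree.node l r).leaves.length / Λ.s : ℕ) : ℝ) ≤
        (RangeTree.node l r).leaves.length * (1 / Λ.s) := by
      rw [mul_one_div]; exact Nat.cast_div_le
    have hown : (13 + 3 * ((((RangeTree.node l r).leaves.length / Λ.s : ℕ) : ℝ) + 1) +
        (jumpSize Λ.s (Λ.d h) (RangeTree.node l r).leaves.length : ℝ)) ≤
        17 + (RangeTree.node l r).leaves.length * levelCost Λ h := by
      have : ((RangeTree.node l r).leaves.length : ℝ) * levelCost Λ h =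
          3 * ((RangeTree.node l r).leaves.length * (1 / Λ.s)) +
          (RangeTree.node l r).leaves.length * (6 * Λ.d h / Λ.s +
            3 * if Λ.d h = 1 then 0 else ((2 : ℝ) ^ Λ.d h)⁻¹) := by
        rw [levelCost]; ring
      linarith
    have hadd' : ((RangeTree.node l r).leaves.length : ℝ) =
      l.leaves.length + r.leaves.length := by exact_mod_cast hadd
    rw [RangeTree.words]
    push_cast
    cases h with
    -- The children have height index `0` again, so the inductive bound would charge level `0`
    -- twice; here they are leaves without tables.
    | zero =>
      have hl := ht.2.2.1.length_pos
      have hr := ht.2.2.2.length_pos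
      have h2 := ht.2.1
      obtain ⟨i, rfl⟩ := ht.2.2.1.eq_leaf (by omega)
      obtain ⟨j, rfl⟩ := ht.2.2.2.eq_leaf (by omega)
      simp only [RangeTree.words, zero_add, Finset.sum_range_one]
      have e1 : ((RangeTree.leaf i : RangeTree n).leaves.length : ℝ) = 1 := by
        simp [RangeTree.leaves]
      have e2 : ((RangeTree.leaf j : RangeTree n).leaves.length : ℝ) = 1 := by
        simp [RangeTree.leaves]
      rw [e1, e2] at hadd'
      push_cast
      rw [hadd'] at hown ⊢
      linarith
    | succ h =>
      have i1 := ih₁ ht.2.2.1 (by omega)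
      have i2 := ih₂ ht.2.2.2 (by omega)
      simp only [Nat.add_sub_cancel] at i1 i2 ⊢
      rw [Finset.sum_range_succ, mul_add]
      set S := ∑ k ∈ Finset.range (h + 1), levelCost Λ k
      have : ((RangeTree.node l r).leaves.length : ℝ) * S =
        l.leaves.length * S + r.leaves.length * S := by rw [hadd', add_mul]
      linarith

/-- The two sums of the jump schedule pay off here. Bit vectors and ranks cost `3 / s` per box and
level, hence at most `6` over all levels; the fields cost at most `6 * c` and the child and base
tables at most `3 * c`. The other `34` come from the `17` words for each of the fewer than `2 * len`
nodes. -/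
theorem RangeTree.Bal.words_le_mul (hΛ : Λ.Valid) {ε : ℝ} {c : ℕ}
    (hc : JumpSchedule ε c Λ.s Λ.d) {h : ℕ} {t : RangeTree n} (ht : t.Bal h) (hh : h ≤ Λ.s) :
    t.words Λ h ≤ (40 + 9 * c) * t.leaves.length := by
  have h1 := ht.words_le hΛ hh
  have hs0 : (1 : ℝ) ≤ Λ.s := by exact_mod_cast hΛ.s_pos
  have hsum : ∑ k ∈ Finset.range (h + 1), levelCost Λ k ≤ 6 + 9 * c := by
    simp only [levelCost]
    rw [Finset.sum_add_distrib, ← Finset.sum_div, ← Finset.mul_sum, Finset.sum_add_distrib,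
      ← Finset.mul_sum, Finset.sum_const, Finset.card_range, nsmul_eq_mul]
    have h2 : (∑ k ∈ Finset.range (h + 1), (Λ.d k : ℝ)) ≤ c * Λ.s := by
      exact_mod_cast hc.sum_le h hh
    have h3 := hc.sum_inv_le h hh
    have h4 : ((h + 1 : ℕ) : ℝ) ≤ 2 * Λ.s := by
      have : h + 1 ≤ 2 * Λ.s := by have := hΛ.s_pos; omega
      exact_mod_cast this
    have h5 : (((h + 1 : ℕ) : ℝ) * 3 + 6 * ∑ k ∈ Finset.range (h + 1), (Λ.d k : ℝ)) / Λ.s ≤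
        6 + 6 * c := by
      rw [div_le_iff₀ (by linarith)]
      nlinarith
    linarith
  have hlen : (1 : ℝ) ≤ t.leaves.length := by exact_mod_cast ht.length_pos
  have : (t.words Λ h : ℝ) ≤ ((40 + 9 * c) * t.leaves.length : ℕ) := by
    push_cast
    nlinarith
  exact_mod_cast this

/-! ### Construction of the upper layers -/

theorem exists_ofList_laid (hΛ : Λ.Valid) {c₀ : ℕ}
    (hc : ∀ (h : ℕ) (t : RangeTree n), t.Bal h → h ≤ Λ.s → t.words Λ h ≤ c₀ * t.leaves.length)
    (o : ℕ) (ho : o ≤ 2) (L : List (Fin n)) (hL : L.Nodup) (base : ℕ)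
    (hbase : base + (c₀ * L.length + 1) < 2 ^ Λ.w) :
    ∃ (p : ℕ) (ext : List ℕ), p < 2 ^ Λ.w ∧ ext.length ≤ c₀ * L.length + 1 ∧
      (∀ x ∈ ext, x < 2 ^ Λ.w) ∧
      ∀ M, Holds M base ext → (RangeTree.ofList L).Laid Λ o M p := by
  have hsmall := hΛ.small
  have hLn : L.length ≤ n := by simpa using hL.length_le_card
  rcases RangeTree.ofList_cases L with ⟨rfl, h⟩ | h
  · refine ⟨base, [0], by omega, by simp, by simp, fun M hM => Or.inl ⟨h, hM.head⟩⟩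
  · have hlog : Nat.log 2 L.length ≤ Λ.s :=
      Nat.lt_succ_iff.mp (Nat.log_lt_of_lt_pow
        (by have := h.length_pos; rw [RangeTree.leaves_ofList] at this; omega)
        (hLn.trans_lt hΛ.lt_two_pow))
    have hw := hc _ _ h hlog
    rw [RangeTree.leaves_ofList] at hw
    obtain ⟨T, ext, hT, hTb, hext, hx, hM⟩ := exists_rangeTree_laid hΛ o ho _ _ base h hlog
      (by rw [RangeTree.leaves_ofList]; omega) (by omega)
    refine ⟨T.addr, ext, hTb.addr_lt, by omega, hx, fun M hMe => Or.inr ⟨_, T, hlog, hT, rfl, h,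
      by rwa [RangeTree.leaves_ofList], hM M hMe⟩⟩

theorem exists_intervalTree_laid (hΛ : Λ.Valid) {c₀ : ℕ}
    (hc : ∀ (h : ℕ) (t : RangeTree n), t.Bal h → h ≤ Λ.s → t.words Λ h ≤ c₀ * t.leaves.length)
    (L : List (Fin n)) : L.Nodup → ∀ base : ℕ,
    base + (if L.length = 0 then 1 else (2 * c₀ + 25) * L.length - 12) < 2 ^ Λ.w →
    ∃ (p : ℕ) (ext : List ℕ), p < 2 ^ Λ.w ∧
      ext.length ≤ (if L.length = 0 then 1 else (2 * c₀ + 25) * L.length - 12) ∧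
      (∀ x ∈ ext, x < 2 ^ Λ.w) ∧
      ∀ M, Holds M base ext → (IntervalTree.build Λ.b L).Laid Λ M p := by
  have hsmall := hΛ.small
  induction L using IntervalTree.build.induct Λ.b with
  | case1 =>
    intro _ base hbase
    simp only [List.length_nil, if_true] at hbase ⊢
    refine ⟨base, [0], by omega, by simp, by simp, fun M hM => ?_⟩
    rw [IntervalTree.build, dif_pos rfl]
    exact hM.head
  | case2 L hL ih₁ ih₂ =>
    intro hnd base hbase
    have hpos : 0 < L.length := List.length_pos_iff.mpr hL
    have hLn : L.length ≤ n := by simpa using hnd.length_le_card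
    rw [if_neg hpos.ne'] at hbase ⊢
    have hsum := length_yMiddle_add Λ.b L
    have hl := length_yLeft_lt Λ.b L hL
    have hr := length_yRight_lt Λ.b L hL
    have hmnd : (yMiddle Λ.b L).Nodup := hnd.filter _
    set lo := (yMiddle Λ.b L).insertionSort fun i j => (Λ.b i).y1 ≤ (Λ.b j).y1 with hlo
    set up := (yMiddle Λ.b L).insertionSort fun i j => (Λ.b i).y2 ≤ (Λ.b j).y2 with hup
    have plo : lo.Perm (yMiddle Λ.b L) := List.perm_insertionSort _ _
    have pup : up.Perm (yMiddle Λ.b L) := List.perm_insertionSort _ _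
    set m := (yMiddle Λ.b L).length with hm
    set x := (yLeft Λ.b L).length with hx
    set y := (yRight Λ.b L).length with hy
    -- The `- 12` is a credit that pays for nodes at which no box is stored. Such a node has two
    -- nonempty subtrees, because each subtree is smaller than the whole list, so it receives two
    -- credits and passes on one. A single box with two empty subtrees gives equality.
    have hbound : 2 * (c₀ * m + 1) + (if x = 0 then 1 else (2 * c₀ + 25) * x - 12) +
        (if y = 0 then 1 else (2 * c₀ + 25) * y - 12) + m + 8 ≤ (2 * c₀ + 25) * L.length - 12 := by
      have hexp : (2 * c₀ + 25) * L.length =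
          2 * (c₀ * m) + 25 * m + (2 * c₀ + 25) * x + (2 * c₀ + 25) * y := by
        rw [← hsum]; ring
      have h25 : ∀ z : ℕ, 25 * z ≤ (2 * c₀ + 25) * z := fun z => Nat.mul_le_mul_right z (by omega)
      have hx25 := h25 x
      have hy25 := h25 y
      split_ifs with h1 h2 h2
      · simp only [h1, h2, mul_zero] at *; omega
      · simp only [h1, mul_zero] at *; omega
      · simp only [h2, mul_zero] at *; omega
      · omega
    obtain ⟨p₁, e₁, hp₁, hl₁, hx₁, hM₁⟩ := exists_ofList_laid hΛ hc 1 (by omega) lo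
      (plo.nodup_iff.mpr hmnd) base (by rw [plo.length_eq, ← hm]; omega)
    rw [plo.length_eq, ← hm] at hl₁
    obtain ⟨p₂, e₂, hp₂, hl₂, hx₂, hM₂⟩ := exists_ofList_laid hΛ hc 2 (by omega) up
      (pup.nodup_iff.mpr hmnd) (base + e₁.length) (by rw [pup.length_eq, ← hm]; omega)
    rw [pup.length_eq, ← hm] at hl₂
    obtain ⟨p₃, e₃, hp₃, hl₃, hx₃, hM₃⟩ := ih₁ (hnd.filter _) (base + e₁.length + e₂.length)
      (by omega)
    obtain ⟨p₄, e₄, hp₄, hl₄, hx₄, hM₄⟩ := ih₂ (hnd.filter _)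
      (base + e₁.length + e₂.length + e₃.length) (by omega)
    set X := (RangeTree.ofList (yMiddle Λ.b L)).bottomList Λ.b with hX
    have hXp : X.Perm (yMiddle Λ.b L) := by
      have := (RangeTree.ofList (yMiddle Λ.b L)).bottomList_perm Λ.b
      rwa [RangeTree.leaves_ofList] at this
    have hXl : X.length = m := hXp.length_eq
    obtain ⟨pm, hpm, hcm⟩ : ∃ p < 5 * n, (coordsOf Λ.b)[p]? = some (yMedian Λ.b L) := by
      obtain ⟨hlt, hmed⟩ := yMedian_eq_getElem Λ.b L hL
      have hmem : yMedian Λ.b L ∈ yEndpoints Λ.b L := by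
        rw [← List.mem_insertionSort (· ≤ ·), hmed]
        exact List.getElem_mem _
      simp only [yEndpoints, List.mem_flatMap, List.mem_cons, List.not_mem_nil, or_false] at hmem
      obtain ⟨i, -, h⟩ := hmem
      refine exists_getElem?_coordsOf Λ.b i _ ?_
      simp only [CanonicalBox.coordinates, List.mem_cons, List.not_mem_nil, or_false]
      tauto
    refine ⟨base + e₁.length + e₂.length + e₃.length + e₄.length + (X.map Fin.val).length,
      e₁ ++ (e₂ ++ (e₃ ++ (e₄ ++ (X.map Fin.val ++ [1, pm, p₁, p₂, p₃, p₄, X.length,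
        base + e₁.length + e₂.length + e₃.length + e₄.length])))), ?_, ?_, ?_, ?_⟩
    · rw [List.length_map]; omega
    · simp only [List.length_append, List.length_cons, List.length_nil, List.length_map]
      omega
    · intro z hz
      simp only [List.mem_append, List.mem_cons, List.not_mem_nil, or_false, List.mem_map] at hz
      rcases hz with hz | hz | hz | hz | ⟨i, -, rfl⟩ | hz
      · exact hx₁ z hz
      · exact hx₂ z hz
      · exact hx₃ z hz
      · exact hx₄ z hz
      · have := i.isLt; omega
      · omega
    · intro M hM
      have m1 := hM.right
      have m2 := m1.right
      have m3 := m2.right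
      have m4 := m3.right
      have m5 := m4.right
      rw [IntervalTree.build, dif_neg hL]
      have k1 := m5.tail
      have k2 := k1.tail
      have k3 := k2.tail
      have k4 := k3.tail
      have k5 := k4.tail
      have k6 := k5.tail
      have k7 := k6.tail
      refine ⟨m5.head, ⟨_, k1.head, hcm⟩, ⟨_, k2.head, hM₁ M hM.left⟩, ⟨_, k3.head, hM₂ M m1.left⟩,
        ⟨_, k4.head, hM₃ M m2.left⟩, ⟨_, k5.head, hM₄ M m3.left⟩, X, _, k6.head, k7.head,
        m4.left, RangeTree.bottomList_pairwise Λ.b _, ?_, ?_, ?_⟩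
      · rw [lowerTree, RangeTree.leaves_ofList]; exact hXp.trans plo.symm
      · rw [upperTree, RangeTree.leaves_ofList]; exact hXp.trans pup.symm
      · omega

/-- Six words per node cover the record of at most five words and the one word of an interval tree
that may be empty. -/
theorem exists_segmentTree_laid (hΛ : Λ.Valid) {c₀ : ℕ}
    (hc : ∀ (h : ℕ) (t : RangeTree n), t.Bal h → h ≤ Λ.s → t.words Λ h ≤ c₀ * t.leaves.length)
    (keys : List ℝ) (J I : Set ℝ) : (∀ k ∈ keys, k ∈ zKeys Λ.b) → ∀ base : ℕ,
    base + (6 * (SegmentTree.build Λ.b keys J I).nodes +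
      (2 * c₀ + 25) * (SegmentTree.build Λ.b keys J I).boxes) < 2 ^ Λ.w →
    ∃ (p : ℕ) (ext : List ℕ), p < 2 ^ Λ.w ∧
      ext.length ≤ 6 * (SegmentTree.build Λ.b keys J I).nodes +
        (2 * c₀ + 25) * (SegmentTree.build Λ.b keys J I).boxes ∧
      (∀ x ∈ ext, x < 2 ^ Λ.w) ∧
      ∀ M, Holds M base ext → (SegmentTree.build Λ.b keys J I).Laid Λ M p := by
  have hsmall := hΛ.small
  have hint : ∀ (J I : Set ℝ) (base : ℕ),
      base + (1 + (2 * c₀ + 25) * (IntervalTree.build Λ.b (assigned Λ.b J I)).boxes) < 2 ^ Λ.w →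
      ∃ (p : ℕ) (ext : List ℕ), p < 2 ^ Λ.w ∧
        ext.length ≤ 1 + (2 * c₀ + 25) * (IntervalTree.build Λ.b (assigned Λ.b J I)).boxes ∧
        (∀ x ∈ ext, x < 2 ^ Λ.w) ∧
        ∀ M, Holds M base ext → (IntervalTree.build Λ.b (assigned Λ.b J I)).Laid Λ M p := by
    intro J I base hbase
    rw [IntervalTree.boxes_build] at hbase ⊢
    have hle : (if (assigned Λ.b J I).length = 0 then 1
        else (2 * c₀ + 25) * (assigned Λ.b J I).length - 12) ≤
        1 + (2 * c₀ + 25) * (assigned Λ.b J I).length := by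
      split_ifs <;> omega
    obtain ⟨p, ext, h1, h2, h3, h4⟩ := exists_intervalTree_laid hΛ hc (assigned Λ.b J I)
      ((List.nodup_finRange n).filter _) base (by omega)
    exact ⟨p, ext, h1, by omega, h3, h4⟩
  induction keys, J, I using SegmentTree.build.induct with
  | case1 J I =>
    intro _ base
    rw [SegmentTree.build, dif_pos rfl]
    simp only [SegmentTree.nodes, SegmentTree.boxes]
    intro hbase
    obtain ⟨p, e, hp, hl, hx, hM⟩ := hint J I base (by omega)
    refine ⟨base + e.length, e ++ [0, p], by omega, ?_, ?_, ?_⟩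
    · simp only [List.length_append, List.length_cons, List.length_nil]; omega
    · intro z hz
      simp only [List.mem_append, List.mem_cons, List.not_mem_nil, or_false] at hz
      rcases hz with hz | hz
      · exact hx z hz
      · omega
    · intro M hMe
      exact ⟨hMe.right.head, p, hMe.right.tail.head, hM M hMe.left⟩
  | case2 keys J I hk hlt ih₁ ih₂ =>
    intro hkeys base
    rw [SegmentTree.build, dif_neg hk]
    simp only [SegmentTree.nodes, SegmentTree.boxes, Nat.mul_add]
    intro hbase
    obtain ⟨pk, hpk, hck⟩ : ∃ p < 5 * n,
        (coordsOf Λ.b)[p]? = some (keys[keys.length / 2] : WithTop ℝ) := by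
      obtain ⟨i, hi⟩ := (zKeys_spec Λ.b _).mp (hkeys _ (List.getElem_mem hlt))
      refine exists_getElem?_coordsOf Λ.b i _ ?_
      simp only [CanonicalBox.coordinates, List.mem_cons, List.not_mem_nil, or_false,
        WithTop.coe_inj]
      tauto
    obtain ⟨p, e, hp, hl, hx, hM⟩ := hint J I base (by omega)
    obtain ⟨p₁, e₁, hp₁, hl₁, hx₁, hM₁⟩ := ih₁ (fun k hk => hkeys k (List.mem_of_mem_take hk))
      (base + e.length) (by omega)
    obtain ⟨p₂, e₂, hp₂, hl₂, hx₂, hM₂⟩ := ih₂ (fun k hk => hkeys k (List.mem_of_mem_drop hk))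
      (base + e.length + e₁.length) (by omega)
    refine ⟨base + e.length + e₁.length + e₂.length, e ++ (e₁ ++ (e₂ ++ [1, p, pk, p₁, p₂])),
      by omega, ?_, ?_, ?_⟩
    · simp only [List.length_append, List.length_cons, List.length_nil]; omega
    · intro z hz
      simp only [List.mem_append, List.mem_cons, List.not_mem_nil, or_false] at hz
      rcases hz with hz | hz | hz | hz
      · exact hx z hz
      · exact hx₁ z hz
      · exact hx₂ z hz
      · omega
    · intro M hMe
      have m1 := hMe.right
      have m2 := m1.right
      have m3 := m2.right
      exact ⟨m3.head, ⟨p, m3.tail.head, hM M hMe.left⟩, ⟨pk, m3.tail.tail.head, hck⟩,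
        ⟨p₁, m3.tail.tail.tail.head, hM₁ M m1.left⟩,
        ⟨p₂, m3.tail.tail.tail.tail.head, hM₂ M m2.left⟩⟩

/-- The memory: the address of the root, the chunk size, the table of bit counts, and the trees. -/
theorem exists_memory (hΛ : Λ.Valid) {c₀ : ℕ}
    (hc : ∀ (h : ℕ) (t : RangeTree n), t.Bal h → h ≤ Λ.s → t.words Λ h ≤ c₀ * t.leaves.length)
    (hw : n + 2 + (6 * (structureOf Λ.b).nodes + (2 * c₀ + 25) * (structureOf Λ.b).boxes) <
      2 ^ Λ.w) :
    ∃ (M : List ℕ) (root : ℕ), M[0]? = some root ∧ M[1]? = some Λ.s ∧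
      (∀ x < 2 ^ Λ.s, M[2 + x]? = some (popCount Λ.s x)) ∧ (structureOf Λ.b).Laid Λ M root ∧
      (∀ x ∈ M, x < 2 ^ Λ.w) ∧ M.length ≤ n + 2 +
        (6 * (structureOf Λ.b).nodes + (2 * c₀ + 25) * (structureOf Λ.b).boxes) := by
  have h2 := hΛ.two_pow_le
  obtain ⟨root, ext, hr, hl, hx, hM⟩ := exists_segmentTree_laid hΛ hc (zKeys Λ.b) Set.univ Set.univ
    (fun _ h => h) (2 + 2 ^ Λ.s) (by rw [structureOf] at hw; omega)
  have hs : Λ.s < 2 ^ Λ.s := Nat.lt_two_pow_self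
  set tab := (List.range (2 ^ Λ.s)).map (popCount Λ.s) with htab
  have hlen : tab.length = 2 ^ Λ.s := by simp [htab]
  have hall : Holds (root :: Λ.s :: (tab ++ ext)) 0 (root :: Λ.s :: (tab ++ ext)) :=
    fun i x hx => by rwa [Nat.zero_add]
  refine ⟨root :: Λ.s :: (tab ++ ext), root, rfl, rfl, ?_, ?_, ?_, ?_⟩
  · intro x hx
    exact hall.tail.tail.left.table hx
  · refine hM _ ?_
    have := hall.tail.tail.right
    rwa [hlen] at this
  · intro x hx'
    simp only [List.mem_cons, List.mem_append] at hx'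
    rcases hx' with rfl | rfl | hx' | hx'
    · exact hr
    · omega
    · obtain ⟨y, -, rfl⟩ := List.mem_map.mp hx'
      have : popCount Λ.s y ≤ Λ.s := List.countP_le_length.trans (by simp)
      omega
    · exact hx x hx'
  · simp only [List.length_cons, List.length_append, hlen]
    rw [structureOf]
    omega

end Layout

end

end Stabbing

namespace Stabbing

noncomputable section

/-! ## The query programs -/

theorem Ev.var' {w : ℕ} {M : List ℕ} {σ : St} {r v : ℕ} (h : σ.reg r = v) :
    Ev w M σ (.var r) v := h ▸ .var r

section WP

variable {w : ℕ} {M : List ℕ} {coords : List (WithTop ℝ)} {σ : St} {Q : ℕ → St → Prop}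

theorem WP.seq_assign {d : ℕ} {e : Expr} {v : ℕ} {s : Stmt} (h : Ev w M σ e v)
    (hq : WP w M coords s (σ.set d v) fun t σ' => Q (e.cost + 1 + t) σ') :
    WP w M coords (.seq (.assign d e) s) σ Q := .seq (.assign h hq)

theorem WP.seq_getC {d : ℕ} {e : Expr} {v : ℕ} {x : WithTop ℝ} {s : Stmt} (h : Ev w M σ e v)
    (hx : coords[v]? = some x)
    (hq : WP w M coords s (σ.setC d x) fun t σ' => Q (e.cost + 1 + t) σ') :
    WP w M coords (.seq (.getC d e) s) σ Q := .seq (.getC h hx hq)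

theorem WP.of_seq {s₁ s₂ : Stmt} (h : WP w M coords (.seq s₁ s₂) σ Q) :
    WP w M coords s₁ σ fun t₁ σ₁ => WP w M coords s₂ σ₁ fun t₂ σ₂ => Q (t₁ + t₂) σ₂ := by
  obtain ⟨t, σ', h, hq⟩ := h
  cases h with
  | seq h₁ h₂ => exact ⟨_, _, h₁, _, _, h₂, hq⟩

/-- Unrolls one iteration while the statement after the loop stays attached. An induction over a
tree can then treat a loop and the step that follows it at the final leaf as one program. -/
theorem WP.whil_seq_true {e₁ e₂ : Expr} {s s' : Stmt} {v₁ v₂ : ℕ} (h₁ : Ev w M σ e₁ v₁)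
    (h₂ : Ev w M σ e₂ v₂) (h : v₁ < v₂)
    (hb : WP w M coords s σ fun t σ' =>
      WP w M coords (.seq (.whil e₁ e₂ s) s') σ' fun t' σ'' =>
        Q (e₁.cost + e₂.cost + 2 + t + t') σ'') :
    WP w M coords (.seq (.whil e₁ e₂ s) s') σ Q := by
  refine WP.seq (WP.whil_true h₁ h₂ h (hb.mono fun t σ' h => h.of_seq.mono fun t' σ'' h => ?_))
  simpa only [Nat.add_assoc] using h

end WP

/-- The variables below `k` and the query are unchanged, the counter (variable `2`) has grown by
`a` and the output by `o`. -/
structure Post (k : ℕ) (σ σ' : St) (a : ℕ) (o : List ℕ) : Prop where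
  reg : ∀ r < k, r ≠ 2 → σ'.reg r = σ.reg r
  creg : ∀ r < 3, σ'.creg r = σ.creg r
  acc : σ'.reg 2 = σ.reg 2 + a
  out : σ'.out = σ.out ++ o

namespace Post

variable {k : ℕ} {σ σ' σ'' : St} {a a' : ℕ} {o o' : List ℕ}

theorem refl : Post k σ σ 0 [] := ⟨fun _ _ _ => rfl, fun _ _ => rfl, rfl, by simp⟩

theorem set (h : Post k σ σ' a o) {r : ℕ} (hr : k ≤ r) (hk : 2 < k) (v : ℕ) :
    Post k σ (σ'.set r v) a o := by
  refine ⟨fun r' h₁ h₂ => ?_, h.creg, ?_, h.out⟩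
  · rw [St.reg_set, if_neg (by omega)]; exact h.reg r' h₁ h₂
  · rw [St.reg_set, if_neg (by omega)]; exact h.acc

theorem setC (h : Post k σ σ' a o) {r : ℕ} (hr : 3 ≤ r) (v : WithTop ℝ) :
    Post k σ (σ'.setC r v) a o := by
  refine ⟨h.reg, fun r' h₁ => ?_, h.acc, h.out⟩
  rw [St.creg_setC, if_neg (by omega)]; exact h.creg r' h₁

theorem emit (h : Post k σ σ' a o) (v : ℕ) : Post k σ (σ'.emit v) a (o ++ [v]) :=
  ⟨h.reg, h.creg, h.acc, by rw [St.out_emit, h.out, List.append_assoc]⟩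

theorem trans (h : Post k σ σ' a o) (h' : Post k σ' σ'' a' o') :
    Post k σ σ'' (a + a') (o ++ o') :=
  ⟨fun r h₁ h₂ => (h'.reg r h₁ h₂).trans (h.reg r h₁ h₂),
    fun r h₁ => (h'.creg r h₁).trans (h.creg r h₁),
    by rw [h'.acc, h.acc, Nat.add_assoc], by rw [h'.out, h.out, List.append_assoc]⟩

theorem mono (h : Post k σ σ' a o) {k' : ℕ} (hk : k' ≤ k) : Post k' σ σ' a o :=
  ⟨fun r h₁ h₂ => h.reg r (by omega) h₂, h.creg, h.acc, h.out⟩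

end Post

/-- The memory is a valid layout with the table of bit counts. -/
structure Env {n : ℕ} (Λ : Layout n) (M : List ℕ) : Prop where
  valid : Λ.Valid
  lt : ∀ x ∈ M, x < 2 ^ Λ.w
  length_le : M.length ≤ 2 ^ Λ.w
  pop : ∀ x < 2 ^ Λ.s, M[2 + x]? = some (popCount Λ.s x)

section Programs

variable {n : ℕ} {Λ : Layout n} {M : List ℕ}

theorem Env.lit (hE : Env Λ M) {σ : St} {v : ℕ} (hv : v < 16) : Ev Λ.w M σ (.lit v) v :=
  .lit v (by have := hE.valid.small; omega)

theorem Env.addr_lt (hE : Env Λ M) {a x : ℕ} (h : M[a]? = some x) : a < 2 ^ Λ.w :=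
  (List.getElem?_eq_some_iff.mp h).1.trans_le hE.length_le

theorem Env.two_pow_lt (hE : Env Λ M) {k : ℕ} (hk : k < Λ.s) : 1 * 2 ^ k < 2 ^ Λ.w := by
  rw [one_mul]
  exact Nat.pow_lt_pow_right (by norm_num) (hk.trans_le hE.valid.s_le)

theorem length_leaves_le {t : RangeTree n} (ht : t.leaves.Nodup) : t.leaves.length ≤ n := by
  simpa using ht.length_le_card

/-- The word with the bits of the chunk of position `p`. -/
def chunkExpr (v p : ℕ) : Expr :=
  .ld (.ld (.var v) (.lit 5)) (.op .add (.op .mul (.lit 2) (.op .div (.var p) (.var 1))) (.lit 1))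

/-- The number of entries before position `p` that belong to the right child of the node `v`. -/
def rankExpr (v p : ℕ) : Expr :=
  .op .add (.ld (.ld (.var v) (.lit 5)) (.op .mul (.lit 2) (.op .div (.var p) (.var 1))))
    (.ld (.lit 2) (.op .mod (chunkExpr v p) (.op .shl (.lit 1) (.op .mod (.var p) (.var 1)))))

/-- The bit of the entry at position `p`. -/
def bitExpr (v p : ℕ) : Expr :=
  .op .mod (.op .shr (chunkExpr v p) (.op .mod (.var p) (.var 1))) (.lit 2)

/-- The directory gives the count before the chunk, and the table of bit counts gives the count
inside it after masking. Ranks are needed also at the end of the list, where there is no entry, so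
the claim about the bit is conditional on an entry being there. -/
theorem ev_rank (hE : Env Λ M) {o h a : ℕ} {l r : LTree n}
    (hN : LTree.NodeLaid Λ o M h a l r) (hnd : (LTree.node a l r).erase.leaves.Nodup) {σ : St}
    {v p j : ℕ} (h1 : σ.reg 1 = Λ.s) (hv : σ.reg v = a) (hp : σ.reg p = j)
    (hj : j ≤ (LTree.node a l r).erase.leaves.length) :
    Ev Λ.w M σ (rankExpr v p) ((LTree.node a l r).erase.rank Λ.b r.erase j) ∧
    ∃ x, Ev Λ.w M σ (bitExpr v p) x ∧ ∀ i,
      ((LTree.node a l r).erase.bottomList Λ.b)[j]? = some i →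
        (x = 1 ↔ i ∈ r.erase.leaves) ∧ x < 2 := by
  obtain ⟨-, -, -, -, -, ⟨rp, h5, hR⟩, -⟩ := hN
  obtain ⟨c, x, hc, hx, hcx, hbit⟩ := hR j hj
  have hs := hE.valid.s_pos
  have hsmall := hE.valid.small
  have ha1 := hE.addr_lt hc
  have ha2 := hE.addr_lt hx
  have hmod := Nat.mod_lt j hs
  have ep : Ev Λ.w M σ (.ld (.var v) (.lit 5)) rp := .ld (.var' hv) (hE.lit (by norm_num)) h5
  have ed : Ev Λ.w M σ (.op .div (.var p) (.var 1)) (j / Λ.s) :=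
    .op (.var' hp) (.var' h1) trivial
  have em : Ev Λ.w M σ (.op .mod (.var p) (.var 1)) (j % Λ.s) :=
    .op (.var' hp) (.var' h1) trivial
  have e2 : Ev Λ.w M σ (.op .mul (.lit 2) (.op .div (.var p) (.var 1))) (2 * (j / Λ.s)) :=
    .op (hE.lit (by norm_num)) ed (show 2 * (j / Λ.s) < 2 ^ Λ.w by omega)
  have ex : Ev Λ.w M σ (chunkExpr v p) x :=
    .ld ep (.op e2 (hE.lit (by norm_num)) (show 2 * (j / Λ.s) + 1 < 2 ^ Λ.w by omega)) hx
  have hlen := length_leaves_le hnd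
  refine ⟨?_, x / 2 ^ (j % Λ.s) % 2, ?_, fun i hi => ⟨hbit i hi, Nat.mod_lt _ (by norm_num)⟩⟩
  · rw [← hcx]
    have hpop : M[2 + x % 2 ^ (j % Λ.s)]? = some (popCount Λ.s (x % 2 ^ (j % Λ.s))) :=
      hE.pop _ ((Nat.mod_lt _ (by positivity)).trans
        (Nat.pow_lt_pow_right (by norm_num) hmod))
    have em' : Ev Λ.w M σ (.op .mod (chunkExpr v p)
        (.op .shl (.lit 1) (.op .mod (.var p) (.var 1)))) (x % 2 ^ (j % Λ.s)) := by
      have := Ev.op (o := .mod) ex (Ev.op (o := .shl) (hE.lit (σ := σ) (show 1 < 16 by norm_num)) em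
        (hE.two_pow_lt hmod)) trivial
      simpa [BinOp.nat] using this
    refine Ev.op (o := .add) (.ld ep e2 hc) (.ld (hE.lit (by norm_num)) em' hpop) ?_
    show c + _ < _
    rw [hcx]
    exact (RangeTree.rank_le _ _ _ _).trans_lt (by omega)
  · exact .op (.op ex em trivial) (hE.lit (by norm_num)) trivial

/-- Every entry belongs to exactly one child, so it is enough to store the ranks for the right
child. -/
theorem rank_left_eq {l r : RangeTree n} (hnd : (RangeTree.node l r).leaves.Nodup) (j : ℕ)
    (hj : j ≤ (RangeTree.node l r).leaves.length) :
    (RangeTree.node l r).rank Λ.b l j = j - (RangeTree.node l r).rank Λ.b r j := by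
  have h := List.length_eq_countP_add_countP (p := fun i => decide (i ∈ r.leaves))
    (l := ((RangeTree.node l r).bottomList Λ.b).take j)
  rw [List.length_take, RangeTree.length_bottomList, min_eq_left hj] at h
  have h2 : (((RangeTree.node l r).bottomList Λ.b).take j).countP (fun i => decide (i ∈ l.leaves)) =
      (((RangeTree.node l r).bottomList Λ.b).take j).countP
        (fun i => decide ¬ (decide (i ∈ r.leaves) = true)) := by
    refine List.countP_congr fun i hi => ?_
    have hi' := (RangeTree.mem_bottomList Λ.b).mp (List.mem_of_mem_take hi)
    rw [RangeTree.leaves, List.nodup_append] at hnd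
    rw [RangeTree.leaves, List.mem_append] at hi'
    simp only [decide_eq_true_eq]
    exact ⟨fun h h' => hnd.2.2 i h i h' rfl, fun h => hi'.resolve_right h⟩
  rw [RangeTree.rank, RangeTree.rank, h2]
  omega

/-- One step of the search for the leaf of an entry: from the node in variable `23` and the
position in variable `24` to a descendant. -/
def decodeStep : Stmt :=
  .seq (.assign 26 (.ld (.var 23) (.lit 6)))
  (.seq (.ite (.lit 0) (.var 26)
    (.seq (.assign 27 (.ld (.var 23) (.lit 7)))
    (.seq (.assign 28 (.op .mod (.op .shr (.ld (.ld (.var 23) (.lit 12)) (.op .div (.var 24) (.var 27)))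
      (.op .mul (.var 26) (.op .mod (.var 24) (.var 27)))) (.op .shl (.lit 1) (.var 26))))
    (.seq (.assign 29 (.ld (.var 23) (.lit 8)))
    (.seq (.assign 30 (.op .div (.var 28) (.var 29)))
    (.seq (.assign 24 (.op .add (.ld (.ld (.var 23) (.lit 11))
      (.op .add (.op .mul (.op .div (.var 24) (.var 29)) (.ld (.var 23) (.lit 9))) (.var 30)))
      (.op .mod (.var 28) (.var 29))))
    (.assign 23 (.ld (.ld (.var 23) (.lit 10)) (.var 30))))))))
    (.seq (.assign 28 (rankExpr 23 24))
    (.ite (.lit 0) (bitExpr 23 24)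
      (.seq (.assign 24 (.var 28)) (.assign 23 (.ld (.var 23) (.lit 2))))
      (.seq (.assign 24 (.op .sub (.var 24) (.var 28))) (.assign 23 (.ld (.var 23) (.lit 1)))))))
  (.assign 25 (.ld (.var 23) (.lit 0))))

/-- The tag of a range tree node. -/
def LTree.tag : LTree n → ℕ
  | .leaf _ _ => 1
  | .node _ _ _ => 2

theorem LTree.Laid.getElem?_tag {o h : ℕ} {T : LTree n} (hT : T.Laid Λ o M h) :
    M[T.addr + 0]? = some T.tag := by
  cases T with
  | leaf a i => exact hT.1
  | node a l r => exact hT.1.1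

/-- The word at offset `6` decides between one level by the rank directory and `Λ.d h` levels by the
jump tables; either way the height index falls by `Λ.d h`. The strict decrease of the number of
leaves is recorded because the truncated height index cannot fall below `0`. -/
theorem decodeStep_spec (hE : Env Λ M) {coords : List (WithTop ℝ)} {o h a j : ℕ} {l r : LTree n}
    {i : Fin n} (hT : (LTree.node a l r).Laid Λ o M h) (hB : (LTree.node a l r).erase.Bal h)
    (hh : h ≤ Λ.s)
    (hnd : (LTree.node a l r).erase.leaves.Nodup) (σ : St) (h1 : σ.reg 1 = Λ.s)
    (h23 : σ.reg 23 = a) (h24 : σ.reg 24 = j)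
    (hj : ((LTree.node a l r).erase.bottomList Λ.b)[j]? = some i) :
    WP Λ.w M coords decodeStep σ fun t σ' => t ≤ 80 ∧ Post 23 σ σ' 0 [] ∧
      ∃ (u : LTree n) (j' : ℕ), u.Laid Λ o M (h - Λ.d h) ∧ u.erase.Bal (h - Λ.d h) ∧
        u.erase.leaves.Nodup ∧ σ'.reg 23 = u.addr ∧ σ'.reg 24 = j' ∧ σ'.reg 25 = u.tag ∧
        (u.erase.bottomList Λ.b)[j']? = some i ∧ u.erase.leaves.length <
          (LTree.node a l r).erase.leaves.length := by
  have hlt := (List.getElem?_eq_some_iff.mp hj).1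
  rw [RangeTree.length_bottomList] at hlt
  have hmem : i ∈ (LTree.node a l r).erase.leaves :=
    (RangeTree.mem_bottomList Λ.b).mp (List.mem_of_getElem? hj)
  have hsmall := hE.valid.small
  have hN := hT.1
  obtain ⟨k0, k1, k2, -, -, -, hJ⟩ := hN
  have hlenadd : (LTree.node a l r).erase.leaves.length =
      l.erase.leaves.length + r.erase.leaves.length := by
    simp [LTree.erase, RangeTree.leaves]
  have hposl := hB.2.2.1.length_pos
  have hposr := hB.2.2.2.length_pos
  rcases hJ with ⟨hd1, k6⟩ | ⟨hd2, hd3, k6, k7, k8, k9, p₁, p₂, p₃, k10, k11, k12, hJ⟩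
  · refine WP.seq_assign (.ld (.var' h23) (hE.lit (by norm_num)) k6) ?_
    refine WP.seq (WP.ite (hE.lit (by norm_num)) (.var' rfl) (fun hc => ?_) fun _ => ?_)
    · simp at hc
    obtain ⟨er, -⟩ := ev_rank hE hT.1 hnd (σ := σ.set 26 0) (v := 23) (p := 24) (by simpa using h1)
      (by simpa using h23) (by simpa using h24) hlt.le
    refine WP.seq_assign er ?_
    set k := (LTree.node a l r).erase.rank Λ.b r.erase j with hk
    have hkj : k ≤ j := RangeTree.rank_le _ _ _ _
    obtain ⟨-, x, ex, hx⟩ := ev_rank hE hT.1 hnd (σ := (σ.set 26 0).set 28 k) (v := 23) (p := 24)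
      (by simpa using h1) (by simpa using h23) (by simpa using h24) hlt.le
    obtain ⟨hxi, hx2⟩ := hx i hj
    refine WP.ite (hE.lit (by norm_num)) ex (fun hc => ?_) fun hc => ?_
    · have hir : i ∈ r.erase.leaves := hxi.mp (by omega)
      refine WP.seq_assign (.var' rfl) ?_
      refine WP.assign (.ld (.var' (by simpa using h23)) (hE.lit (by norm_num)) k2) ?_
      refine WP.assign (.ld (.var' rfl) (hE.lit (by norm_num))
        (by simpa using hT.2.2.getElem?_tag)) ?_
      refine ⟨by simp [rankExpr, bitExpr, chunkExpr], ?_, r, k, ?_, ?_, ?_, by simp, by simp,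
        by simp, ?_, by omega⟩
      · exact (((((Post.refl.set (by norm_num) (by norm_num) _).set (by norm_num) (by norm_num)
          _).set (by norm_num) (by norm_num) _).set (by norm_num) (by norm_num) _).set (by norm_num)
          (by norm_num) _)
      · rw [hd1]; exact hT.2.2
      · rw [hd1]; exact hB.2.2.2
      · rw [LTree.erase, RangeTree.leaves, List.nodup_append] at hnd; exact hnd.2.1
      · exact RangeTree.getElem?_rank Λ.b (filter_leaves_right hnd) hj hir
    · have hil : i ∈ l.erase.leaves := by
        have : i ∉ r.erase.leaves := fun h => by have := hxi.mpr h; omega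
        rw [LTree.erase, RangeTree.leaves, List.mem_append] at hmem
        exact hmem.resolve_right this
      refine WP.seq_assign (.op (.var' (by simpa using h24)) (.var' rfl)
        (show _ ≤ j by simpa using hkj)) ?_
      refine WP.assign (.ld (.var' (by simpa using h23)) (hE.lit (by norm_num)) k1) ?_
      refine WP.assign (.ld (.var' rfl) (hE.lit (by norm_num))
        (by simpa using hT.2.1.getElem?_tag)) ?_
      refine ⟨by simp [rankExpr, bitExpr, chunkExpr], ?_, l, j - k, ?_, ?_, ?_, by simp,
        by simp [BinOp.nat], by simp, ?_, by omega⟩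
      · exact (((((Post.refl.set (by norm_num) (by norm_num) _).set (by norm_num) (by norm_num)
          _).set (by norm_num) (by norm_num) _).set (by norm_num) (by norm_num) _).set (by norm_num)
          (by norm_num) _)
      · rw [hd1]; exact hT.2.1
      · rw [hd1]; exact hB.2.2.1
      · rw [LTree.erase, RangeTree.leaves, List.nodup_append] at hnd; exact hnd.1
      · rw [hk, LTree.erase, ← rank_left_eq hnd j hlt.le]
        exact RangeTree.getElem?_rank Λ.b (filter_leaves_left hnd) hj hil
  · set d := Λ.d h with hd
    set f := Λ.s / (3 * d) with hf
    obtain ⟨c, off, x, y, u, hu, hiu, hcu, hfx, hfield, hoff, hy, hyo⟩ := hJ j i hj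
    have hf0 : 0 < f := Nat.div_pos (by omega) (by omega)
    have hsw := hE.valid.s_le
    have hww : Λ.w < 2 ^ Λ.w := Nat.lt_two_pow_self
    have hfs : 3 * d * f ≤ Λ.s := Nat.mul_div_le _ _
    have hjf := Nat.mod_lt j hf0
    have hg1 : 3 * d * (j % f) ≤ 3 * d * f := Nat.mul_le_mul_left _ hjf.le
    have hg2 : 1 * 2 ^ (3 * d) < 2 ^ Λ.w := by
      have h3s : 3 * d ≤ Λ.s := by omega
      rw [one_mul]
      have h1 : 2 ^ (3 * d) ≤ 2 ^ Λ.s := Nat.pow_le_pow_right (by norm_num) h3s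
      have h2 := hE.valid.two_pow_le
      omega
    have haddr := hE.addr_lt hy
    -- Since `off < 2 ^ (2 * d)`, quotient and remainder by `2 ^ (2 * d)` separate the two parts of
    -- a field.
    have hdiv : (c * 2 ^ (2 * d) + off) / 2 ^ (2 * d) = c := by
      rw [Nat.add_comm, Nat.add_mul_div_right _ _ (by positivity), Nat.div_eq_of_lt hoff,
        Nat.zero_add]
    have hmod : (c * 2 ^ (2 * d) + off) % 2 ^ (2 * d) = off := by
      rw [Nat.add_comm, Nat.add_mul_mod_self_right, Nat.mod_eq_of_lt hoff]
    have huL := hT.of_mem_desc Λ hu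
    have hrk : (LTree.node a l r).erase.rank Λ.b u.erase j ≤ j := RangeTree.rank_le _ _ _ _
    have hlen := length_leaves_le hnd
    refine WP.seq_assign (.ld (.var' h23) (hE.lit (by norm_num)) k6) ?_
    refine WP.seq (WP.ite (hE.lit (by norm_num)) (.var' rfl) (fun _ => ?_) fun hc => ?_)
    swap
    · simp at hc; omega
    refine WP.seq_assign (.ld (.var' (by simpa using h23)) (hE.lit (by norm_num)) k7) ?_
    refine WP.seq_assign (v := c * 2 ^ (2 * d) + off) ?_ ?_
    · have := Ev.op (w := Λ.w) (M := M) (σ := (σ.set 26 (3 * d)).set 27 f) (o := .mod)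
        (.op (o := .shr) (.ld (.ld (.var' (r := 23) (by simpa using h23)) (hE.lit (by norm_num)) k12)
          (.op (o := .div) (.var' (r := 24) (by simpa using h24)) (.var' (r := 27) (by simp)) trivial)
            hfx)
          (.op (o := .mul) (.var' (r := 26) (v := 3 * d) (by simp))
            (.op (o := .mod) (.var' (r := 24) (v := j) (by simpa using h24))
              (.var' (r := 27) (v := f) (by simp)) trivial)
            (show 3 * d * (j % f) < 2 ^ Λ.w by omega)) trivial)
        (.op (o := .shl) (hE.lit (show 1 < 16 by norm_num))
          (.var' (r := 26) (v := 3 * d) (by simp)) hg2) trivial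
      rw [← hfield]
      simpa [BinOp.nat] using this
    refine WP.seq_assign (.ld (.var' (by simpa using h23)) (hE.lit (by norm_num)) k8) ?_
    refine WP.seq_assign (v := c) ?_ ?_
    · have := Ev.op (w := Λ.w) (M := M) (o := .div) (σ := ((((σ.set 26 (3 * d)).set 27 f).set 28
        (c * 2 ^ (2 * d) + off)).set 29 (2 ^ (2 * d)))) (.var' (r := 28) (by simp; rfl))
        (.var' (r := 29) (by simp; rfl)) trivial
      simpa only [BinOp.nat, hdiv] using this
    refine WP.seq_assign (v := (LTree.node a l r).erase.rank Λ.b u.erase j) ?_ ?_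
    · rw [← hyo]
      refine .op (.ld (.ld (.var' (by simpa using h23)) (hE.lit (by norm_num)) k11)
        (.op (o := .add) (v₁ := j / 2 ^ (2 * d) * 2 ^ d) (v₂ := c)
          (.op (o := .mul) (.op (o := .div) (.var' (by simpa using h24)) (.var' (by simp)) trivial)
            (.ld (.var' (by simpa using h23)) (hE.lit (by norm_num)) k9) ?_) (.var' (by simp)) ?_)
        hy) (v₂ := off) ?_ ?_
      · show j / 2 ^ (2 * d) * 2 ^ d < _; omega
      · show j / 2 ^ (2 * d) * 2 ^ d + c < _; omega
      · have := Ev.op (w := Λ.w) (M := M) (o := .mod) (σ := ((((σ.set 26 (3 * d)).set 27 f).set 28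
          (c * 2 ^ (2 * d) + off)).set 29 (2 ^ (2 * d))).set 30 c) (.var' (r := 28) (by simp; rfl))
          (.var' (r := 29) (by simp; rfl)) trivial
        simpa only [BinOp.nat, hmod] using this
      · show y + off < _; omega
    refine WP.assign (.ld (.ld (.var' (by simpa using h23)) (hE.lit (by norm_num)) k10)
      (.var' (by simp)) hcu) ?_
    refine WP.assign (.ld (.var' rfl) (hE.lit (by norm_num)) (by simpa using huL.getElem?_tag)) ?_
    refine ⟨by simp, ?_, u, _, huL, LTree.bal_of_mem_desc hB hu, ?_, by simp, by simp,
      by simp, RangeTree.getElem?_rank Λ.b (LTree.filter_leaves_of_mem_desc hnd hu) hj hiu, ?_⟩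
    · exact ((((((((Post.refl.set (by norm_num) (by norm_num) _).set (by norm_num) (by norm_num)
          _).set (by norm_num) (by norm_num) _).set (by norm_num) (by norm_num) _).set (by norm_num)
          (by norm_num) _).set (by norm_num) (by norm_num) _).set (by norm_num) (by norm_num)
          _).set (by norm_num) (by norm_num) _)
    · rw [← LTree.filter_leaves_of_mem_desc hnd hu]; exact hnd.filter _
    · obtain ⟨k, hk⟩ : ∃ k, d = k + 1 := ⟨d - 1, by omega⟩
      rw [hk] at hu
      rcases List.mem_append.mp hu with hu | hu
      · have : u.erase.leaves.length ≤ l.erase.leaves.length := by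
          rw [← LTree.filter_leaves_of_mem_desc (T := l) ?_ hu]
          · exact List.length_filter_le _ _
          · rw [LTree.erase, RangeTree.leaves, List.nodup_append] at hnd; exact hnd.1
        omega
      · have : u.erase.leaves.length ≤ r.erase.leaves.length := by
          rw [← LTree.filter_leaves_of_mem_desc (T := r) ?_ hu]
          · exact List.length_filter_le _ _
          · rw [LTree.erase, RangeTree.leaves, List.nodup_append] at hnd; exact hnd.2.1
        omega

end Programs

end

end Stabbing

namespace Stabbing

noncomputable section

section Programs

variable {n : ℕ} {Λ : Layout n} {M : List ℕ} {coords : List (WithTop ℝ)}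

/-! ### Visiting a node -/

theorem decode_leaf (hE : Env Λ M) {o h j : ℕ} {T : LTree n} {i i' : Fin n}
    (hT : T.Laid Λ o M h) (hl : T.erase = .leaf i') (σ : St) (h23 : σ.reg 23 = T.addr)
    (h25 : σ.reg 25 = T.tag) (hj : (T.erase.bottomList Λ.b)[j]? = some i) :
    WP Λ.w M coords (.whil (.lit 1) (.var 25) decodeStep) σ fun t σ' => t ≤ 4 ∧ Post 23 σ σ' 0 [] ∧
      M[σ'.reg 23 + 1]? = some (i : ℕ) := by
  cases T with
  | node a l r => cases hl
  | leaf a i₀ =>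
    have hi : i₀ = i := by
      have := (RangeTree.mem_bottomList Λ.b).mp (List.mem_of_getElem? hj)
      simpa [LTree.erase, RangeTree.leaves, eq_comm] using this
    subst hi
    refine WP.whil_false (hE.lit (by norm_num)) (.var' h25) (by simp [LTree.tag])
      ⟨by simp, Post.refl, ?_⟩
    rw [h23]; exact hT.2

/-- Each iteration costs at most `80 + 4` steps and makes one jump of the schedule. The `+ 1` is for
a node with two leaves at height index `0`, which the schedule does not see. -/
theorem decode_spec (hE : Env Λ M) {o h j : ℕ} {T : LTree n} {i : Fin n}
    (hT : T.Laid Λ o M h) (hB : T.erase.Bal h) (hh : h ≤ Λ.s) (hnd : T.erase.leaves.Nodup) (σ : St)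
    (h1 : σ.reg 1 = Λ.s) (h23 : σ.reg 23 = T.addr) (h24 : σ.reg 24 = j)
    (h25 : σ.reg 25 = T.tag) (hj : (T.erase.bottomList Λ.b)[j]? = some i) :
    WP Λ.w M coords (.whil (.lit 1) (.var 25) decodeStep) σ fun t σ' =>
      t ≤ 84 * (jumpSteps Λ.d h + 1) + 4 ∧ Post 23 σ σ' 0 [] ∧
      M[σ'.reg 23 + 1]? = some (i : ℕ) := by
  induction h using Nat.strong_induction_on generalizing T j σ with
  | _ h ih =>
    cases hT' : T with
    | leaf a i' =>
      subst hT'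
      exact (decode_leaf hE hT rfl σ h23 h25 hj).mono fun t σ' h => ⟨by omega, h.2⟩
    | node a l r =>
      subst hT'
      refine WP.whil_true (hE.lit (by norm_num)) (.var' h25) (by simp [LTree.tag]) ?_
      refine (decodeStep_spec hE hT hB hh hnd σ h1 h23 h24 hj).mono ?_
      rintro t σ' ⟨ht, hP, u, j', huL, huB, hund, hu23, hu24, hu25, huj, hlen⟩
      rcases Nat.eq_zero_or_pos h with rfl | hpos
      · obtain ⟨i', hi'⟩ := huB.eq_leaf (by have := hB.2.1; rw [LTree.erase] at hlen; omega)
        refine (decode_leaf hE huL hi' σ' hu23 hu25 huj).mono ?_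
        rintro t' σ'' ⟨ht', hP', hM'⟩
        refine ⟨?_, by simpa using hP.trans hP', hM'⟩
        simp only [Expr.cost]; omega
      · have hd : 0 < Λ.d h := by rcases hE.valid.jump h with h | h <;> omega
        refine (ih (h - Λ.d h) (by omega) huL huB (by omega) hund σ'
          ((hP.reg 1 (by norm_num) (by norm_num)).trans h1) hu23 hu24 hu25 huj).mono ?_
        rintro t' σ'' ⟨ht', hP', hM'⟩
        refine ⟨?_, by simpa using hP.trans hP', hM'⟩
        rw [jumpSteps_eq Λ.d hpos hd]
        simp only [Expr.cost]; omega

/-- What a program does at a visited node: the increase of the counter, the output, and a bound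
on the time. -/
structure Visitor (n : ℕ) where
  add : RangeTree n → ℕ
  outs : RangeTree n → List ℕ
  time : RangeTree n → ℕ

/-- From `σ`, the nodes in `L` have been visited, with `K` further steps, and the variables
below `k` are unchanged. -/
def Visitor.Done (V : Visitor n) (k : ℕ) (σ : St) (L : List (RangeTree n)) (K t : ℕ) (σ' : St) :
    Prop :=
  t ≤ K + (L.map V.time).sum ∧ Post k σ σ' (L.map V.add).sum (L.flatMap V.outs)

theorem Visitor.Done.trans {V : Visitor n} {k K K' t t' : ℕ} {σ σ' σ'' : St}
    {L L' : List (RangeTree n)} (h : V.Done k σ L K t σ') (h' : V.Done k σ' L' K' t' σ'') :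
    V.Done k σ (L ++ L') (K + K') (t + t') σ'' := by
  refine ⟨?_, ?_⟩
  · rw [List.map_append, List.sum_append]; have := h.1; have := h'.1; omega
  · rw [List.map_append, List.sum_append, List.flatMap_append]; exact h.2.trans h'.2

theorem Visitor.Done.acc_lt {V : Visitor n} {k K t N : ℕ} {σ σ' : St}
    {L L' : List (RangeTree n)} (h : V.Done k σ L K t σ')
    (hN : σ.reg 2 + ((L ++ L').map V.add).sum < N) : σ'.reg 2 + (L'.map V.add).sum < N := by
  rw [h.2.acc]; rw [List.map_append, List.sum_append] at hN; omega

/-- The program `vs` visits the node in variable `20`, given in variable `21` the number of boxes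
below it whose `x`-range contains `x`. -/
def VisitSpec (Λ : Layout n) (M : List ℕ) (coords : List (WithTop ℝ)) (x : ℝ) (vs : Stmt)
    (V : Visitor n) : Prop :=
  ∀ (σ : St) (o h : ℕ) (T : LTree n), T.Laid Λ o M h → T.erase.Bal h → h ≤ Λ.s →
    T.erase.leaves.Nodup → σ.reg 1 = Λ.s → σ.reg 20 = T.addr → σ.reg 21 = T.erase.count Λ.b x →
    σ.reg 2 + V.add T.erase < 2 ^ Λ.w →
    WP Λ.w M coords vs σ fun t σ' => t ≤ V.time T.erase ∧ Post 20 σ σ' (V.add T.erase)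
      (V.outs T.erase)

/-- Add the number of boxes to the counter. -/
def countVisit : Stmt := .assign 2 (.op .add (.var 2) (.var 21))

def countVisitor (b : Fin n → CanonicalBox) (x : ℝ) : Visitor n where
  add v := v.count b x
  outs _ := []
  time _ := 4

theorem countVisit_spec (x : ℝ) : VisitSpec Λ M coords x countVisit (countVisitor Λ.b x) := by
  intro σ o h T hT hB hh hnd h1 h20 h21 hacc
  refine WP.assign (.op (.var' rfl) (.var' h21) hacc) ⟨by simp [countVisitor], ?_⟩
  refine ⟨fun r hr hr2 => by simp [hr2], fun _ _ => rfl, by simp [BinOp.nat, countVisitor], ?_⟩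
  simp [countVisitor]

/-- Output the prefix of the bottom list. -/
def reportVisit : Stmt :=
  .seq (.assign 22 (.lit 0)) (.whil (.var 22) (.var 21)
    (.seq (.assign 23 (.var 20)) (.seq (.assign 24 (.var 22))
    (.seq (.assign 25 (.ld (.var 23) (.lit 0))) (.seq (.whil (.lit 1) (.var 25) decodeStep)
    (.seq (.outp (.ld (.var 23) (.lit 1)))
    (.assign 22 (.op .add (.var 22) (.lit 1)))))))))

def reportVisitor (b : Fin n → CanonicalBox) (x : ℝ) (J : ℕ) : Visitor n where
  add _ := 0
  outs v := (v.piece b x).map Fin.val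
  time v := 6 + v.count b x * (84 * J + 110)

/-- The entries to be output are the first `count` entries of the bottom list. Each of them is
decoded separately, starting from the visited node. -/
theorem reportVisit_spec (hE : Env Λ M) (x : ℝ) {J : ℕ} (hJ : ∀ h ≤ Λ.s, jumpSteps Λ.d h ≤ J) :
    VisitSpec Λ M coords x reportVisit (reportVisitor Λ.b x J) := by
  intro σ o h T hT hB hh hnd h1 h20 h21 _
  set k := T.erase.count Λ.b x with hk
  have hkn : k ≤ n := (T.erase.count_le Λ.b x).trans (length_leaves_le hnd)
  have hsmall := hE.valid.small
  refine WP.seq_assign (hE.lit (by norm_num)) ?_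
  -- The induction is on the number `m` of entries still to be output, with the position `p` of the
  -- next one free.
  suffices H : ∀ m p (σ' : St), p + m = k → σ'.reg 1 = Λ.s → σ'.reg 20 = T.addr →
      σ'.reg 21 = k → σ'.reg 22 = p → WP Λ.w M coords (.whil (.var 22) (.var 21)
    (.seq (.assign 23 (.var 20)) (.seq (.assign 24 (.var 22))
    (.seq (.assign 25 (.ld (.var 23) (.lit 0))) (.seq (.whil (.lit 1) (.var 25) decodeStep)
    (.seq (.outp (.ld (.var 23) (.lit 1)))
    (.assign 22 (.op .add (.var 22) (.lit 1))))))))) σ' fun t σ'' =>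
      t ≤ 4 + m * (84 * J + 110) ∧
        Post 20 σ' σ'' 0 (((T.erase.piece Λ.b x).drop p).map Fin.val) by
    have hP := (Post.refl (k := 20) (σ := σ)).set (r := 22) (by norm_num) (by norm_num) 0
    refine (H k 0 _ (by omega) (by simpa using h1) (by simpa using h20)
      (by simpa using h21) (by simp)).mono ?_
    rintro t σ' ⟨ht, hP'⟩
    refine ⟨by simp only [Expr.cost, reportVisitor, ← hk]; omega, ?_⟩
    simpa [reportVisitor] using hP.trans hP'
  intro m
  induction m with
  | zero =>
    intro p σ' hp h1 h20 h21 h22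
    refine WP.whil_false (.var' h22) (.var' h21) (by omega) ⟨by simp, ?_⟩
    rw [List.drop_of_length_le (by rw [RangeTree.length_piece]; omega)]
    exact Post.refl
  | succ m ih =>
    intro p σ' hp h1 h20 h21 h22
    have hlen : (T.erase.piece Λ.b x).length = k := T.erase.length_piece Λ.b x
    obtain ⟨i, hi⟩ : ∃ i, (T.erase.piece Λ.b x)[p]? = some i :=
      ⟨_, List.getElem?_eq_getElem (by omega)⟩
    have hi' : (T.erase.bottomList Λ.b)[p]? = some i := by
      rw [RangeTree.piece, List.getElem?_take_of_lt (by omega)] at hi; exact hi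
    refine WP.whil_true (.var' h22) (.var' h21) (by omega) ?_
    refine WP.seq_assign (.var' h20) ?_
    refine WP.seq_assign (.var' (by simpa using h22)) ?_
    refine WP.seq_assign (.ld (.var' rfl) (hE.lit (by norm_num)) (by simpa using hT.getElem?_tag)) ?_
    refine WP.seq ((decode_spec hE hT hB hh hnd _ ?_ (by simp) (by simp) (by simp) hi').mono ?_)
    · simpa using h1
    rintro t₁ σ₁ ⟨ht₁, hP₁, hM₁⟩
    have hP₁' := (((Post.refl (k := 20) (σ := σ')).set (r := 23) (by norm_num) (by norm_num)
      T.addr).set (r := 24) (by norm_num) (by norm_num) p).set (r := 25) (by norm_num)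
      (by norm_num) T.tag |>.trans (hP₁.mono (by norm_num))
    have e20 := hP₁.reg 20 (by norm_num) (by norm_num)
    have e21 := hP₁.reg 21 (by norm_num) (by norm_num)
    have e22 := hP₁.reg 22 (by norm_num) (by norm_num)
    simp only [St.reg_set] at e20 e21 e22
    refine WP.seq (WP.outp (.ld (.var' rfl) (hE.lit (by norm_num)) hM₁) ?_)
    refine WP.assign (.op (.var' (v := p) (by simpa [h22] using e22)) (hE.lit (by norm_num))
      (show p + 1 < _ by omega)) ?_
    have hP₂ := (hP₁'.emit (i : ℕ)).set (r := 22) (by norm_num) (by norm_num) (BinOp.add.nat p 1)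
    refine (ih (p + 1) _ (by omega) ?_ ?_ ?_ (by simp [BinOp.nat])).mono ?_
    · simpa using (hP₂.reg 1 (by norm_num) (by norm_num)).trans h1
    · simpa [h20] using e20
    · simpa [h21] using e21
    rintro t₂ σ₂ ⟨ht₂, hP₃⟩
    have hd := hJ h hh
    refine ⟨?_, ?_⟩
    · rw [Nat.succ_mul]; simp only [Expr.cost]; omega
    · have hdrop : (T.erase.piece Λ.b x).drop p = i :: (T.erase.piece Λ.b x).drop (p + 1) := by
        rw [← List.getElem_cons_drop (by omega)]
        congr 1
        exact (List.getElem?_eq_some_iff.mp hi).2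
      rw [hdrop]
      simpa using hP₂.trans hP₃

end Programs

end

end Stabbing

namespace Stabbing

noncomputable section

section Programs

variable {n : ℕ} {Λ : Layout n} {M : List ℕ} {coords : List (WithTop ℝ)}

/-! ### Searching a range tree -/

/-- Visit the node with address `e₁` and count `e₂` if `c` holds. -/
def visitIf (c : Bool) (e₁ e₂ : Expr) (vs : Stmt) : Stmt :=
  if c then .seq (.assign 20 e₁) (.seq (.assign 21 e₂) vs) else .skip

theorem visitIf_spec {x : ℝ} {vs : Stmt} {V : Visitor n} (hV : VisitSpec Λ M coords x vs V)
    (c : Bool) {e₁ e₂ : Expr} {o h : ℕ} {T : LTree n} (hT : T.Laid Λ o M h) (hB : T.erase.Bal h)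
    (hh : h ≤ Λ.s) (hnd : T.erase.leaves.Nodup) {σ : St} (h1 : σ.reg 1 = Λ.s)
    (he₁ : Ev Λ.w M σ e₁ T.addr) (he₂ : Ev Λ.w M (σ.set 20 T.addr) e₂ (T.erase.count Λ.b x))
    (hacc : σ.reg 2 + ((if c then [T.erase] else []).map V.add).sum < 2 ^ Λ.w) :
    WP Λ.w M coords (visitIf c e₁ e₂ vs) σ
      (V.Done 20 σ (if c then [T.erase] else []) (e₁.cost + e₂.cost + 2)) := by
  cases c with
  | false => exact WP.skip ⟨by simp, by simpa using Post.refl⟩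
  | true =>
    refine WP.seq_assign he₁ (WP.seq_assign he₂ ((hV _ o h T hT hB hh hnd ?_ ?_ ?_ ?_).mono ?_))
    · simpa using h1
    · simp
    · simp
    · simpa using hacc
    · rintro t σ' ⟨ht, hP⟩
      refine ⟨by simp; omega, ?_⟩
      have := (((Post.refl (k := 20) (σ := σ)).set (r := 20) (by norm_num) (by norm_num)
        T.addr).set (r := 21) (by norm_num) (by norm_num) _).trans hP
      simpa using this

/-- One level of the search in a range tree, from the internal node in variable `10` with the
count in variable `11`. -/
def walkStep (up : Bool) (vs : Stmt) : Stmt :=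
  .seq (.getC 3 (.ld (.var 10) (.lit 4)))
  (.seq (.assign 15 (rankExpr 10 11))
  (.seq (.assign 16 (.op .sub (.var 11) (.var 15)))
  (.seq (.cite 1 3
    (.seq (visitIf up (.ld (.var 10) (.lit 2)) (.var 15) vs)
      (.seq (.assign 11 (.var 16)) (.assign 10 (.ld (.var 10) (.lit 1)))))
    (.seq (visitIf (!up) (.ld (.var 10) (.lit 1)) (.var 16) vs)
      (.seq (.assign 11 (.var 15)) (.assign 10 (.ld (.var 10) (.lit 2))))))
  (.assign 12 (.ld (.var 10) (.lit 0))))))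

/-- The end of the search in a range tree. -/
def walkLeaf (up : Bool) (o : ℕ) (vs : Stmt) : Stmt :=
  .ite (.lit 0) (.var 12)
    (.seq (.getC 3 (.op .add (.op .mul (.lit 5) (.ld (.var 10) (.lit 1))) (.lit o)))
    (.cite 1 3 (visitIf up (.var 10) (.var 11) vs) (visitIf (!up) (.var 10) (.var 11) vs))) .skip

/-- Isolates the subtree visited at this level as a list with at most one element, in the form in
which `visitIf` is specified. -/
theorem canon_node (key : Fin n → WithTop ℝ) (y : WithTop ℝ) (up : Bool) (l r : RangeTree n) :
    (RangeTree.node l r).canon key y up = if y < r.firstKey key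
      then (if up then [r] else []) ++ l.canon key y up
      else (if !up then [l] else []) ++ r.canon key y up := by
  rw [RangeTree.canon]; cases up <;> simp

theorem canon_leaf (key : Fin n → WithTop ℝ) (y : WithTop ℝ) (up : Bool) (i : Fin n) :
    (RangeTree.leaf i).canon key y up = if y < key i
      then (if up then [.leaf i] else []) else (if !up then [.leaf i] else []) := by
  rw [RangeTree.canon]; cases up <;> split_ifs <;> simp_all

/-- A single rank gives the prefix lengths of both children, the left one by subtraction. The
comparison of `y` with the first key on the right then selects the child to visit, if any, and the
child in which to continue. -/
theorem walkStep_spec (hE : Env Λ M) {x : ℝ} {vs : Stmt} {V : Visitor n}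
    (hV : VisitSpec Λ M (coordsOf Λ.b) x vs V) {o : ℕ} {key : Fin n → WithTop ℝ}
    (hkey : ∀ i : Fin n, (coordsOf Λ.b)[5 * (i : ℕ) + o]? = some (key i)) (y : WithTop ℝ)
    (up : Bool) {h a : ℕ} {l r : LTree n} (hT : (LTree.node a l r).Laid Λ o M h)
    (hB : (LTree.node a l r).erase.Bal h) (hh : h ≤ Λ.s)
    (hnd : (LTree.node a l r).erase.leaves.Nodup) (σ : St) (h1 : σ.reg 1 = Λ.s)
    (h10 : σ.reg 10 = a) (h11 : σ.reg 11 = (LTree.node a l r).erase.count Λ.b x)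
    (hy : σ.creg 1 = y)
    (hacc : σ.reg 2 + (((if y < r.erase.firstKey key then (if up then [r.erase] else [])
      else (if !up then [l.erase] else []) : List (RangeTree n))).map V.add).sum < 2 ^ Λ.w) :
    WP Λ.w M (coordsOf Λ.b) (walkStep up vs) σ fun t σ' =>
      V.Done 10 σ (if y < r.erase.firstKey key then (if up then [r.erase] else [])
        else (if !up then [l.erase] else [])) 90 t σ' ∧
      let u := if y < r.erase.firstKey key then l else r
      σ'.reg 10 = u.addr ∧ σ'.reg 11 = u.erase.count Λ.b x ∧ σ'.reg 12 = u.tag := by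
  have hN := hT.1
  obtain ⟨-, k1, k2, -, k4, -⟩ := hN
  have hle := (LTree.node a l r).erase.count_le Λ.b x
  have hndl : l.erase.leaves.Nodup := by
    rw [LTree.erase, RangeTree.leaves, List.nodup_append] at hnd; exact hnd.1
  have hndr : r.erase.leaves.Nodup := by
    rw [LTree.erase, RangeTree.leaves, List.nodup_append] at hnd; exact hnd.2.1
  have hsum : (LTree.node a l r).erase.count Λ.b x = l.erase.count Λ.b x + r.erase.count Λ.b x :=
    count_node ..
  refine WP.seq_getC (.ld (.var' h10) (hE.lit (by norm_num)) k4) (hkey r.first) ?_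
  rw [LTree.firstKey_erase] at hacc ⊢
  obtain ⟨er, -⟩ := ev_rank hE hT.1 hnd (σ := σ.setC 3 (key r.first)) (v := 10) (p := 11)
    (by simpa using h1) (by simpa using h10) (by simpa using h11) hle
  rw [show (LTree.node a l r).erase.rank Λ.b r.erase ((LTree.node a l r).erase.count Λ.b x) =
    r.erase.count Λ.b x from RangeTree.rank_count Λ.b x (filter_leaves_right hnd)] at er
  refine WP.seq_assign er ?_
  refine WP.seq_assign (.op (.var' (by simpa using h11)) (.var' (by simp; rfl))
    (show _ ≤ _ by omega)) ?_
  rw [show BinOp.sub.nat ((LTree.node a l r).erase.count Λ.b x) (r.erase.count Λ.b x) =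
    l.erase.count Λ.b x by rw [BinOp.nat, hsum]; omega]
  set σ₀ := ((σ.setC 3 (key r.first)).set 15 (r.erase.count Λ.b x)).set 16 (l.erase.count Λ.b x)
    with hσ₀
  have hP₀ : Post 10 σ σ₀ 0 [] := ((Post.refl.setC (by norm_num) _).set (by norm_num) (by norm_num)
    _).set (by norm_num) (by norm_num) _
  have c1 : σ₀.creg 1 = y := by simpa [σ₀] using hy
  have c3 : σ₀.creg 3 = key r.first := by simp [σ₀]
  have g1 : σ₀.reg 1 = Λ.s := by simpa [σ₀] using h1
  have g10 : σ₀.reg 10 = a := by simpa [σ₀] using h10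
  have g15 : σ₀.reg 15 = r.erase.count Λ.b x := by simp [σ₀]
  have g16 : σ₀.reg 16 = l.erase.count Λ.b x := by simp [σ₀]
  have g2 : σ₀.reg 2 = σ.reg 2 := by simp [σ₀]
  rw [← g2] at hacc
  -- A visit writes only to variables from `20` on and the step itself to variables from `10` on, so
  -- everything below `10` survives apart from the counter.
  have hfin : ∀ {L : List (RangeTree n)} {K t : ℕ} {σ₁ : St}, V.Done 20 σ₀ L K t σ₁ →
      ∀ v v' v'' t', t' + K ≤ 90 + t → V.Done 10 σ L 90 t' (((σ₁.set 11 v).set 10 v').set 12 v'') := by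
    intro L K t σ₁ hD v v' v'' t' ht'
    refine ⟨by have := hD.1; omega, ?_⟩
    have := hP₀.trans ((((hD.2.mono (k' := 10) (by norm_num)).set (r := 11) (by norm_num)
      (by norm_num) v).set (r := 10) (by norm_num) (by norm_num) v').set (r := 12) (by norm_num)
      (by norm_num) v'')
    simpa using this
  refine WP.seq (WP.cite (fun hc => ?_) fun hc => ?_)
  · rw [c1, c3] at hc
    simp only [if_pos hc] at hacc ⊢
    refine WP.seq ((visitIf_spec hV up hT.2.2 hB.2.2.2 (by omega) hndr g1 (.ld (.var' g10)
      (hE.lit (by norm_num)) k2) (.var' (by simpa using g15)) hacc).mono fun t σ₁ hD => ?_)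
    have e10 := hD.2.reg 10 (by norm_num) (by norm_num)
    have e16 := hD.2.reg 16 (by norm_num) (by norm_num)
    refine WP.seq_assign (.var' (e16.trans g16)) ?_
    refine WP.assign (.ld (.var' (by simpa using e10.trans g10)) (hE.lit (by norm_num)) k1) ?_
    refine WP.assign (.ld (.var' rfl) (hE.lit (by norm_num)) (by simpa using hT.2.1.getElem?_tag)) ?_
    exact ⟨hfin hD _ _ _ _ (by simp [rankExpr, chunkExpr]; omega), by simp, by simp, by simp⟩
  · rw [c1, c3] at hc
    simp only [if_neg hc] at hacc ⊢
    refine WP.seq ((visitIf_spec hV (!up) hT.2.1 hB.2.2.1 (by omega) hndl g1 (.ld (.var' g10)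
      (hE.lit (by norm_num)) k1) (.var' (by simpa using g16)) hacc).mono fun t σ₁ hD => ?_)
    have e10 := hD.2.reg 10 (by norm_num) (by norm_num)
    have e15 := hD.2.reg 15 (by norm_num) (by norm_num)
    refine WP.seq_assign (.var' (e15.trans g15)) ?_
    refine WP.assign (.ld (.var' (by simpa using e10.trans g10)) (hE.lit (by norm_num)) k2) ?_
    refine WP.assign (.ld (.var' rfl) (hE.lit (by norm_num)) (by simpa using hT.2.2.getElem?_tag)) ?_
    exact ⟨hfin hD _ _ _ _ (by simp [rankExpr, chunkExpr]; omega), by simp, by simp, by simp⟩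

/-- The loop stops at a leaf whose own key has not been tested yet, so loop and leaf test are
specified together. The budget is `100` steps per level, besides the time of the visits. -/
theorem walkLoop_spec (hE : Env Λ M) {x : ℝ} {vs : Stmt} {V : Visitor n}
    (hV : VisitSpec Λ M (coordsOf Λ.b) x vs V) {o : ℕ} (ho : o < 5) {key : Fin n → WithTop ℝ}
    (hkey : ∀ i : Fin n, (coordsOf Λ.b)[5 * (i : ℕ) + o]? = some (key i)) (y : WithTop ℝ)
    (up : Bool) {h : ℕ} {T : LTree n} (hT : T.Laid Λ o M h)
    (hB : T.erase.Bal h) (hh : h ≤ Λ.s) (hnd : T.erase.leaves.Nodup) (σ : St) (h1 : σ.reg 1 = Λ.s)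
    (h10 : σ.reg 10 = T.addr) (h11 : σ.reg 11 = T.erase.count Λ.b x) (h12 : σ.reg 12 = T.tag)
    (hy : σ.creg 1 = y)
    (hacc : σ.reg 2 + ((T.erase.canon key y up).map V.add).sum < 2 ^ Λ.w) :
    WP Λ.w M (coordsOf Λ.b)
      (.seq (.whil (.lit 1) (.var 12) (walkStep up vs)) (walkLeaf up o vs)) σ
      (V.Done 10 σ (T.erase.canon key y up) (100 * (T.erase.height + 1))) := by
  induction T generalizing h σ with
  | leaf a i =>
    have hsmall := hE.valid.small
    have hi := i.isLt
    refine WP.seq (WP.whil_false (hE.lit (by norm_num)) (.var' h12) (by simp [LTree.tag]) ?_)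
    refine WP.ite (hE.lit (by norm_num)) (.var' h12) (fun _ => ?_) fun hc => ?_
    swap
    · simp [LTree.tag] at hc
    refine WP.seq_getC (.op (.op (hE.lit (by norm_num)) (.ld (.var' h10) (hE.lit (by norm_num)) hT.2)
      (show 5 * (i : ℕ) < _ by omega)) (hE.lit (by omega))
      (show 5 * (i : ℕ) + o < _ by omega)) (hkey i) ?_
    have e : (LTree.leaf a i).erase.canon key y up = _ := canon_leaf key y up i
    rw [e] at hacc ⊢
    have hP₀ : Post 20 σ (σ.setC 3 (key i)) 0 [] := Post.refl.setC (by norm_num) _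
    have hfin : ∀ {L : List (RangeTree n)} {t : ℕ} {σ₁ : St},
        V.Done 20 (σ.setC 3 (key i)) L 4 t σ₁ → ∀ t' ≤ 40 + t,
        V.Done 10 σ L (100 * ((LTree.leaf a i).erase.height + 1)) t' σ₁ := by
      intro L t σ₁ hD t' ht'
      refine ⟨by have := hD.1; simp only [LTree.erase, RangeTree.height]; omega, ?_⟩
      simpa using (hP₀.trans hD.2).mono (k' := 10) (by norm_num)
    refine WP.cite (fun hc => ?_) fun hc => ?_
    · simp only [St.creg_setC, if_true, Nat.reduceEqDiff, if_false, hy] at hc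
      simp only [if_pos hc] at hacc ⊢
      refine (visitIf_spec hV up (T := .leaf a i) (σ := σ.setC 3 (key i)) hT hB hh hnd h1
        (.var' (r := 10) h10) (.var' (r := 11) (by simpa using h11)) hacc).mono fun t σ₁ hD => hfin hD _ ?_
      simp only [Expr.cost]; omega
    · simp only [St.creg_setC, if_true, Nat.reduceEqDiff, if_false, hy] at hc
      simp only [if_neg hc] at hacc ⊢
      refine (visitIf_spec hV (!up) (T := .leaf a i) (σ := σ.setC 3 (key i)) hT hB hh hnd h1
        (.var' (r := 10) h10) (.var' (r := 11) (by simpa using h11)) hacc).mono fun t σ₁ hD => hfin hD _ ?_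
      simp only [Expr.cost]; omega
  | node a l r ih₁ ih₂ =>
    have e : (LTree.node a l r).erase.canon key y up = _ := canon_node key y up l.erase r.erase
    rw [e] at hacc ⊢
    refine WP.whil_seq_true (hE.lit (by norm_num)) (.var' h12) (by simp [LTree.tag]) ?_
    have hndl : l.erase.leaves.Nodup := by
      rw [LTree.erase, RangeTree.leaves, List.nodup_append] at hnd; exact hnd.1
    have hndr : r.erase.leaves.Nodup := by
      rw [LTree.erase, RangeTree.leaves, List.nodup_append] at hnd; exact hnd.2.1
    by_cases hc : y < r.erase.firstKey key
    · simp only [if_pos hc] at hacc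
      have hs := walkStep_spec hE hV hkey y up hT hB hh hnd σ h1 h10 h11 hy (by
        simp only [if_pos hc]; rw [List.map_append, List.sum_append] at hacc; omega)
      simp only [if_pos hc] at hs ⊢
      refine hs.mono ?_
      rintro t σ₁ ⟨hD, g10, g11, g12⟩
      refine (ih₁ hT.2.1 hB.2.2.1 (by omega) hndl σ₁
        ((hD.2.reg 1 (by norm_num) (by norm_num)).trans h1) g10 g11 g12
        ((hD.2.creg 1 (by norm_num)).trans hy) (hD.acc_lt hacc)).mono fun t' σ₂ hD' => ?_
      have := hD.trans hD'
      refine ⟨?_, this.2⟩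
      have h2 := this.1
      have : (LTree.node a l r).erase.height = max l.erase.height r.erase.height + 1 := rfl
      have := le_max_left l.erase.height r.erase.height
      simp only [Expr.cost]; omega
    · simp only [if_neg hc] at hacc
      have hs := walkStep_spec hE hV hkey y up hT hB hh hnd σ h1 h10 h11 hy (by
        simp only [if_neg hc]; rw [List.map_append, List.sum_append] at hacc; omega)
      simp only [if_neg hc] at hs ⊢
      refine hs.mono ?_
      rintro t σ₁ ⟨hD, g10, g11, g12⟩
      refine (ih₂ hT.2.2 hB.2.2.2 (by omega) hndr σ₁
        ((hD.2.reg 1 (by norm_num) (by norm_num)).trans h1) g10 g11 g12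
        ((hD.2.creg 1 (by norm_num)).trans hy) (hD.acc_lt hacc)).mono fun t' σ₂ hD' => ?_
      have := hD.trans hD'
      refine ⟨?_, this.2⟩
      have h2 := this.1
      have : (LTree.node a l r).erase.height = max l.erase.height r.erase.height + 1 := rfl
      have := le_max_right l.erase.height r.erase.height
      simp only [Expr.cost]; omega

/-- The search in the range tree in variable `10` with the count in variable `11`. -/
def walk (up : Bool) (o : ℕ) (vs : Stmt) : Stmt :=
  .seq (.assign 12 (.ld (.var 10) (.lit 0)))
    (.seq (.whil (.lit 1) (.var 12) (walkStep up vs)) (walkLeaf up o vs))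

theorem walk_spec (hE : Env Λ M) {x : ℝ} {vs : Stmt} {V : Visitor n}
    (hV : VisitSpec Λ M (coordsOf Λ.b) x vs V) {o : ℕ} (ho : o < 5) {key : Fin n → WithTop ℝ}
    (hkey : ∀ i : Fin n, (coordsOf Λ.b)[5 * (i : ℕ) + o]? = some (key i)) (y : WithTop ℝ)
    (up : Bool) {t : RangeTree n} {p : ℕ} (ht : t.Laid Λ o M p) (σ : St) (h1 : σ.reg 1 = Λ.s)
    (h10 : σ.reg 10 = p) (h11 : σ.reg 11 = t.count Λ.b x)
    (hy : σ.creg 1 = y) (hacc : σ.reg 2 + ((t.canon key y up).map V.add).sum < 2 ^ Λ.w) :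
    WP Λ.w M (coordsOf Λ.b) (walk up o vs) σ
      (V.Done 10 σ (t.canon key y up) (100 * (t.height + 1) + 5)) := by
  -- The empty tree has tag `0`, which stops the loop at once and also skips the leaf test.
  rcases ht with ⟨rfl, hM⟩ | ⟨h, T, hh, rfl, rfl, hB, hnd, hT⟩
  · refine WP.seq_assign (.ld (.var' h10) (hE.lit (by norm_num)) hM) ?_
    refine WP.seq (WP.whil_false (hE.lit (by norm_num)) (.var' rfl) (by simp) ?_)
    refine WP.ite (hE.lit (by norm_num)) (.var' rfl) (fun hc => by simp at hc) fun _ => ?_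
    refine WP.skip ⟨by simp [RangeTree.height]; omega, ?_⟩
    simpa [RangeTree.canon] using (Post.refl (k := 10) (σ := σ)).set (r := 12) (by norm_num)
      (by norm_num) 0
  · refine WP.seq_assign (.ld (.var' h10) (hE.lit (by norm_num)) hT.getElem?_tag) ?_
    have hP₀ := (Post.refl (k := 10) (σ := σ)).set (r := 12) (by norm_num) (by norm_num) T.tag
    refine (walkLoop_spec hE hV ho hkey y up hT hB hh hnd _ (by simpa using h1) (by simpa using h10)
      (by simpa using h11) (by simp) (by simpa using hy) (by simpa using hacc)).mono
      fun t' σ₁ hD => ⟨by have := hD.1; simp only [Expr.cost]; omega, ?_⟩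
    simpa using hP₀.trans hD.2

end Programs

end

end Stabbing

namespace Stabbing

noncomputable section

section Programs

variable {n : ℕ} {Λ : Layout n} {M : List ℕ}

/-! ### Counting the boxes of an interval tree node -/

/-- One step of the binary search in the list of boxes of the interval tree node. -/
def bsearchStep : Stmt :=
  .seq (.assign 32 (.op .div (.op .add (.var 8) (.var 30)) (.lit 2)))
  (.seq (.getC 3 (.op .mul (.lit 5) (.ld (.var 31) (.var 32))))
  (.cite 0 3 (.assign 30 (.var 32)) (.assign 8 (.op .add (.var 32) (.lit 1)))))

/-- Find the number of boxes in the list of the interval tree node in variable `5` whose `x`-range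
contains the query. -/
def bsearch : Stmt :=
  .seq (.assign 30 (.ld (.var 5) (.lit 6))) (.seq (.assign 8 (.lit 0))
  (.seq (.assign 31 (.ld (.var 5) (.lit 7))) (.whil (.var 8) (.var 30) bsearchStep)))

theorem lt_countP_iff {α : Type*} (p : α → Bool) {L : List α}
    (hL : L.Pairwise fun a c => p c → p a) {j : ℕ} {a : α} (ha : L[j]? = some a) :
    j < L.countP p ↔ p a := by
  obtain ⟨hj, rfl⟩ := List.getElem?_eq_some_iff.mp ha
  have h := take_countP_eq_filter p L hL
  constructor
  · intro hlt
    have : L[j] ∈ L.take (L.countP p) := List.mem_take_iff_getElem.mpr ⟨j, by omega, rfl⟩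
    rw [h] at this
    exact (List.mem_filter.mp this).2
  · intro hp
    have hall : ∀ c ∈ L.take (j + 1), p c := by
      intro c hc
      obtain ⟨m, hm, rfl⟩ := List.mem_take_iff_getElem.mp hc
      rcases Nat.lt_or_ge m j with hmj | hmj
      · exact List.pairwise_iff_getElem.mp hL m j (by omega) hj hmj hp
      · obtain rfl : m = j := by omega
        exact hp
    have h1 : (L.take (j + 1)).countP p = j + 1 := by
      rw [List.countP_eq_length.mpr hall, List.length_take]; omega
    have h2 := (List.take_sublist (j + 1) L).countP_le (p := p)
    omega

/-- The number sought stays between `lo` and `hi`. The box in the middle passes the test exactly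
when its index is below that number (`lt_countP_iff`), so either outcome halves the gap, which `m`
bounds in binary. -/
theorem bsearch_loop (hE : Env Λ M) (x : ℝ) {X : List (Fin n)} {p : ℕ}
    (hX : Holds M p (X.map Fin.val)) (hs : X.Pairwise fun i j => (Λ.b i).x1 ≤ (Λ.b j).x1)
    (hn : X.length ≤ n) (m lo hi : ℕ) (hm : hi - lo < 2 ^ m)
    (hlo : lo ≤ X.countP fun i => (Λ.b i).x1 ≤ x) (hhi : (X.countP fun i => (Λ.b i).x1 ≤ x) ≤ hi)
    (hhl : hi ≤ X.length) (σ : St) (h8 : σ.reg 8 = lo) (h30 : σ.reg 30 = hi) (h31 : σ.reg 31 = p)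
    (hx : σ.creg 0 = x) :
    WP Λ.w M (coordsOf Λ.b) (.whil (.var 8) (.var 30) bsearchStep) σ fun t σ' =>
      t ≤ 25 * m + 4 ∧ Post 8 σ σ' 0 [] ∧ σ'.reg 8 = X.countP fun i => (Λ.b i).x1 ≤ x := by
  induction m generalizing lo hi σ with
  | zero =>
    refine WP.whil_false (.var' h8) (.var' h30) (by simp at hm; omega) ⟨by simp, Post.refl, ?_⟩
    simp at hm; omega
  | succ m ih =>
    by_cases hlt : lo < hi
    swap
    · exact WP.whil_false (.var' h8) (.var' h30) hlt ⟨by simp only [Expr.cost]; omega, Post.refl,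
        by omega⟩
    have hsmall := hE.valid.small
    obtain ⟨i, hi'⟩ : ∃ i, X[(lo + hi) / 2]? = some i :=
      ⟨_, List.getElem?_eq_getElem (by omega)⟩
    have hin := i.isLt
    have hMi : M[p + (lo + hi) / 2]? = some (i : ℕ) := hX _ _ (by simp [hi'])
    have hcount := lt_countP_iff (fun i => decide ((Λ.b i).x1 ≤ x)) (hs.imp fun {i j} h => by
      simpa using fun h' => h.trans h') hi'
    rw [decide_eq_true_eq] at hcount
    rw [pow_succ] at hm
    refine WP.whil_true (.var' h8) (.var' h30) hlt ?_
    refine WP.seq_assign (v := (lo + hi) / 2) (.op (o := .div) (.op (o := .add) (.var' h8)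
      (.var' h30) (show lo + hi < _ by omega)) (hE.lit (by norm_num)) trivial) ?_
    refine WP.seq_getC (v := 5 * (i : ℕ)) (x := ((Λ.b i).x1 : WithTop ℝ)) (.op (o := .mul)
      (hE.lit (by norm_num)) (.ld (.var' (r := 31) (by simpa using h31)) (.var' (r := 32) (by simp))
      hMi) (show 5 * (i : ℕ) < _ by omega)) (getElem?_coordsOf Λ.b i 0 (by norm_num)) ?_
    set σ₀ := (σ.set 32 ((lo + hi) / 2)).setC 3 ((Λ.b i).x1 : WithTop ℝ) with hσ₀
    have hP₀ : Post 8 σ σ₀ 0 [] := ((Post.refl.set (by norm_num) (by norm_num) _).setC (by norm_num)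
      _)
    have c0 : σ₀.creg 0 = x := by simpa [σ₀] using hx
    have c3 : σ₀.creg 3 = ((Λ.b i).x1 : WithTop ℝ) := by simp [σ₀]
    have g8 : σ₀.reg 8 = lo := by simpa [σ₀] using h8
    have g30 : σ₀.reg 30 = hi := by simpa [σ₀] using h30
    have g31 : σ₀.reg 31 = p := by simpa [σ₀] using h31
    have g32 : σ₀.reg 32 = (lo + hi) / 2 := by simp [σ₀]
    refine WP.cite (fun hc => ?_) fun hc => ?_
    · rw [c0, c3, WithTop.coe_lt_coe] at hc
      refine WP.assign (.var' g32) ?_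
      refine (ih lo ((lo + hi) / 2) (by omega) hlo (by
        by_contra hcon
        exact absurd (hcount.mp (by omega)) (not_le.mpr hc)) (by omega) _ (by simpa using g8) (by simp)
        (by simpa using g31) (by simpa using c0)).mono ?_
      rintro t σ' ⟨ht, hP, h⟩
      refine ⟨by simp only [Expr.cost]; omega, ?_, h⟩
      simpa using (hP₀.set (r := 30) (by norm_num) (by norm_num) _).trans hP
    · rw [c0, c3, WithTop.coe_lt_coe, not_lt] at hc
      refine WP.assign (.op (.var' g32) (hE.lit (by norm_num)) (show _ + 1 < _ by omega)) ?_
      have hk := hcount.mpr hc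
      refine (ih ((lo + hi) / 2 + 1) hi (by omega) (by omega) hhi hhl _ (by simp [BinOp.nat])
        (by simpa using g30) (by simpa using g31) (by simpa using c0)).mono ?_
      rintro t σ' ⟨ht, hP, h⟩
      refine ⟨by simp only [Expr.cost]; omega, ?_, h⟩
      simpa using (hP₀.set (r := 8) (by norm_num) (by norm_num) _).trans hP

theorem bsearch_spec (hE : Env Λ M) (x : ℝ) {a : ℕ} {X : List (Fin n)} {p : ℕ}
    (h6 : M[a + 6]? = some X.length) (h7 : M[a + 7]? = some p)
    (hX : Holds M p (X.map Fin.val)) (hs : X.Pairwise fun i j => (Λ.b i).x1 ≤ (Λ.b j).x1)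
    (hn : X.length ≤ n) (σ : St) (h5 : σ.reg 5 = a) (hx : σ.creg 0 = x) :
    WP Λ.w M (coordsOf Λ.b) bsearch σ fun t σ' =>
      t ≤ 25 * (Λ.s + 1) + 16 ∧ Post 8 σ σ' 0 [] ∧
        σ'.reg 8 = X.countP fun i => (Λ.b i).x1 ≤ x := by
  refine WP.seq_assign (.ld (.var' h5) (hE.lit (by norm_num)) h6) ?_
  refine WP.seq_assign (hE.lit (by norm_num)) ?_
  refine WP.seq_assign (.ld (.var' (by simpa using h5)) (hE.lit (by norm_num)) h7) ?_
  refine (bsearch_loop hE x hX hs hn (Λ.s + 1) 0 X.length (by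
    have := hE.valid.lt_two_pow; omega) (by omega) List.countP_le_length le_rfl _ (by simp) (by simp)
    (by simp) (by simpa using hx)).mono ?_
  rintro t σ' ⟨ht, hP, h⟩
  refine ⟨by simp only [Expr.cost]; omega, ?_, h⟩
  simpa using (((Post.refl.set (by norm_num) (by norm_num) _).set (by norm_num) (by norm_num)
    _).set (by norm_num) (by norm_num) _).trans hP

/-! ### The search in the upper layers -/

/-- One level of the search in an interval tree. -/
def intervalStep (vs : Stmt) : Stmt :=
  .seq bsearch (.seq (.getC 3 (.ld (.var 5) (.lit 1))) (.seq (.assign 11 (.var 8))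
  (.seq (.cite 1 3
    (.seq (.assign 10 (.ld (.var 5) (.lit 2))) (.seq (.assign 7 (.ld (.var 5) (.lit 4)))
      (walk false 1 vs)))
    (.seq (.assign 10 (.ld (.var 5) (.lit 3))) (.seq (.assign 7 (.ld (.var 5) (.lit 5)))
      (walk true 2 vs))))
  (.seq (.assign 5 (.var 7)) (.assign 6 (.ld (.var 5) (.lit 0)))))))

/-- The search in the interval tree in variable `5`. -/
def intervalWalk (vs : Stmt) : Stmt :=
  .seq (.assign 6 (.ld (.var 5) (.lit 0))) (.whil (.lit 0) (.var 6) (intervalStep vs))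

/-- The tag of an interval tree node. -/
def IntervalTree.tag : IntervalTree n → ℕ
  | .nil => 0
  | .node _ _ _ _ _ => 1

theorem IntervalTree.Laid.getElem?_tag {t : IntervalTree n} {a : ℕ} (ht : t.Laid Λ M a) :
    M[a + 0]? = some t.tag := by
  cases t with
  | nil => exact ht
  | node m lo up l r => exact ht.1

/-- The list `X` has the same boxes as either of the two range trees of the node, so one binary
search, done before the comparison with the median, gives the count at the root of whichever tree is
walked. A level costs one binary search and one walk, both logarithmic. -/
theorem intervalLoop_spec (hE : Env Λ M) {x y : ℝ} {vs : Stmt} {V : Visitor n}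
    (hV : VisitSpec Λ M (coordsOf Λ.b) x vs V) {H : ℕ} (t : IntervalTree n)
    (hH : ∀ T ∈ t.rangeTrees, T.height ≤ H) {a : ℕ} (ht : t.Laid Λ M a) (σ : St)
    (h1 : σ.reg 1 = Λ.s) (h5 : σ.reg 5 = a) (h6 : σ.reg 6 = t.tag) (hx : σ.creg 0 = x)
    (hy : σ.creg 1 = y)
    (hacc : σ.reg 2 + ((t.visits Λ.b y).map V.add).sum < 2 ^ Λ.w) :
    WP Λ.w M (coordsOf Λ.b) (.whil (.lit 0) (.var 6) (intervalStep vs)) σ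
      (V.Done 5 σ (t.visits Λ.b y) (t.depth * (25 * (Λ.s + 1) + 100 * (H + 1) + 100) + 4)) := by
  induction t generalizing a σ with
  | nil =>
    exact WP.whil_false (hE.lit (by norm_num)) (.var' h6) (by simp [IntervalTree.tag])
      ⟨by simp; omega, by simpa [IntervalTree.visits] using Post.refl⟩
  | node m lo up l r ih₁ ih₂ =>
    obtain ⟨-, ⟨p₁, k1, hm⟩, ⟨p₂, k2, hlo⟩, ⟨p₃, k3, hup⟩, ⟨p₄, k4, hl⟩, ⟨p₅, k5, hr⟩, X, p, k6, k7,
      hX, hs, hXlo, hXup, hn⟩ := ht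
    simp only [IntervalTree.rangeTrees, List.mem_cons, List.mem_append] at hH
    refine WP.whil_true (hE.lit (by norm_num)) (.var' h6) (by simp [IntervalTree.tag]) ?_
    refine WP.seq ((bsearch_spec hE x k6 k7 hX hs hn σ h5 hx).mono ?_)
    rintro t₀ σ₁ ⟨ht₀, hP₁, hk⟩
    have e5 := (hP₁.reg 5 (by norm_num) (by norm_num)).trans h5
    refine WP.seq_getC (.ld (.var' e5) (hE.lit (by norm_num)) k1) hm ?_
    refine WP.seq_assign (.var' hk) ?_
    set c := X.countP fun i => (Λ.b i).x1 ≤ x with hc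
    set σ₂ := (σ₁.setC 3 m).set 11 c with hσ₂
    have hP₂ : Post 5 σ σ₂ 0 [] := ((hP₁.mono (by norm_num)).setC (by norm_num) _).set
      (by norm_num) (by norm_num) _
    have g5 : σ₂.reg 5 = a := by simpa [σ₂] using e5
    have g11 : σ₂.reg 11 = c := by simp [σ₂]
    have g1 := (hP₂.reg 1 (by norm_num) (by norm_num)).trans h1
    have g2 : σ₂.reg 2 = σ.reg 2 := by simpa using hP₂.acc
    have c0 := (hP₂.creg 0 (by norm_num)).trans hx
    have c1 := (hP₂.creg 1 (by norm_num)).trans hy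
    have c3 : σ₂.creg 3 = m := by simp [σ₂]
    -- The accounting is the same for both directions: one unit of depth pays for this level, and
    -- the counters and outputs of walk and recursion are appended.
    have key : ∀ {o : ℕ}, ∀ {k : Fin n → WithTop ℝ} {b : Bool} {T : RangeTree n} {t' : IntervalTree n}
        {L : List (RangeTree n)} {p' : ℕ} {K t₁ t₂ : ℕ} {σ₃ σ₄ : St},
        (IntervalTree.node m lo up l r).visits Λ.b y = T.canon k y b ++ L → T.height ≤ H →
        t'.depth + 1 ≤ (IntervalTree.node m lo up l r).depth →
        V.Done 10 ((σ₂.set 10 o).set 7 p') (T.canon k y b) (100 * (T.height + 1) + 5) t₁ σ₃ →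
        V.Done 5 ((σ₃.set 5 p').set 6 t'.tag) L
          (t'.depth * (25 * (Λ.s + 1) + 100 * (H + 1) + 100) + 4) t₂ σ₄ →
        K ≤ t₀ + t₁ + t₂ + 50 →
        V.Done 5 σ ((IntervalTree.node m lo up l r).visits Λ.b y)
          ((IntervalTree.node m lo up l r).depth * (25 * (Λ.s + 1) + 100 * (H + 1) + 100) + 4)
          K σ₄ := by
      intro o k b T t' L p' K t₁ t₂ σ₃ σ₄ hv hT hd hD hD' hK
      rw [hv]
      refine ⟨?_, ?_⟩
      · rw [List.map_append, List.sum_append]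
        have h1 := hD.1
        have h2 := hD'.1
        have h3 := Nat.mul_le_mul_right (25 * (Λ.s + 1) + 100 * (H + 1) + 100) hd
        rw [Nat.succ_mul] at h3
        omega
      · rw [List.map_append, List.sum_append, List.flatMap_append]
        have := (((hP₂.set (r := 10) (by norm_num) (by norm_num) o).set (r := 7) (by norm_num)
          (by norm_num) p').trans (hD.2.mono (k' := 5) (by norm_num))).set (r := 5) (by norm_num)
          (by norm_num) p' |>.set (r := 6) (by norm_num) (by norm_num) t'.tag |>.trans hD'.2
        simpa using this
    have hvis : (IntervalTree.node m lo up l r).visits Λ.b y = if (y : WithTop ℝ) < m then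
      lo.canon (fun i => (Λ.b i).y1) y false ++ l.visits Λ.b y
      else up.canon (fun i => (Λ.b i).y2) y true ++ r.visits Λ.b y := rfl
    have hdl := le_max_left l.depth r.depth
    have hdr := le_max_right l.depth r.depth
    refine WP.seq (WP.cite (fun hc => ?_) fun hc => ?_)
    · rw [c1, c3] at hc
      rw [if_pos hc] at hvis
      rw [hvis] at hacc
      refine WP.seq_assign (.ld (.var' g5) (hE.lit (by norm_num)) k2) ?_
      refine WP.seq_assign (.ld (.var' (by simpa using g5)) (hE.lit (by norm_num)) k4) ?_
      refine (walk_spec hE hV (by norm_num) (fun i => getElem?_coordsOf Λ.b i 1 (by norm_num)) y false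
        hlo _ (by simpa using g1) (by simp) ?_ (by simpa using c1) ?_).mono fun t₁ σ₃ hD => ?_
      · simpa [RangeTree.count, g11, hc] using hXlo.countP_eq _
      · rw [List.map_append, List.sum_append] at hacc; simp [g2]; omega
      have q7 := hD.2.reg 7 (by norm_num) (by norm_num)
      refine WP.seq_assign (.var' (v := p₄) (by simpa using q7)) ?_
      refine WP.assign (.ld (.var' rfl) (hE.lit (by norm_num)) (by simpa using hl.getElem?_tag)) ?_
      refine (ih₁ (fun T hT => hH T (by tauto)) hl _ ?_ (by simp) (by simp) ?_ ?_ ?_).mono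
        fun t₂ σ₄ hD' => key hvis (hH lo (by tauto)) (Nat.succ_le_succ hdl) hD hD' ?_
      · simpa [g1] using hD.2.reg 1 (by norm_num) (by norm_num)
      · simpa [c0] using hD.2.creg 0 (by norm_num)
      · simpa [c1] using hD.2.creg 1 (by norm_num)
      · have := hD.acc_lt (L' := l.visits Λ.b y) (N := 2 ^ Λ.w) (by simpa [g2] using hacc)
        simpa using this
      · simp only [Expr.cost]; omega
    · rw [c1, c3] at hc
      rw [if_neg hc] at hvis
      rw [hvis] at hacc
      refine WP.seq_assign (.ld (.var' g5) (hE.lit (by norm_num)) k3) ?_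
      refine WP.seq_assign (.ld (.var' (by simpa using g5)) (hE.lit (by norm_num)) k5) ?_
      refine (walk_spec hE hV (by norm_num) (fun i => getElem?_coordsOf Λ.b i 2 (by norm_num)) y true
        hup _ (by simpa using g1) (by simp) ?_ (by simpa using c1) ?_).mono fun t₁ σ₃ hD => ?_
      · simpa [RangeTree.count, g11, hc] using hXup.countP_eq _
      · rw [List.map_append, List.sum_append] at hacc; simp [g2]; omega
      have q7 := hD.2.reg 7 (by norm_num) (by norm_num)
      refine WP.seq_assign (.var' (v := p₅) (by simpa using q7)) ?_
      refine WP.assign (.ld (.var' rfl) (hE.lit (by norm_num)) (by simpa using hr.getElem?_tag)) ?_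
      refine (ih₂ (fun T hT => hH T (by tauto)) hr _ ?_ (by simp) (by simp) ?_ ?_ ?_).mono
        fun t₂ σ₄ hD' => key hvis (hH up (by tauto)) (Nat.succ_le_succ hdr) hD hD' ?_
      · simpa [g1] using hD.2.reg 1 (by norm_num) (by norm_num)
      · simpa [c0] using hD.2.creg 0 (by norm_num)
      · simpa [c1] using hD.2.creg 1 (by norm_num)
      · have := hD.acc_lt (L' := r.visits Λ.b y) (N := 2 ^ Λ.w) (by simpa [g2] using hacc)
        simpa using this
      · simp only [Expr.cost]; omega

theorem intervalWalk_spec (hE : Env Λ M) {x y : ℝ} {vs : Stmt} {V : Visitor n}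
    (hV : VisitSpec Λ M (coordsOf Λ.b) x vs V) {H : ℕ} (t : IntervalTree n)
    (hH : ∀ T ∈ t.rangeTrees, T.height ≤ H) {a : ℕ} (ht : t.Laid Λ M a) (σ : St)
    (h1 : σ.reg 1 = Λ.s) (h5 : σ.reg 5 = a) (hx : σ.creg 0 = x) (hy : σ.creg 1 = y)
    (hacc : σ.reg 2 + ((t.visits Λ.b y).map V.add).sum < 2 ^ Λ.w) :
    WP Λ.w M (coordsOf Λ.b) (intervalWalk vs) σ
      (V.Done 5 σ (t.visits Λ.b y) (t.depth * (25 * (Λ.s + 1) + 100 * (H + 1) + 100) + 9)) := by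
  refine WP.seq_assign (.ld (.var' h5) (hE.lit (by norm_num)) ht.getElem?_tag) ?_
  refine (intervalLoop_spec hE hV t hH ht _ (by simpa using h1) (by simpa using h5) (by simp)
    (by simpa using hx) (by simpa using hy) (by simpa using hacc)).mono fun t' σ' hD =>
    ⟨by have := hD.1; simp only [Expr.cost]; omega, ?_⟩
  simpa using ((Post.refl (k := 5) (σ := σ)).set (r := 6) (by norm_num) (by norm_num) t.tag).trans
    hD.2

/-- One level of the search in the segment tree. -/
def segmentStep (vs : Stmt) : Stmt :=
  .seq (.assign 5 (.ld (.var 3) (.lit 1))) (.seq (intervalWalk vs)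
  (.seq (.assign 4 (.ld (.var 3) (.lit 0)))
  (.ite (.lit 0) (.var 4) (.seq (.getC 3 (.ld (.var 3) (.lit 2)))
    (.cite 2 3 (.assign 3 (.ld (.var 3) (.lit 3))) (.assign 3 (.ld (.var 3) (.lit 4))))) .skip)))

/-- The search in the whole structure. -/
def segmentWalk (vs : Stmt) : Stmt :=
  .seq (.assign 3 (.ld (.lit 0) (.lit 0))) (.seq (.assign 1 (.ld (.lit 0) (.lit 1)))
  (.seq (.assign 4 (.lit 1)) (.whil (.lit 0) (.var 4) (segmentStep vs))))

/-- Variable `4` holds the tag of the node just treated and not of the next one, since the interval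
tree at a leaf must be searched as well. It therefore starts positive, and the loop ends only after
the tag of a leaf has been read. -/
theorem segmentLoop_spec (hE : Env Λ M) {x y z : ℝ} {vs : Stmt} {V : Visitor n}
    (hV : VisitSpec Λ M (coordsOf Λ.b) x vs V) {H D : ℕ} (t : SegmentTree n)
    (hD : ∀ m ∈ t.intervalTrees, m.depth ≤ D)
    (hH : ∀ m ∈ t.intervalTrees, ∀ T ∈ m.rangeTrees, T.height ≤ H) {a : ℕ}
    (ht : t.Laid Λ M a) (σ : St) (h1 : σ.reg 1 = Λ.s) (h3 : σ.reg 3 = a) (h4 : 0 < σ.reg 4)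
    (hx : σ.creg 0 = x) (hy : σ.creg 1 = y) (hz : σ.creg 2 = z)
    (hacc : σ.reg 2 + ((t.visits Λ.b y z).map V.add).sum < 2 ^ Λ.w) :
    WP Λ.w M (coordsOf Λ.b) (.whil (.lit 0) (.var 4) (segmentStep vs)) σ
      (V.Done 3 σ (t.visits Λ.b y z)
        (t.depth * (D * (25 * (Λ.s + 1) + 100 * (H + 1) + 100) + 50))) := by
  induction t generalizing a σ with
  | leaf m =>
    obtain ⟨k0, p, k1, hm⟩ := ht
    rw [SegmentTree.visits] at hacc ⊢
    refine WP.whil_true (hE.lit (by norm_num)) (.var' rfl) h4 ?_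
    refine WP.seq_assign (.ld (.var' h3) (hE.lit (by norm_num)) k1) ?_
    refine WP.seq ((intervalWalk_spec hE hV m (hH m (by simp [SegmentTree.intervalTrees])) hm _
      (by simpa using h1) (by simp) (by simpa using hx) (by simpa using hy)
      (by simpa using hacc)).mono
      fun t₁ σ₁ hV₁ => ?_)
    have e3 : σ₁.reg 3 = a := by simpa [h3] using hV₁.2.reg 3 (by norm_num) (by norm_num)
    refine WP.seq_assign (.ld (.var' e3) (hE.lit (by norm_num)) k0) ?_
    refine WP.ite (hE.lit (by norm_num)) (.var' rfl) (fun hc => by simp at hc) fun _ => ?_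
    refine WP.skip (WP.whil_false (hE.lit (by norm_num)) (.var' rfl) (by simp) ⟨?_, ?_⟩)
    · have h1 := hV₁.1
      have h2 := Nat.mul_le_mul_right (25 * (Λ.s + 1) + 100 * (H + 1) + 100)
        (hD m (by simp [SegmentTree.intervalTrees]))
      simp only [Expr.cost, SegmentTree.depth]; omega
    · have := (((Post.refl (k := 3) (σ := σ)).set (r := 5) (by norm_num) (by norm_num) p).trans
        (hV₁.2.mono (k' := 3) (by norm_num))).set (r := 4) (by norm_num) (by norm_num) 0
      simpa using this
  | node k m l r ih₁ ih₂ =>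
    obtain ⟨k0, ⟨p, k1, hm⟩, ⟨p₂, k2, hk⟩, ⟨p₃, k3, hl⟩, ⟨p₄, k4, hr⟩⟩ := ht
    simp only [SegmentTree.intervalTrees, List.mem_cons, List.mem_append] at hD hH
    rw [SegmentTree.visits] at hacc ⊢
    refine WP.whil_true (hE.lit (by norm_num)) (.var' rfl) h4 ?_
    refine WP.seq_assign (.ld (.var' h3) (hE.lit (by norm_num)) k1) ?_
    refine WP.seq ((intervalWalk_spec hE hV m (hH m (by tauto)) hm _
      (by simpa using h1) (by simp) (by simpa using hx) (by simpa using hy) (by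
        rw [List.map_append, List.sum_append] at hacc; simp; omega)).mono
      fun t₁ σ₁ hV₁ => ?_)
    have e3 : σ₁.reg 3 = a := by simpa [h3] using hV₁.2.reg 3 (by norm_num) (by norm_num)
    have hdl := le_max_left l.depth r.depth
    have hdr := le_max_right l.depth r.depth
    have hacc' := hV₁.acc_lt (L' := if z < k then l.visits Λ.b y z else r.visits Λ.b y z)
      (N := 2 ^ Λ.w) (by simpa using hacc)
    refine WP.seq_assign (.ld (.var' e3) (hE.lit (by norm_num)) k0) ?_
    refine WP.ite (hE.lit (by norm_num)) (.var' rfl) (fun _ => ?_) fun hc => by simp at hc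
    refine WP.seq_getC (.ld (.var' (by simpa using e3)) (hE.lit (by norm_num)) k2) hk ?_
    have c0 : σ₁.creg 0 = x := by simpa [hx] using hV₁.2.creg 0 (by norm_num)
    have c1 : σ₁.creg 1 = y := by simpa [hy] using hV₁.2.creg 1 (by norm_num)
    have c2 : σ₁.creg 2 = z := by simpa [hz] using hV₁.2.creg 2 (by norm_num)
    have g1 : σ₁.reg 1 = Λ.s := by simpa [h1] using hV₁.2.reg 1 (by norm_num) (by norm_num)
    have key : ∀ {t' : SegmentTree n} {p' K t₂ : ℕ} {σ₄ : St},
        t'.depth + 1 ≤ (SegmentTree.node k m l r).depth →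
        V.Done 3 ((((σ₁.set 4 1).setC 3 (k : WithTop ℝ)).set 3 p')) (t'.visits Λ.b y z)
          (t'.depth * (D * (25 * (Λ.s + 1) + 100 * (H + 1) + 100) + 50)) t₂ σ₄ →
        K ≤ t₁ + t₂ + 41 →
        V.Done 3 σ (m.visits Λ.b y ++ t'.visits Λ.b y z) ((SegmentTree.node k m l r).depth *
          (D * (25 * (Λ.s + 1) + 100 * (H + 1) + 100) + 50)) K σ₄ := by
      intro t' p' K t₂ σ₄ hd hV₂ hK
      refine ⟨?_, ?_⟩
      · rw [List.map_append, List.sum_append]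
        have h1 := hV₁.1
        have h2 := hV₂.1
        have h3 := Nat.mul_le_mul_right (D * (25 * (Λ.s + 1) + 100 * (H + 1) + 100) + 50) hd
        rw [Nat.succ_mul] at h3
        have h4 := Nat.mul_le_mul_right (25 * (Λ.s + 1) + 100 * (H + 1) + 100) (hD m (by tauto))
        omega
      · rw [List.map_append, List.sum_append, List.flatMap_append]
        have := (((Post.refl (k := 3) (σ := σ)).set (r := 5) (by norm_num) (by norm_num) p).trans
          (hV₁.2.mono (k' := 3) (by norm_num))).set (r := 4) (by norm_num) (by norm_num) 1 |>.setC
          (r := 3) (by norm_num) (k : WithTop ℝ) |>.set (r := 3) (by norm_num) (by norm_num) p'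
          |>.trans hV₂.2
        simpa using this
    refine WP.cite (fun hc => ?_) fun hc => ?_
    · have hc' : z < k := by simpa [c2] using hc
      rw [if_pos hc'] at hacc' ⊢
      refine WP.assign (.ld (.var' (by simpa using e3)) (hE.lit (by norm_num)) k3) ?_
      refine (ih₁ (fun m hm => hD m (by tauto)) (fun m hm => hH m (by tauto)) hl _
        (by simpa using g1) (by simp) (by simp) (by simpa using c0) (by simpa using c1)
        (by simpa using c2) (by simpa using hacc')).mono
        fun t₂ σ₄ hV₂ => key (Nat.succ_le_succ hdl) hV₂ ?_
      simp only [Expr.cost]; omega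
    · have hc' : ¬ z < k := by simpa [c2] using hc
      rw [if_neg hc'] at hacc' ⊢
      refine WP.assign (.ld (.var' (by simpa using e3)) (hE.lit (by norm_num)) k4) ?_
      refine (ih₂ (fun m hm => hD m (by tauto)) (fun m hm => hH m (by tauto)) hr _
        (by simpa using g1) (by simp) (by simp) (by simpa using c0) (by simpa using c1)
        (by simpa using c2) (by simpa using hacc')).mono
        fun t₂ σ₄ hV₂ => key (Nat.succ_le_succ hdr) hV₂ ?_
      simp only [Expr.cost]; omega

theorem segmentWalk_spec (hE : Env Λ M) {q : Point} {vs : Stmt} {V : Visitor n}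
    (hV : VisitSpec Λ M (coordsOf Λ.b) q.x vs V) {H D : ℕ} (t : SegmentTree n)
    (hD : ∀ m ∈ t.intervalTrees, m.depth ≤ D)
    (hH : ∀ m ∈ t.intervalTrees, ∀ T ∈ m.rangeTrees, T.height ≤ H) {a : ℕ}
    (ht : t.Laid Λ M a) (h0 : M[0]? = some a) (h1 : M[1]? = some Λ.s)
    (hacc : ((t.visits Λ.b q.y q.z).map V.add).sum < 2 ^ Λ.w) :
    WP Λ.w M (coordsOf Λ.b) (segmentWalk vs)
      ⟨fun _ => 0, (startConfig (w := Λ.w) [] q).coordReg, []⟩ fun t' σ' =>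
      t' ≤ t.depth * (D * (25 * (Λ.s + 1) + 100 * (H + 1) + 100) + 50) + 12 +
        ((t.visits Λ.b q.y q.z).map V.time).sum ∧
      σ'.reg 2 = ((t.visits Λ.b q.y q.z).map V.add).sum ∧
      σ'.out = (t.visits Λ.b q.y q.z).flatMap V.outs := by
  refine WP.seq_assign (.ld (hE.lit (by norm_num)) (hE.lit (by norm_num)) h0) ?_
  refine WP.seq_assign (.ld (hE.lit (by norm_num)) (hE.lit (by norm_num)) h1) ?_
  refine WP.seq_assign (hE.lit (by norm_num)) ?_
  refine (segmentLoop_spec hE (x := q.x) (y := q.y) (z := q.z) hV t hD hH ht _ (by simp) (by simp) (by simp)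
    (by simp [startConfig]) (by simp [startConfig]) (by simp [startConfig]) (by simpa using hacc)).mono
    fun t' σ' hV => ⟨?_, by simpa using hV.2.acc, by simpa using hV.2.out⟩
  have := hV.1
  simp only [Expr.cost]; omega

end Programs

end

end Stabbing

namespace Stabbing

noncomputable section

/-! ### Size, depth and exactness of the structure in terms of `n` -/

section Bounds

variable {n : ℕ} (b : Fin n → CanonicalBox)

theorem depth_structureOf_le {s : ℕ} (hs : n < 2 ^ (s + 1)) : (structureOf b).depth ≤ s + 3 :=
  SegmentTree.depth_build_le b (s + 2) _ _ _ (by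
    have := length_zKeys_le b
    rw [pow_succ] at hs ⊢; rw [pow_succ]; omega)

theorem boxes_structureOf_le {s : ℕ} (hs : n < 2 ^ (s + 1)) :
    (structureOf b).boxes ≤ 4 * (s + 3) * n := by
  have h := SegmentTree.boxes_build_le b (s + 3) (zKeys b) Set.univ Set.univ (cuts_zKeys b)
    (depth_structureOf_le b hs)
  have h0 : assigned b Set.univ Set.univ = [] := by
    rw [assigned, List.filter_eq_nil_iff]
    intro i _
    simp [not_univ_subset_zRange b i]
  rw [h0] at h
  have h1 := Nat.mul_le_mul_left (2 * (s + 3)) (endpointsIn_le b Set.univ)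
  calc (structureOf b).boxes ≤ _ := h
    _ ≤ 2 * (s + 3) * (2 * n) := by simpa using h1
    _ = 4 * (s + 3) * n := by ring

theorem nodes_structureOf_le : (structureOf b).nodes ≤ 4 * n + 1 := by
  have := length_zKeys_le b
  rw [structureOf, SegmentTree.nodes_build]; omega

theorem depth_of_mem_intervalTrees {s : ℕ} (hs : n < 2 ^ (s + 1)) :
    ∀ m ∈ (structureOf b).intervalTrees, m.depth ≤ 2 * (s + 1) := by
  intro m hm
  obtain ⟨J, I, rfl⟩ := SegmentTree.intervalTrees_build b _ _ _ m hm
  exact IntervalTree.depth_build_le b (s + 1) _ ((length_assigned_le_card b J I).trans_lt hs)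

theorem rangeTrees_of_mem_intervalTrees :
    ∀ m ∈ (structureOf b).intervalTrees, ∀ T ∈ m.rangeTrees,
      ∃ L : List (Fin n), L.length ≤ n ∧ T = .ofList L := by
  intro m hm T hT
  obtain ⟨J, I, rfl⟩ := SegmentTree.intervalTrees_build b _ _ _ m hm
  obtain ⟨L, hL, rfl⟩ := IntervalTree.rangeTrees_build b _ T hT
  exact ⟨L, hL.trans (length_assigned_le_card b J I), rfl⟩

theorem height_of_mem_intervalTrees :
    ∀ m ∈ (structureOf b).intervalTrees, ∀ T ∈ m.rangeTrees, T.height ≤ Nat.log 2 n + 1 := by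
  intro m hm T hT
  obtain ⟨L, hL, rfl⟩ := rangeTrees_of_mem_intervalTrees b m hm T hT
  exact RangeTree.height_ofList_le hL

theorem length_visits_structureOf_le {s : ℕ} (hs : Nat.log 2 n = s) (y z : ℝ) :
    ((structureOf b).visits b y z).length ≤ (s + 3) * (2 * (s + 1) * (s + 2)) := by
  have hs' : n < 2 ^ (s + 1) := hs ▸ Nat.lt_pow_succ_log_self (by norm_num) n
  refine (SegmentTree.length_visits_le b y z (2 * (s + 1) * (s + 2)) _ fun m hm => ?_).trans
    (Nat.mul_le_mul_right _ (depth_structureOf_le b hs'))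
  have hH := height_of_mem_intervalTrees b m hm
  rw [hs] at hH
  exact (IntervalTree.length_visits_le b y (s + 1) m hH).trans
    (Nat.mul_le_mul_right _ (depth_of_mem_intervalTrees b hs' m hm))

theorem bottomList_mem_of_mem_visits {y z : ℝ} {v : RangeTree n}
    (hv : v ∈ (structureOf b).visits b y z) : v.bottomList b ∈ bottomLists b := by
  obtain ⟨m, hm, hv⟩ := SegmentTree.exists_of_mem_visits b y z _ hv
  obtain ⟨T, hT, hv⟩ := IntervalTree.mem_subtrees_of_mem_visits b y m (fun T hT => by
    obtain ⟨L, -, rfl⟩ := rangeTrees_of_mem_intervalTrees b m hm T hT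
    exact ⟨L, rfl⟩) hv
  exact List.mem_map_of_mem (List.mem_flatMap.mpr ⟨T, List.mem_flatMap.mpr ⟨m, hm, hT⟩, hv⟩)

/-- The visited prefixes together are a rearrangement of a filter of `List.finRange n`, which has no
repetitions; so no box occurs twice, within one prefix or across several. -/
theorem stabbed_eq_toFinset (q : Point) {L : List (Fin n)}
    (hL : L.Perm ((((structureOf b).visits b q.y q.z).flatMap (RangeTree.piece b q.x)))) :
    L.Nodup ∧ (∀ i, i ∈ L ↔ i ∈ stabbed b q) ∧ L.length = (stabbed b q).card := by
  classical
  have h := hL.trans (flatMap_piece_visits_perm b q)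
  have hnd : L.Nodup := h.nodup_iff.mpr ((List.nodup_finRange n).filter _)
  have hmem : ∀ i, i ∈ L ↔ i ∈ stabbed b q := fun i => by
    rw [h.mem_iff]; simp [stabbed]
  refine ⟨hnd, hmem, ?_⟩
  rw [← List.toFinset_card_of_nodup hnd]
  congr 1
  ext i
  rw [List.mem_toFinset, hmem]

theorem sum_count_visits (q : Point) :
    (((structureOf b).visits b q.y q.z).map (RangeTree.count b q.x)).sum = (stabbed b q).card := by
  rw [← (stabbed_eq_toFinset b q (List.Perm.refl _)).2.2, List.length_flatMap]
  congr 1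
  exact List.map_congr_left fun v _ => (v.length_piece b q.x).symm

end Bounds

theorem log_le_lg {n : ℕ} (hn : 2 ≤ n) : (Nat.log 2 n : ℝ) ≤ lg n := by
  rw [lg, Real.le_logb_iff_rpow_le (by norm_num) (by exact_mod_cast (by omega : 0 < n)),
    Real.rpow_natCast]
  exact_mod_cast Nat.pow_log_le_self 2 (by omega)

/-- The time of the search outside the visited nodes is at most cubic. -/
theorem walk_time_le {s d : ℕ} (hs : 1 ≤ s) (hd : d ≤ s + 3) :
    d * (2 * (s + 1) * (25 * (s + 1) + 100 * (s + 1 + 1) + 100) + 50) + 12 ≤ 7412 * s ^ 3 := by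
  have h1 : d ≤ 4 * s := by omega
  have h2 : 2 * (s + 1) ≤ 4 * s := by omega
  have h3 : 25 * (s + 1) + 100 * (s + 1 + 1) + 100 ≤ 450 * s := by omega
  calc _ ≤ 4 * s * (4 * s * (450 * s) + 50) + 12 := by gcongr
    _ = 7200 * s ^ 3 + 200 * s + 12 := by ring
    _ ≤ 7200 * s ^ 3 + 200 * s ^ 3 + 12 * s ^ 3 := by
      have h4 : s ≤ s ^ 3 := Nat.le_self_pow (by norm_num) s
      omega
    _ = _ := by ring

theorem visits_le_cube {s m : ℕ} (hs : 1 ≤ s) (hm : m ≤ (s + 3) * (2 * (s + 1) * (s + 2))) :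
    m ≤ 48 * s ^ 3 := by
  have h1 : s + 3 ≤ 4 * s := by omega
  have h2 : 2 * (s + 1) ≤ 4 * s := by omega
  have h3 : s + 2 ≤ 3 * s := by omega
  calc m ≤ _ := hm
    _ ≤ 4 * s * (4 * s * (3 * s)) := by gcongr
    _ = _ := by ring

/-! ### The counting and the reporting query -/

section Queries

variable {n : ℕ} {Λ : Layout n} {M : List ℕ}

/-- The counter never overflows, because the final sum is at most `n`. The time is `7412 * s ^ 3`
for the search, `4` steps for each of at most `48 * s ^ 3` visits, and the final output, which `7700
* s ^ 3` covers. -/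
theorem count_query (hE : Env Λ M) (hs : Nat.log 2 n = Λ.s) {root : ℕ}
    (h0 : M[0]? = some root) (h1 : M[1]? = some Λ.s)
    (hL : (structureOf Λ.b).Laid Λ M root) (q : Point) :
    ∃ (t : ℕ) (out : BitVec Λ.w), AnswersIn
      (Stmt.program (.seq (segmentWalk countVisit) (.outp (.var 2)))) (M.map (BitVec.ofNat Λ.w))
        (coordsOf Λ.b) q t [out] ∧ out.toNat = (stabbed Λ.b q).card ∧ t ≤ 7700 * Λ.s ^ 3 := by
  have hlt := hE.valid.lt_two_pow
  have hsum : ((((structureOf Λ.b).visits Λ.b q.y q.z).map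
      (countVisitor Λ.b q.x).add)).sum = (stabbed Λ.b q).card := sum_count_visits Λ.b q
  have hcard : (stabbed Λ.b q).card ≤ n := by
    simpa using Finset.card_le_univ (stabbed Λ.b q)
  have hsmall := hE.valid.small
  have hH := height_of_mem_intervalTrees Λ.b
  rw [hs] at hH
  obtain ⟨t, σ', hx, ht, hacc, hout⟩ := segmentWalk_spec hE (countVisit_spec q.x) (structureOf Λ.b)
    (depth_of_mem_intervalTrees Λ.b hlt) hH hL h0 h1 (by rw [hsum]; omega)
  have hx' := Exec.seq hx (Exec.outp (Ev.var 2))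
  obtain ⟨out, ho, hmap⟩ := Exec.answersIn hE.lt hE.length_le (by decide) hx'
  have hfl : ((structureOf Λ.b).visits Λ.b q.y q.z).flatMap (countVisitor Λ.b q.x).outs = [] :=
    List.flatMap_eq_nil_iff.mpr fun _ _ => rfl
  simp only [St.emit, hout, hfl, List.nil_append] at hmap
  obtain ⟨a, rfl, ha⟩ := List.map_eq_singleton_iff.mp hmap
  refine ⟨_, a, ho, by rw [ha, hacc, hsum], ?_⟩
  have htime : (((structureOf Λ.b).visits Λ.b q.y q.z).map (countVisitor Λ.b q.x).time).sum =
      4 * ((structureOf Λ.b).visits Λ.b q.y q.z).length := by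
    simp [countVisitor, mul_comm]
  have hv := visits_le_cube hE.valid.s_pos (length_visits_structureOf_le Λ.b hs q.y q.z)
  have hw := walk_time_le hE.valid.s_pos (depth_structureOf_le Λ.b hlt)
  have hpos : 0 < Λ.s ^ 3 := pow_pos hE.valid.s_pos 3
  simp only [Expr.cost]
  omega

/-- A visit has `6` steps of its own, and `7412 + 6 * 48 = 7700`. All other time is charged to the
reported boxes, whose total number is the sum of the prefix lengths. -/
theorem report_query (hE : Env Λ M) (hs : Nat.log 2 n = Λ.s) {root J : ℕ}
    (hJ : ∀ h ≤ Λ.s, jumpSteps Λ.d h ≤ J) (h0 : M[0]? = some root) (h1 : M[1]? = some Λ.s)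
    (hL : (structureOf Λ.b).Laid Λ M root) (q : Point) :
    ∃ (t : ℕ) (out : List (BitVec Λ.w)), AnswersIn
      (Stmt.program (segmentWalk reportVisit)) (M.map (BitVec.ofNat Λ.w))
        (coordsOf Λ.b) q t out ∧
      out.map BitVec.toNat = (((structureOf Λ.b).visits Λ.b q.y q.z).flatMap
        (RangeTree.piece Λ.b q.x)).map Fin.val ∧
      t ≤ 7700 * Λ.s ^ 3 + (stabbed Λ.b q).card * (84 * J + 110) := by
  have hlt := hE.valid.lt_two_pow
  have hH := height_of_mem_intervalTrees Λ.b
  rw [hs] at hH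
  have hsum : ((((structureOf Λ.b).visits Λ.b q.y q.z).map
      (reportVisitor Λ.b q.x J).add)).sum = 0 := by simp [reportVisitor]
  obtain ⟨t, σ', hx, ht, -, hout⟩ := segmentWalk_spec hE (reportVisit_spec hE q.x hJ)
    (structureOf Λ.b) (depth_of_mem_intervalTrees Λ.b hlt) hH hL h0 h1 (by rw [hsum]; positivity)
  obtain ⟨out, ho, hmap⟩ := Exec.answersIn hE.lt hE.length_le (by decide) hx
  refine ⟨t, out, ho, ?_, ?_⟩
  · rw [hmap, hout, List.map_flatMap]; rfl
  have htime : (((structureOf Λ.b).visits Λ.b q.y q.z).map (reportVisitor Λ.b q.x J).time).sum =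
      6 * ((structureOf Λ.b).visits Λ.b q.y q.z).length +
        (stabbed Λ.b q).card * (84 * J + 110) := by
    rw [← sum_count_visits, ← List.sum_map_mul_right]
    simp only [reportVisitor, List.sum_map_add, List.map_const', List.sum_replicate, smul_eq_mul]
    ring
  have hv := visits_le_cube hE.valid.s_pos (length_visits_structureOf_le Λ.b hs q.y q.z)
  have hw := walk_time_le hE.valid.s_pos (depth_structureOf_le Λ.b hlt)
  omega

end Queries

/-- The summands `5 * n` and `15` make the same bound account for the coordinate cells and give the
room for coordinate addresses and literals that `Layout.Valid` asks for. -/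
theorem space_le {n s c₀ nodes boxes : ℕ} (hn : 2 ≤ n) (hs : 1 ≤ s) (hnodes : nodes ≤ 4 * n + 1)
    (hboxes : boxes ≤ 4 * (s + 3) * n) :
    n + 2 + (6 * nodes + (2 * c₀ + 25) * boxes) + 5 * n + 15 ≤
      (45 + 16 * (2 * c₀ + 25)) * (n * s) := by
  have h1 : n ≤ n * s := Nat.le_mul_of_pos_right n hs
  have h2 : boxes ≤ 16 * (n * s) := by
    refine hboxes.trans ?_
    have : 4 * (s + 3) ≤ 16 * s := by omega
    calc 4 * (s + 3) * n ≤ 16 * s * n := by gcongr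
      _ = _ := by ring
  have h3 := Nat.mul_le_mul_left (2 * c₀ + 25) h2
  have h4 : (45 + 16 * (2 * c₀ + 25)) * (n * s) =
    45 * (n * s) + (2 * c₀ + 25) * (16 * (n * s)) := by ring
  rw [h4]
  omega

end

end Stabbing

/-! ### Choice of the constants and assembly -/

theorem mainTheorem6 (ε : ℝ) (hε : 0 < ε) :
    ∃ (C : ℝ) (countProg reportProg : Stabbing.Program), 0 < C ∧
      ∀ (n w : ℕ) (b : Fin n → Stabbing.CanonicalBox), 2 ≤ n →
        C * (n * Stabbing.lg n) ≤ 2 ^ w →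
        ∃ (mem : List (BitVec w)) (coords : List (WithTop ℝ)),
          -- the memory holds the three layers of trees, and only coordinates of the boxes
          (∃ root : ℕ, (Stabbing.structureOf b).StoredAt b mem coords root) ∧
          (∀ v ∈ coords, ∃ i, v ∈ (b i).coordinates) ∧
          -- space in words
          ((mem.length + coords.length : ℕ) : ℝ) ≤ C * (n * Stabbing.lg n) ∧
          ∀ q : Stabbing.Point,
            -- counting
            (∃ (t : ℕ) (out : BitVec w), Stabbing.AnswersIn countProg mem coords q t [out] ∧
              out.toNat = (Stabbing.stabbed b q).card ∧
              (t : ℝ) ≤ C * Stabbing.lg n ^ 3) ∧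
            -- reporting
            (∃ (t : ℕ) (out : List (BitVec w)) (pieces : List (List (Fin n))),
              Stabbing.AnswersIn reportProg mem coords q t out ∧
              (t : ℝ) ≤ C * (Stabbing.lg n ^ 3 +
                (Stabbing.stabbed b q).card * Stabbing.lg n ^ ε) ∧
              -- the reported boxes, piece by piece, each stabbed box exactly once
              out.map BitVec.toNat = pieces.flatten.map Fin.val ∧
              pieces.flatten.Nodup ∧
              (∀ i, i ∈ pieces.flatten ↔ i ∈ Stabbing.stabbed b q) ∧
              -- the pieces are disjoint nonempty prefixes of bottom lists
              pieces.Pairwise List.Disjoint ∧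
              (∀ s ∈ pieces, s ≠ [] ∧ ∃ P ∈ Stabbing.bottomLists b, s <+: P) ∧
              (pieces.length : ℝ) ≤ C * Stabbing.lg n ^ 3) := by
  classical
  open Stabbing in
  obtain ⟨c, hc⟩ := exists_jumpSchedule ε hε
  set c₀ := 40 + 9 * c with hc₀
  set C₁ := 45 + 16 * (2 * c₀ + 25) with hC₁
  -- The summands serve the space, the cubic part of the query times, and the time per reported box.
  set C := C₁ + 7700 + (84 * c + 110) with hC
  refine ⟨C, Stmt.program (.seq (segmentWalk countVisit) (.outp (.var 2))),
    Stmt.program (segmentWalk reportVisit), by positivity, ?_⟩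
  intro n w b hn hw
  -- The integer `s = ⌊lg n⌋` is at once the chunk size, the bound on the height indices and the
  -- parameter of the jump schedule. All bounds are proved in terms of `s` and passed on by `s ≤ lg
  -- n`.
  obtain ⟨s, hs⟩ : ∃ s, Nat.log 2 n = s := ⟨_, rfl⟩
  have hs1 : 1 ≤ s := hs ▸ Nat.log_pos (by norm_num) hn
  obtain ⟨d, hd⟩ := hc s hs1
  have hlg : (s : ℝ) ≤ lg n := hs ▸ log_le_lg hn
  have hsR : (1 : ℝ) ≤ s := by exact_mod_cast hs1
  have hlg1 : 1 ≤ lg n := hsR.trans hlg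
  have hlt : n < 2 ^ (s + 1) := hs ▸ Nat.lt_pow_succ_log_self (by norm_num) n
  have hspace := space_le (c₀ := c₀) hn hs1 (nodes_structureOf_le b) (boxes_structureOf_le b hlt)
  rw [← hC₁] at hspace
  have hns : ((C₁ * (n * s) : ℕ) : ℝ) ≤ C * (n * lg n) := by
    rw [Nat.cast_mul, Nat.cast_mul]
    gcongr
    exact_mod_cast (by omega : C₁ ≤ C)
  -- The assumption on the word size becomes the statement that all addresses and stored values fit
  -- into words.
  have hns2 : C₁ * (n * s) ≤ 2 ^ w := by exact_mod_cast hns.trans hw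
  have hpow : 2 ^ s ≤ n := hs ▸ Nat.pow_log_le_self 2 (by omega)
  set Λ : Layout n := ⟨b, w, s, d⟩ with hΛ
  have hval : Λ.Valid := ⟨hs1, hpow, hlt,
    show 5 * n + 15 < 2 ^ w by omega, hd.cases⟩
  obtain ⟨M, root, h0, h1, hpop, hL, hM, hlen⟩ := exists_memory hval (c₀ := c₀)
    (fun h t ht hh => by exact_mod_cast ht.words_le_mul hval hd hh) (by
      show n + 2 + (6 * (structureOf b).nodes + (2 * c₀ + 25) * (structureOf b).boxes) < 2 ^ w; omega)
  change M.length ≤ n + 2 + (6 * (structureOf b).nodes + (2 * c₀ + 25) * (structureOf b).boxes) at hlen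
  have hE : Env Λ M := ⟨hval, hM, hlen.trans (by show _ ≤ 2 ^ w; omega), hpop⟩
  have hw0 : 0 < w := Nat.pos_of_ne_zero fun h => by
    rw [h, pow_zero] at hns2; omega
  have hcube : ((7700 * s ^ 3 : ℕ) : ℝ) ≤ C * lg n ^ 3 := by
    push_cast
    gcongr
    exact_mod_cast (by omega : 7700 ≤ C)
  refine ⟨M.map (BitVec.ofNat w), coordsOf b, ⟨root, hL.storedAt hM hw0⟩, ?_, ?_, ?_⟩
  · intro v hv
    obtain ⟨i, -, hi⟩ := List.mem_flatMap.mp hv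
    exact ⟨i, hi⟩
  · refine le_trans ?_ hns
    rw [List.length_map, length_coordsOf]
    have hle : M.length + 5 * n ≤ C₁ * (n * s) := by omega
    exact_mod_cast hle
  intro q
  refine ⟨?_, ?_⟩
  · obtain ⟨t, out, ha, ho, ht⟩ := count_query hE hs h0 h1 hL q
    exact ⟨t, out, ha, ho, le_trans (by exact_mod_cast ht) hcube⟩
  -- The number of jumps is an integer, so rounding the real bound of the schedule down loses
  -- nothing.
  · set J := ⌊(c : ℝ) * (s : ℝ) ^ ε⌋₊ with hJ
    have hJ' : (J : ℝ) ≤ c * (s : ℝ) ^ ε := Nat.floor_le (by positivity)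
    obtain ⟨t, out, ha, ho, ht⟩ := report_query hE hs (J := J)
      (fun h hh => Nat.le_floor (hd.steps_le h hh)) h0 h1 hL q
    set vs := (structureOf b).visits b q.y q.z with hvs
    -- Visited nodes without a matching box give empty prefixes; these are dropped, which does not
    -- change the output.
    set pieces := (vs.map (RangeTree.piece b q.x)).filter (fun L => !L.isEmpty) with hp
    have hflat : pieces.flatten = vs.flatMap (RangeTree.piece b q.x) := by
      rw [hp, List.flatten_filter_not_isEmpty]; rfl
    obtain ⟨hnd, hmem, -⟩ := stabbed_eq_toFinset b q (L := pieces.flatten) (by rw [hflat])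
    refine ⟨t, out, pieces, ha, ?_, by rw [hflat]; exact ho, hnd, hmem,
      (List.nodup_flatten.mp hnd).2, ?_, ?_⟩
    · have hpow : (s : ℝ) ^ ε ≤ lg n ^ ε := Real.rpow_le_rpow (by positivity) hlg hε.le
      have hone : 1 ≤ (s : ℝ) ^ ε := Real.one_le_rpow hsR hε.le
      have hk : ((84 * J + 110 : ℕ) : ℝ) ≤ C * lg n ^ ε := by
        have hC' : ((84 * c + 110 : ℕ) : ℝ) ≤ C := by exact_mod_cast (by omega)
        calc ((84 * J + 110 : ℕ) : ℝ) = 84 * J + 110 := by push_cast; ring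
          _ ≤ 84 * (c * (s : ℝ) ^ ε) + 110 * (s : ℝ) ^ ε := by linarith
          _ = ((84 * c + 110 : ℕ) : ℝ) * (s : ℝ) ^ ε := by push_cast; ring
          _ ≤ C * lg n ^ ε := by gcongr
      calc (t : ℝ) ≤ ((7700 * s ^ 3 + (stabbed b q).card * (84 * J + 110) : ℕ) : ℝ) := by
            exact_mod_cast ht
        _ = ((7700 * s ^ 3 : ℕ) : ℝ) + (stabbed b q).card * ((84 * J + 110 : ℕ) : ℝ) := by
            push_cast; ring
        _ ≤ C * lg n ^ 3 + (stabbed b q).card * (C * lg n ^ ε) := by gcongr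
        _ = _ := by ring
    · intro L hL'
      rw [hp, List.mem_filter] at hL'
      obtain ⟨v, hv, rfl⟩ := List.mem_map.mp hL'.1
      exact ⟨by simpa using hL'.2, _, bottomList_mem_of_mem_visits b hv, List.take_prefix _ _⟩
    · refine le_trans ?_ hcube
      have h2 := visits_le_cube hs1 (length_visits_structureOf_le b hs q.y q.z)
      have h3 : pieces.length ≤ vs.length := (List.length_filter_le _ _).trans (by simp)
      exact_mod_cast h3.trans (h2.trans (by omega))
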